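/- **Proposition 4.2.** Let $(W,\omega)$ be a finite-dimensional complex symplectic vector space. A *dual pair* in $Sp(W)$ is a pair of subgroups $(G,G')$ that are each other's full centralizers in $Sp(W)$ and that both act completely reducibly on $W$. By a *classical group* in $Sp(W)$ we mean an embedded copy of $GL_n(\mathbb C)$, of $O_n(\mathbb C)$ or of $Sp_n(\mathbb C)$ ($n$ even), $n\ge 1$, for which $W$ is a direct sum of copies of the standard module $\mathbb C^n$ and of its dual; for a *product of two copies of a classical group* we require likewise that $W$ is a direct sum of copies of the standard modules of the two factors and of their duals. A *symmetric subgroup* of a subgroup $G\subset Sp(W)$ is a fixed-point group $H=G^\theta$, where $\theta$ is an automorphism of $G$ with $\theta^2=1$ which is the restriction to $G$ of a linear endomorphism of $\operatorname{End}(W)$. (If $G$ is a classical group or a product of two copies of one, the last condition says that $\theta$ permutes the standard modules and their duals up to isomorphism; it rules out only twists by characters, such as $g\mapsto\det(g)g$ on $O_{2k}$, among the algebraic involutions.) Let $(G,G')$ be a dual pair in $Sp(W)$. 1. Suppose that $G$ is a classical group or a product of two copies of a classical group. Let $H\subset G$ be a symmetric subgroup, and let $H'$ be the centralizer of $H$ in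 $Sp(W)$. Then $(H,H')$ is a dual pair in $Sp(W)$, and $G'$ is a symmetric subgroup of $H'$. 2. Suppose that $(G,H)$ is one of the classical symmetric pairs in the first column of the following table, where the second column gives $W$ as a $G$-module ($V$ is the standard module of $G$; for a product, $V_1$ and $V_2$ are the standard modules of the two factors) and all parameters are positive integers. Then $H$ is a symmetric subgroup of $G$, and, with $H'$ the centralizer of $H$ in $Sp(W)$, the pair $(H',G')$ is the classical symmetric pair in the third column, with $W$ as $H'$-module given by the fourth column ($U$, or $U_1,U_2$, being the standard modules of $H'$). | $(G,H)$ | $W$ under $G$ | $(H',G')$ | $W$ under $H'$ | |---|---|---|---| | $(GL_n\times GL_n,\,GL_n)$ | $m(V_1\oplus V_1^*)\oplus l(V_2\oplus V_2^*)$ | $(GL_{m+l},\,GL_m\times GL_l)$ | $n(U\oplus U^*)$ | | $(O_n\times O_n,\,O_n)$ | $2mV_1\oplus 2lV_2$ | $(Sp_{2(m+l)},\,Sp_{2m}\times Sp_{2l})$ | $nU$ | | $(Sp_{2n}\times Sp_{2n},\,Sp_{2n})$ | $mV_1\oplus lV_2$ | $(O_{m+l},\,O_m\times O_l)$ | $2nU$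 | | $(GL_{n+m},\,GL_n\times GL_m)$ | $l(V\oplus V^*)$ | $(GL_l\times GL_l,\,GL_l)$ | $n(U_1\oplus U_1^*)\oplus m(U_2\oplus U_2^*)$ | | $(O_{n+m},\,O_n\times O_m)$ | $2lV$ | $(Sp_{2l}\times Sp_{2l},\,Sp_{2l})$ | $nU_1\oplus mU_2$ | | $(Sp_{2(n+m)},\,Sp_{2n}\times Sp_{2m})$ | $lV$ | $(O_l\times O_l,\,O_l)$ | $2nU_1\oplus 2mU_2$ | | $(O_{2n},\,GL_n)$ | $2mV$ | $(GL_{2m},\,Sp_{2m})$ | $n(U\oplus U^*)$ | | $(Sp_{2n},\,GL_n)$ | $mV$ | $(GL_m,\,O_m)$ | $n(U\oplus U^*)$ | | $(GL_n,\,O_n)$ | $m(V\oplus V^*)$ | $(Sp_{2m},\,GL_m)$ | $nU$ | | $(GL_{2n},\,Sp_{2n})$ | $m(V\oplus V^*)$ | $(O_{2m},\,GL_m)$ | $2nU$ | Here $H\subset G$ is, respectively, the diagonal (rows 1–3); the stabilizer of a direct sum decomposition of the standard module, orthogonal for $O$ and $Sp$ (rows 4–6); the stabilizer of a decomposition of the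 standard module into two complementary totally isotropic subspaces (rows 7–8); the isometry group of a nondegenerate symmetric, respectively alternating, bilinear form on the standard module (rows 9–10). The same descriptions apply to $G'\subset H'$. In particular, passing from $(G,H)$ to $(H',G')$ groups the ten families of classical symmetric pairs into five reciprocal pairs of families. -/

import Mathlib

namespace Reciprocity

universe u

/-- The group of all linear automorphisms of `V` preserving the bilinear form `B`.  For `B`
nondegenerate symmetric this is the orthogonal group of `B`, for `B` nondegenerate alternating the
symplectic group of `B`. -/
def isometryGroup {V : Type u} [AddCommGroup V] [Module ℂ V] (B : LinearMap.BilinForm ℂ V) :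
    Subgroup (V ≃ₗ[ℂ] V) where
  carrier := {g | ∀ x y, B (g x) (g y) = B x y}
  one_mem' := fun _ _ => rfl
  mul_mem' := by
    intro g h hg hh x y
    rw [LinearEquiv.mul_apply, LinearEquiv.mul_apply, hg, hh]
  inv_mem' := by
    intro g hg x y
    have h := hg (g⁻¹ x) (g⁻¹ y)
    rw [← LinearEquiv.mul_apply, ← LinearEquiv.mul_apply, mul_inv_cancel] at h
    exact h.symm

/-- The automorphisms of `V` stabilizing both subspaces `X` and `Y`. -/
def blockGroup {V : Type u} [AddCommGroup V] [Module ℂ V] (X Y : Submodule ℂ V) :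
    Subgroup (V ≃ₗ[ℂ] V) where
  carrier := {g | (∀ x, g x ∈ X ↔ x ∈ X) ∧ (∀ x, g x ∈ Y ↔ x ∈ Y)}
  one_mem' := ⟨fun _ => Iff.rfl, fun _ => Iff.rfl⟩
  mul_mem' := by
    rintro g h ⟨hg, hg'⟩ ⟨hh, hh'⟩
    refine ⟨fun x => ?_, fun x => ?_⟩
    · rw [LinearEquiv.mul_apply, hg, hh]
    · rw [LinearEquiv.mul_apply, hg', hh']
  inv_mem' := by
    rintro g ⟨hg, hg'⟩
    refine ⟨fun x => ?_, fun x => ?_⟩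
    · have h := hg (g⁻¹ x)
      rw [← LinearEquiv.mul_apply, mul_inv_cancel] at h
      exact h.symm
    · have h := hg' (g⁻¹ x)
      rw [← LinearEquiv.mul_apply, mul_inv_cancel] at h
      exact h.symm

section

variable {W : Type u} [AddCommGroup W] [Module ℂ W] {ω : LinearMap.BilinForm ℂ W}

/-- The tautological representation on `W` of a subgroup of the symplectic group of `(W, ω)`. -/
def tautRep (G : Subgroup (isometryGroup ω)) : Representation ℂ G W :=
  (LinearEquiv.automorphismGroup.toLinearMapMonoidHom.comp (isometryGroup ω).subtype).comp
    G.subtype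

/-- The centralizer of `G` in the symplectic group. -/
abbrev commutant (G : Subgroup (isometryGroup ω)) : Subgroup (isometryGroup ω) :=
  Subgroup.centralizer (G : Set (isometryGroup ω))

/-- A (reductive) dual pair in `Sp(W, ω)`: two subgroups which are the full centralizers of each
other and which both act reductively (completely reducibly) on `W`. -/
structure IsDualPair (G G' : Subgroup (isometryGroup ω)) : Prop where
  eq_left : G = commutant G'
  eq_right : G' = commutant G
  reductive_left : Representation.IsSemisimpleRepresentation (tautRep G)
  reductive_right : Representation.IsSemisimpleRepresentation (tautRep G')

/-- `H` is a symmetric subgroup of `G`: the fixed-point group of an automorphism `θ` of `G` with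
`θ² = 1`.  As always for classical symmetric pairs, `θ` is compatible with the linear structure
of `G`: it is the restriction to `G` of a linear map on endomorphisms.  (For a classical group,
or a product of two, this says that `θ` permutes the standard modules and their duals up to
isomorphism.  Among algebraic involutions it discards only twists by characters, such as
`g ↦ det(g) g` on `O₂ₖ`.) -/
def IsSymmetricSubgroup (H G : Subgroup (isometryGroup ω)) : Prop :=
  ∃ θ : G ≃* G,
    (∀ g, θ (θ g) = g) ∧
    (∃ T : Module.End ℂ W →ₗ[ℂ] Module.End ℂ W, ∀ g : G, T (tautRep G g) = tautRep G (θ g)) ∧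
    H = (MonoidHom.eqLocus θ.toMonoidHom (MonoidHom.id G)).map G.subtype

/-- The space `ℂⁿ` of the standard module. -/
abbrev Std (n : ℕ) : Type := Fin n → ℂ

/-- The general linear, orthogonal and symplectic groups on `ℂⁿ` (the latter two with respect to
any nondegenerate symmetric, respectively alternating, form). -/
def IsClassicalGroup {n : ℕ} (C : Subgroup (Std n ≃ₗ[ℂ] Std n)) : Prop :=
  C = ⊤ ∨
  (∃ B : LinearMap.BilinForm ℂ (Std n), B.IsSymm ∧ B.Nondegenerate ∧ C = isometryGroup B) ∨
  (∃ B : LinearMap.BilinForm ℂ (Std n), B.IsAlt ∧ B.Nondegenerate ∧ C = isometryGroup B)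

/-- `φ` embeds the linear group `C` in `Sp(W, ω)` in such a way that `W` becomes the sum of `a`
copies of the standard module `ℂⁿ` of `C` and `b` copies of its dual. -/
def IsStandard {n : ℕ} {C : Subgroup (Std n ≃ₗ[ℂ] Std n)} (φ : C →* isometryGroup ω)
    (a b : ℕ) : Prop :=
  Function.Injective φ ∧
  ∃ e : W ≃ₗ[ℂ] (Fin a → Std n) × (Fin b → Module.Dual ℂ (Std n)),
    ∀ (g : C) (w : W),
      (∀ i, (e ((φ g : W ≃ₗ[ℂ] W) w)).1 i = (g : Std n ≃ₗ[ℂ] Std n) ((e w).1 i)) ∧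
      (∀ j v, (e ((φ g : W ≃ₗ[ℂ] W) w)).2 j v =
        (e w).2 j ((g⁻¹ : Std n ≃ₗ[ℂ] Std n) v))

/-- `φ` embeds `C × C` in `Sp(W, ω)` in such a way that `W` becomes the sum of `a` copies of the
standard module `ℂⁿ` of the first factor, `b` copies of its dual, `c` copies of the standard module
of the second factor and `d` copies of its dual. -/
def IsStandardSq {n : ℕ} {C : Subgroup (Std n ≃ₗ[ℂ] Std n)} (φ : C × C →* isometryGroup ω)
    (a b c d : ℕ) : Prop :=
  Function.Injective φ ∧
  ∃ e : W ≃ₗ[ℂ] ((Fin a → Std n) × (Fin b → Module.Dual ℂ (Std n))) ×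
      ((Fin c → Std n) × (Fin d → Module.Dual ℂ (Std n))),
    ∀ (g h : C) (w : W),
      (∀ i, (e ((φ (g, h) : W ≃ₗ[ℂ] W) w)).1.1 i =
        (g : Std n ≃ₗ[ℂ] Std n) ((e w).1.1 i)) ∧
      (∀ j v, (e ((φ (g, h) : W ≃ₗ[ℂ] W) w)).1.2 j v =
        (e w).1.2 j ((g⁻¹ : Std n ≃ₗ[ℂ] Std n) v)) ∧
      (∀ i, (e ((φ (g, h) : W ≃ₗ[ℂ] W) w)).2.1 i =
        (h : Std n ≃ₗ[ℂ] Std n) ((e w).2.1 i)) ∧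
      (∀ j v, (e ((φ (g, h) : W ≃ₗ[ℂ] W) w)).2.2 j v =
        (e w).2.2 j ((h⁻¹ : Std n ≃ₗ[ℂ] Std n) v))

/-- `G ⊆ Sp(W, ω)` is a classical group (acting on `W` through its standard module). -/
def IsClassical (G : Subgroup (isometryGroup ω)) : Prop :=
  ∃ (n a b : ℕ) (C : Subgroup (Std n ≃ₗ[ℂ] Std n)) (φ : C →* isometryGroup ω),
    0 < n ∧ IsClassicalGroup C ∧ IsStandard φ a b ∧ G = φ.range

/-- `G ⊆ Sp(W, ω)` is a product of two copies of a classical group (acting on `W` through the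
standard modules of the two factors). -/
def IsClassicalSq (G : Subgroup (isometryGroup ω)) : Prop :=
  ∃ (n a b c d : ℕ) (C : Subgroup (Std n ≃ₗ[ℂ] Std n)) (φ : C × C →* isometryGroup ω),
    0 < n ∧ IsClassicalGroup C ∧ IsStandardSq φ a b c d ∧ G = φ.range

/-- The pair `(C, D ∩ C)` of linear groups on `ℂⁿ`, embedded as `(G, H)` in `Sp(W, ω)`, where `W`
is `a` copies of the standard module of `C` and `b` copies of its dual. -/
def IsSinglePair {n : ℕ} (C D : Subgroup (Std n ≃ₗ[ℂ] Std n)) (a b : ℕ)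
    (G H : Subgroup (isometryGroup ω)) : Prop :=
  ∃ φ : C →* isometryGroup ω,
    IsStandard φ a b ∧ G = φ.range ∧ H = (D.subgroupOf C).map φ

/-- The pair `(C × C, C)`, with `C` diagonal, embedded as `(G, H)` in `Sp(W, ω)`, with
multiplicities of the standard modules and their duals as in `IsStandardSq`. -/
def IsDiagonalPair {n : ℕ} (C : Subgroup (Std n ≃ₗ[ℂ] Std n)) (a b c d : ℕ)
    (G H : Subgroup (isometryGroup ω)) : Prop :=
  ∃ φ : C × C →* isometryGroup ω,
    IsStandardSq φ a b c d ∧ G = φ.range ∧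
      H = (φ.comp ((MonoidHom.id C).prod (MonoidHom.id C))).range

end

/-- The ten families of classical symmetric pairs `(G, H)`, together with the multiplicities with
which the standard modules of `G` occur in the symplectic space.
* `diagGL n m l`: `(GLₙ × GLₙ, GLₙ)`, the two factors occurring `m` and `l` times;
* `diagO n m l`: `(Oₙ × Oₙ, Oₙ)`, the two factors occurring `2m` and `2l` times;
* `diagSp n m l`: `(Sp₂ₙ × Sp₂ₙ, Sp₂ₙ)`, the two factors occurring `m` and `l` times;
* `sumGL n m l`: `(GLₙ₊ₘ, GLₙ × GLₘ)`, `l` times;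
* `sumO n m l`: `(Oₙ₊ₘ, Oₙ × Oₘ)`, `2l` times;
* `sumSp n m l`: `(Sp₂₍ₙ₊ₘ₎, Sp₂ₙ × Sp₂ₘ)`, `l` times;
* `polO n m`: `(O₂ₙ, GLₙ)`, `2m` times;
* `polSp n m`: `(Sp₂ₙ, GLₙ)`, `m` times;
* `bilO n m`: `(GLₙ, Oₙ)`, `m` times;
* `bilSp n m`: `(GL₂ₙ, Sp₂ₙ)`, `m` times.
For the general linear groups, the duals of the standard modules occur with the same
multiplicities as the standard modules. -/
inductive Family : Type
  | diagGL (n m l : ℕ)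
  | diagO (n m l : ℕ)
  | diagSp (n m l : ℕ)
  | sumGL (n m l : ℕ)
  | sumO (n m l : ℕ)
  | sumSp (n m l : ℕ)
  | polO (n m : ℕ)
  | polSp (n m : ℕ)
  | bilO (n m : ℕ)
  | bilSp (n m : ℕ)

/-- The reciprocal family: this groups the ten families into five pairs
`diagGL ↔ sumGL`, `diagO ↔ sumSp`, `diagSp ↔ sumO`, `polO ↔ bilSp`, `polSp ↔ bilO`. -/
def Family.reciprocal : Family → Family
  | .diagGL n m l => .sumGL m l n
  | .sumGL n m l => .diagGL l n m
  | .diagO n m l => .sumSp m l n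
  | .sumSp n m l => .diagO l n m
  | .diagSp n m l => .sumO m l n
  | .sumO n m l => .diagSp l n m
  | .polO n m => .bilSp m n
  | .bilSp n m => .polO m n
  | .polSp n m => .bilO m n
  | .bilO n m => .polSp m n

theorem Family.reciprocal_reciprocal (r : Family) : r.reciprocal.reciprocal = r := by
  cases r <;> rfl

/-- `(G, H)`, inside `Sp(W, ω)`, is a classical symmetric pair of the given family. -/
def Family.IsPair {W : Type u} [AddCommGroup W] [Module ℂ W] {ω : LinearMap.BilinForm ℂ W}
    (r : Family) (G H : Subgroup (isometryGroup ω)) : Prop :=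
  match r with
  | .diagGL n m l =>
      0 < n ∧ IsDiagonalPair (⊤ : Subgroup (Std n ≃ₗ[ℂ] Std n)) m m l l G H
  | .diagO n m l =>
      0 < n ∧ ∃ B : LinearMap.BilinForm ℂ (Std n), B.IsSymm ∧ B.Nondegenerate ∧
        IsDiagonalPair (isometryGroup B) (2 * m) 0 (2 * l) 0 G H
  | .diagSp n m l =>
      0 < n ∧ ∃ B : LinearMap.BilinForm ℂ (Std (2 * n)), B.IsAlt ∧ B.Nondegenerate ∧
        IsDiagonalPair (isometryGroup B) m 0 l 0 G H
  | .sumGL n m l =>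
      0 < n ∧ 0 < m ∧ ∃ X Y : Submodule ℂ (Std (n + m)), IsCompl X Y ∧
        Module.finrank ℂ X = n ∧ Module.finrank ℂ Y = m ∧
        IsSinglePair ⊤ (blockGroup X Y) l l G H
  | .sumO n m l =>
      0 < n ∧ 0 < m ∧ ∃ B : LinearMap.BilinForm ℂ (Std (n + m)), B.IsSymm ∧ B.Nondegenerate ∧
        ∃ X Y : Submodule ℂ (Std (n + m)), IsCompl X Y ∧
        Module.finrank ℂ X = n ∧ Module.finrank ℂ Y = m ∧ (∀ x ∈ X, ∀ y ∈ Y, B x y = 0) ∧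
        IsSinglePair (isometryGroup B) (blockGroup X Y) (2 * l) 0 G H
  | .sumSp n m l =>
      0 < n ∧ 0 < m ∧ ∃ B : LinearMap.BilinForm ℂ (Std (2 * (n + m))), B.IsAlt ∧
        B.Nondegenerate ∧
        ∃ X Y : Submodule ℂ (Std (2 * (n + m))), IsCompl X Y ∧
        Module.finrank ℂ X = 2 * n ∧ Module.finrank ℂ Y = 2 * m ∧
        (∀ x ∈ X, ∀ y ∈ Y, B x y = 0) ∧
        IsSinglePair (isometryGroup B) (blockGroup X Y) l 0 G H
  | .polO n m =>
      0 < n ∧ ∃ B : LinearMap.BilinForm ℂ (Std (2 * n)), B.IsSymm ∧ B.Nondegenerate ∧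
        ∃ X Y : Submodule ℂ (Std (2 * n)), IsCompl X Y ∧
        (∀ x ∈ X, ∀ x' ∈ X, B x x' = 0) ∧ (∀ y ∈ Y, ∀ y' ∈ Y, B y y' = 0) ∧
        IsSinglePair (isometryGroup B) (blockGroup X Y) (2 * m) 0 G H
  | .polSp n m =>
      0 < n ∧ ∃ B : LinearMap.BilinForm ℂ (Std (2 * n)), B.IsAlt ∧ B.Nondegenerate ∧
        ∃ X Y : Submodule ℂ (Std (2 * n)), IsCompl X Y ∧
        (∀ x ∈ X, ∀ x' ∈ X, B x x' = 0) ∧ (∀ y ∈ Y, ∀ y' ∈ Y, B y y' = 0) ∧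
        IsSinglePair (isometryGroup B) (blockGroup X Y) m 0 G H
  | .bilO n m =>
      0 < n ∧ ∃ B : LinearMap.BilinForm ℂ (Std n), B.IsSymm ∧ B.Nondegenerate ∧
        IsSinglePair ⊤ (isometryGroup B) m m G H
  | .bilSp n m =>
      0 < n ∧ ∃ B : LinearMap.BilinForm ℂ (Std (2 * n)), B.IsAlt ∧ B.Nondegenerate ∧
        IsSinglePair ⊤ (isometryGroup B) m m G H

end Reciprocity

/-!
Everything takes place in the algebra `End W` with the anti-involution `σ` given by the adjoint
with respect to `ω`; the symplectic group consists of the elements with `σ g * g = 1`. The first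
fact is that a semisimple subalgebra stable under `σ` is generated by the isometries it contains
(`le_of_unitary_mem`, `groupAlg_unitaries`). Indeed the Cayley transform and the reflections
`2 e - 1` show that the generated subalgebra contains the skew elements and the Hermitian
idempotents, and a Hermitian element orthogonal to it under the trace form is a nilpotent which
anticommutes with the skew elements; such an element has square zero, and pairing it with a
Hermitian quasi-inverse of square zero shows that it vanishes. Together with the double centralizer
theorem, the isometries in such an algebra and those in its centralizer form a dual pair
(`isDualPair_unitaries`).

Let `(G, G')` be a dual pair and `A` the algebra generated by `G`. An involution of `G` which is
the restriction of a linear map is an involution of `A` commuting with `σ`, and `A` is the sum of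
an even and an odd part. The even part is semisimple (`isSemisimpleRing_even`) and `H` consists of
its isometries, so `(H, H')` is a dual pair. The ideal generated by the odd part has a unit
`e = ∑ xᵢ yᵢ` with odd `xᵢ` and `yᵢ`, and `b ↦ b (1 - e) + ∑ xᵢ b yᵢ` is an involution of the
centralizer of the even part with fixed algebra the centralizer of `A` (`exists_reciprocal`). Hence
`G'` is symmetric in `H'` (`reciprocity`).

For the classical families, `W` is written in coordinates `ι → U`, where `ι` indexes a basis of the
standard module, or of its sum with the dual, and `U` is the multiplicity space. By Schur's lemma
the form `ω` becomes the product of a form on the index space and a form `β` on `U`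
(`exists_multiplicity_form`, `exists_pairing_eq`, `exists_hyperbolic_coordinates`); as `ω` is
alternating, `β` is alternating when the form of the standard module is symmetric, and conversely.
The groups `G` and `H` generate all matrices which are block diagonal for a partition of `ι`, so
their commutants consist of families of automorphisms of `U`, constant on the classes of the
partition and compatible with `β` (`mem_map_commutant_iff`). When `G` is not of this form, it is
generated by `H` and a single element which becomes a scaling of two complementary subspaces of `U`
(`mem_commutant_iff_of_generation`); the compatibility of the scaling with `β` decides whether
these subspaces are orthogonal or isotropic. The involution of `G` is inner, or the exchange of two
factors, or the contragredient; the last two extend linearly because the condition that a linear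
combination of group elements vanishes on `W` is invariant under them.
-/

namespace Reciprocity

universe u v

/-! ### Algebras generated by their unitary elements -/

section Spanning

variable {W : Type u} [AddCommGroup W] [Module ℂ W]

/-- A linear anti-involution of `End W` which preserves the trace; the example is the adjoint
with respect to a nondegenerate `±`-symmetric form. -/
structure IsTraceInvolution (σ : Module.End ℂ W →ₗ[ℂ] Module.End ℂ W) : Prop where
  map_mul : ∀ a b, σ (a * b) = σ b * σ a
  invol : ∀ a, σ (σ a) = a
  trace : ∀ a, LinearMap.trace ℂ W (σ a) = LinearMap.trace ℂ W a

/-- Von Neumann regularity of a subalgebra of `End W`. -/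
def IsRegularAlg (A : Subalgebra ℂ (Module.End ℂ W)) : Prop :=
  ∀ h ∈ A, ∃ a ∈ A, h * a * h = h

namespace IsTraceInvolution

variable {σ : Module.End ℂ W →ₗ[ℂ] Module.End ℂ W} (hσ : IsTraceInvolution σ)

include hσ

theorem map_one : σ 1 = 1 := by
  have h := hσ.map_mul (σ 1) 1
  rw [mul_one, hσ.invol, mul_one] at h
  exact h.symm

theorem map_pow (a : Module.End ℂ W) (k : ℕ) : σ (a ^ k) = σ a ^ k := by
  induction k with
  | zero => simpa using hσ.map_one
  | succ k ih => rw [pow_succ, hσ.map_mul, ih, pow_succ']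

theorem map_aeval {h : Module.End ℂ W} (hh : σ h = h) (p : Polynomial ℂ) :
    σ (Polynomial.aeval h p) = Polynomial.aeval h p := by
  induction p using Polynomial.induction_on' with
  | add p q hp hq => simp [hp, hq]
  | monomial n a =>
    rw [Polynomial.aeval_monomial, Algebra.algebraMap_eq_smul_one, smul_mul_assoc, one_mul,
      map_smul, hσ.map_pow, hh]

end IsTraceInvolution

theorem aeval_mem_of_mem {A : Subalgebra ℂ (Module.End ℂ W)} {h : Module.End ℂ W} (hh : h ∈ A)
    (p : Polynomial ℂ) : Polynomial.aeval h p ∈ A :=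
  (Algebra.adjoin_le (Set.singleton_subset_iff.mpr hh) : Algebra.adjoin ℂ {h} ≤ A)
    (Polynomial.aeval_mem_adjoin_singleton ℂ h)

/-- Hermitian idempotents `e` come from the unitary elements `2 e - 1`. -/
theorem idempotent_mem_of_unitary_mem {σ : Module.End ℂ W →ₗ[ℂ] Module.End ℂ W}
    (hσ : IsTraceInvolution σ) {A B : Subalgebra ℂ (Module.End ℂ W)}
    (hB : ∀ u ∈ A, σ u * u = 1 → u ∈ B)
    {e : Module.End ℂ W} (he : e ∈ A) (hh : σ e = e) (hid : e * e = e) : e ∈ B := by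
  have h1 : (2 : ℂ) • e - 1 ∈ B := by
    refine hB _ (A.sub_mem (A.smul_mem he _) A.one_mem) ?_
    rw [map_sub, map_smul, hh, hσ.map_one]
    simp only [sub_mul, mul_sub, smul_mul_assoc, mul_smul_comm, hid, mul_one, one_mul]
    module
  have h2 : e = (2 : ℂ)⁻¹ • (((2 : ℂ) • e - 1) + 1) := by module
  rw [h2]
  exact B.smul_mem (B.add_mem h1 B.one_mem) _

variable [FiniteDimensional ℂ W]

/-- A finite-dimensional subalgebra contains the inverses of its invertible elements. -/
theorem inv_mem_subalgebra {A : Subalgebra ℂ (Module.End ℂ W)} {y v : Module.End ℂ W}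
    (hy : y ∈ A) (h : y * v = 1) : v ∈ A := by
  have h' : v * y = 1 := mul_eq_one_comm.mp h
  have hinj : Function.Injective (LinearMap.mulLeft ℂ (⟨y, hy⟩ : A)) := by
    intro a b hab
    have hab' : y * (a : Module.End ℂ W) = y * b := congrArg Subtype.val hab
    ext1
    calc (a : Module.End ℂ W) = v * y * a := by rw [h', one_mul]
      _ = v * y * b := by rw [mul_assoc, hab', mul_assoc]
      _ = b := by rw [h', one_mul]
  obtain ⟨z, hz⟩ := LinearMap.surjective_of_injective hinj 1
  have hz' : y * (z : Module.End ℂ W) = 1 := congrArg Subtype.val hz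
  have : (z : Module.End ℂ W) = v := by
    calc (z : Module.End ℂ W) = v * y * z := by rw [h', one_mul]
      _ = v := by rw [mul_assoc, hz', mul_one]
  exact this ▸ z.2

/-- The trace form is nondegenerate on a von Neumann regular algebra: if `d * a * d = d`, the trace
of the idempotent `d * a` is its rank. -/
theorem eq_zero_of_trace_mul {A : Subalgebra ℂ (Module.End ℂ W)} (hreg : IsRegularAlg A)
    {d : Module.End ℂ W} (hd : d ∈ A)
    (h : ∀ a ∈ A, LinearMap.trace ℂ W (d * a) = 0) : d = 0 := by
  obtain ⟨a, ha, hdad⟩ := hreg d hd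
  have hid : IsIdempotentElem (d * a) := by
    rw [IsIdempotentElem, ← mul_assoc, hdad]
  have := (LinearMap.IsIdempotentElem.trace_eq_zero_iff hid).mp (h a ha)
  rw [← hdad, this, zero_mul]

/-- A Hermitian element which pairs to zero, under the trace, with all Hermitian idempotents
that are polynomials in it, is nilpotent. -/
theorem isNilpotent_of_trace_mul_idempotent (h : Module.End ℂ W)
    (H : ∀ p : Polynomial ℂ, IsIdempotentElem (Polynomial.aeval h p) →
      LinearMap.trace ℂ W (h * Polynomial.aeval h p) = 0) : IsNilpotent h := by
  classical
  set P := minpoly ℂ h with hP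
  have hP0 : P ≠ 0 := minpoly.ne_zero (Algebra.IsIntegral.isIntegral h)
  by_cases hroot : ∀ μ : ℂ, P.IsRoot μ → μ = 0
  · have hs := (IsAlgClosed.splits P).eq_prod_roots
    have hr : P.roots = Multiset.replicate (Multiset.card P.roots) 0 :=
      Multiset.eq_replicate_card.mpr fun b hb => hroot b (Polynomial.isRoot_of_mem_roots hb)
    rw [hr] at hs
    have hm : P.leadingCoeff = 1 := minpoly.monic (Algebra.IsIntegral.isIntegral h)
    refine ⟨Multiset.card P.roots, ?_⟩
    have h0 : Polynomial.aeval h P = 0 := minpoly.aeval ℂ h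
    rw [hs, hm] at h0
    simpa using h0
  · exfalso
    push Not at hroot
    -- `b * q` evaluates to the projection onto the generalized eigenspace of a nonzero `μ`
    obtain ⟨μ, hμ, hμ0⟩ := hroot
    obtain ⟨q, hq, hnd⟩ := Polynomial.exists_eq_pow_rootMultiplicity_mul_and_not_dvd P hP0 μ
    set k := P.rootMultiplicity μ
    have hk : 0 < k := (Polynomial.rootMultiplicity_pos hP0).mpr hμ
    have hcop : IsCoprime ((Polynomial.X - Polynomial.C μ) ^ k) q :=
      IsCoprime.pow_left (((Polynomial.irreducible_X_sub_C μ).coprime_iff_not_dvd).mpr hnd)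
    obtain ⟨a, b, hab⟩ := hcop
    have hPh : Polynomial.aeval h ((Polynomial.X - Polynomial.C μ) ^ k * q) = 0 := by
      rw [← hq]; exact minpoly.aeval ℂ h
    have hid : IsIdempotentElem (Polynomial.aeval h (b * q)) := by
      have h1 : b * q * (b * q) =
          b * q - (a * b) * ((Polynomial.X - Polynomial.C μ) ^ k * q) := by
        linear_combination (b * q) * hab
      rw [IsIdempotentElem, ← map_mul, h1, map_sub, map_mul _ (a * b), hPh, mul_zero, sub_zero]
    have hnil : IsNilpotent (Polynomial.aeval h ((Polynomial.X - Polynomial.C μ) * (b * q))) := by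
      refine ⟨k, ?_⟩
      obtain ⟨j, hj⟩ : ∃ j, k = j + 1 := ⟨k - 1, by omega⟩
      have : ((Polynomial.X - Polynomial.C μ) * (b * q)) ^ k =
          (b ^ k * q ^ j) * ((Polynomial.X - Polynomial.C μ) ^ k * q) := by
        rw [hj, mul_pow, mul_pow, pow_succ q j]; ring
      rw [← map_pow, this, map_mul, hPh, mul_zero]
    have ht := (LinearMap.isNilpotent_trace_of_isNilpotent hnil).eq_zero
    have he : Polynomial.aeval h ((Polynomial.X - Polynomial.C μ) * (b * q)) =
        h * Polynomial.aeval h (b * q) - μ • Polynomial.aeval h (b * q) := by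
      rw [map_mul _ (Polynomial.X - Polynomial.C μ), map_sub, Polynomial.aeval_X,
        Polynomial.aeval_C, sub_mul, Algebra.smul_def]
    rw [he, map_sub, H _ hid, map_smul, zero_sub, neg_eq_zero, smul_eq_mul] at ht
    have he0 := (LinearMap.IsIdempotentElem.trace_eq_zero_iff hid).mp
      ((mul_eq_zero.mp ht).resolve_left hμ0)
    have hq0 : Polynomial.aeval h q = 0 := by
      have h1 : q = a * ((Polynomial.X - Polynomial.C μ) ^ k * q) + q * (b * q) := by
        linear_combination (-q) * hab
      rw [h1, map_add, map_mul _ a, hPh, map_mul _ q, he0, mul_zero, mul_zero, add_zero]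
    have hdvd : P ∣ q := minpoly.dvd ℂ h hq0
    apply hnd
    exact (dvd_pow_self _ hk.ne').trans ((Dvd.intro _ hq.symm).trans hdvd)

variable {σ : Module.End ℂ W →ₗ[ℂ] Module.End ℂ W} (hσ : IsTraceInvolution σ)
  {A B : Subalgebra ℂ (Module.End ℂ W)}

include hσ in
/-- Skew elements are obtained from unitary ones by the Cayley transform. -/
theorem skew_mem_of_unitary_mem (hB : ∀ u ∈ A, σ u * u = 1 → u ∈ B)
    {x : Module.End ℂ W} (hx : x ∈ A) (hsk : σ x = -x) : x ∈ B := by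
  obtain ⟨μ, hμ⟩ : ∃ μ : ℂ, μ ∉ spectrum ℂ x ∪ {0} :=
    ((Module.End.finite_spectrum x).union (Set.finite_singleton 0)).exists_notMem
  rw [Set.mem_union, not_or, Set.mem_singleton_iff] at hμ
  obtain ⟨hμ1, hμ0⟩ := hμ
  rw [spectrum.notMem_iff] at hμ1
  obtain ⟨y, hy⟩ := hμ1
  have hyv : (μ • 1 - x) * (↑y⁻¹ : Module.End ℂ W) = 1 := by
    rw [← Algebra.algebraMap_eq_smul_one, ← hy, Units.mul_inv]
  have hvy := mul_eq_one_comm.mp hyv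
  generalize (↑y⁻¹ : Module.End ℂ W) = v at hyv hvy
  have hyA : μ • 1 - x ∈ A := A.sub_mem (A.smul_mem A.one_mem _) hx
  have hvA : v ∈ A := inv_mem_subalgebra hyA hyv
  have hσv : (μ • 1 + x) * σ v = 1 := by
    have := congrArg σ hvy
    rwa [hσ.map_mul, hσ.map_one, map_sub, map_smul, hσ.map_one, hsk, sub_neg_eq_add] at this
  have hσv' := mul_eq_one_comm.mp hσv
  have hu : (μ • 1 + x) * v ∈ B := by
    refine hB _ (A.mul_mem (A.add_mem (A.smul_mem A.one_mem _) hx) hvA) ?_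
    rw [hσ.map_mul, map_add, map_smul, hσ.map_one, hsk, ← sub_eq_add_neg]
    have hc : (μ • 1 - x) * (μ • 1 + x) = (μ • 1 + x) * (μ • 1 - x) := by
      simp only [mul_add, sub_mul, add_mul, mul_sub, smul_mul_assoc, mul_smul_comm, one_mul,
        mul_one]
      module
    calc σ v * (μ • 1 - x) * ((μ • 1 + x) * v)
        = σ v * ((μ • 1 - x) * (μ • 1 + x)) * v := by simp only [mul_assoc]
      _ = (σ v * (μ • 1 + x)) * ((μ • 1 - x) * v) := by rw [hc]; simp only [mul_assoc]
      _ = 1 := by rw [hσv', hyv, one_mul]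
  have hv : v ∈ B := by
    have h1 : (2 * μ) • v = (μ • 1 + x) * v + 1 := by
      have : μ • v - x * v = 1 := by simpa [sub_mul] using hyv
      rw [add_mul, smul_mul_assoc, one_mul, ← this]
      module
    have h2 : v = (2 * μ)⁻¹ • ((μ • 1 + x) * v + 1) := by
      rw [← h1, smul_smul, inv_mul_cancel₀ (mul_ne_zero two_ne_zero hμ0), one_smul]
    rw [h2]
    exact B.smul_mem (B.add_mem hu B.one_mem) _
  have hyB := inv_mem_subalgebra hv hvy
  have : x = μ • 1 - (μ • 1 - x) := by abel
  rw [this]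
  exact B.sub_mem (B.smul_mem B.one_mem _) hyB

include hσ in
/-- The key step of the spanning theorem: if `h` is orthogonal, under the trace, to the
algebra generated by the unitary elements, then `h = 0`. -/
theorem eq_zero_of_trace_mul_unitary (hA : ∀ a ∈ A, σ a ∈ A) (hreg : IsRegularAlg A)
    (hB : ∀ u ∈ A, σ u * u = 1 → u ∈ B)
    {h : Module.End ℂ W} (hh : h ∈ A) (hN : ∀ b ∈ B, LinearMap.trace ℂ W (h * b) = 0) :
    h = 0 := by
  have tcomm := LinearMap.trace_mul_comm (R := ℂ) (M := W)
  have hskew : ∀ x ∈ A, σ x = -x → x ∈ B := fun x hx hs => skew_mem_of_unitary_mem hσ hB hx hs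
  -- elements orthogonal to `B` are Hermitian, since `B` contains the skew elements
  have hherm : ∀ h ∈ A, (∀ b ∈ B, LinearMap.trace ℂ W (h * b) = 0) → σ h = h := by
    intro h hh hN
    suffices hd : h - σ h = 0 from (sub_eq_zero.mp hd).symm
    refine eq_zero_of_trace_mul hreg (A.sub_mem hh (hA h hh)) fun a ha => ?_
    have hc : a - σ a ∈ B :=
      hskew _ (A.sub_mem ha (hA a ha)) (by rw [map_sub, hσ.invol, neg_sub])
    have h1 := hN _ hc
    have h2 : LinearMap.trace ℂ W (σ h * a) = LinearMap.trace ℂ W (h * σ a) := by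
      rw [← hσ.trace, hσ.map_mul, hσ.invol, tcomm]
    rw [mul_sub, map_sub] at h1
    rw [sub_mul, map_sub, h2, h1]
  have hsh := hherm h hh hN
  have hanti : ∀ x ∈ A, σ x = -x → x * h = -(h * x) := by
    intro x hx hs
    have hxB := hskew x hx hs
    have := hherm (x * h) (A.mul_mem hx hh) fun b hb => by
      rw [mul_assoc, tcomm, mul_assoc]
      exact hN _ (B.mul_mem hb hxB)
    rw [hσ.map_mul, hsh, hs, mul_neg] at this
    exact this.symm
  -- skew `x` anticommute with `h`, in particular the commutators of `h` with Hermitian elements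
  have hcent : ∀ a ∈ A, h * h * a = a * (h * h) := by
    have hsk : ∀ x ∈ A, σ x = -x → h * h * x = x * (h * h) := by
      intro x hx hs
      have h1 := hanti x hx hs
      have h2 : h * x = -(x * h) := by rw [h1, neg_neg]
      rw [mul_assoc, h2, mul_neg, ← mul_assoc, h2, neg_mul, neg_neg, mul_assoc]
    have hhe : ∀ a ∈ A, σ a = a → h * h * a = a * (h * h) := by
      intro a ha hs
      have h1 := hanti (h * a - a * h) (A.sub_mem (A.mul_mem hh ha) (A.mul_mem ha hh))
        (by rw [map_sub, hσ.map_mul, hσ.map_mul, hsh, hs, neg_sub])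
      rw [sub_mul, mul_sub, neg_sub, ← mul_assoc, ← mul_assoc, mul_assoc a h h] at h1
      exact (sub_right_inj.mp h1).symm
    intro a ha
    have h1 := hsk (a - σ a) (A.sub_mem ha (hA a ha)) (by rw [map_sub, hσ.invol, neg_sub])
    have h2 := hhe (a + σ a) (A.add_mem ha (hA a ha)) (by rw [map_add, hσ.invol, add_comm])
    have h3 : a = (2 : ℂ)⁻¹ • ((a - σ a) + (a + σ a)) := by module
    rw [h3, mul_smul_comm, mul_add, h1, h2, ← add_mul, smul_mul_assoc]
  -- `B` contains the Hermitian idempotents of `A`, hence the spectral projections of `h`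
  have hnil : IsNilpotent h := by
    refine isNilpotent_of_trace_mul_idempotent h fun p hp => hN _ ?_
    exact idempotent_mem_of_unitary_mem hσ hB
      (aeval_mem_of_mem hh p) (hσ.map_aeval hsh p) hp
  -- a central nilpotent element of a regular algebra vanishes
  have hsq : h * h = 0 := by
    obtain ⟨a, ha, hza⟩ := hreg (h * h) (A.mul_mem hh hh)
    have hid : IsIdempotentElem (h * h * a) := by
      rw [IsIdempotentElem, ← mul_assoc, hza]
    have hn : IsNilpotent (h * h * a) :=
      Commute.isNilpotent_mul_right (hcent a ha)
        (Commute.isNilpotent_mul_right (Commute.refl h) hnil)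
    obtain ⟨k, hk⟩ := hn
    have h0 : h * h * a = 0 := by
      have := hid.pow_succ_eq k
      rw [← this, pow_succ, hk, zero_mul]
    rw [← hza, h0, zero_mul]
  -- a Hermitian quasi-inverse of `h`, then one with square zero
  obtain ⟨a, ha, hsa, haha, hhah⟩ : ∃ a ∈ A, σ a = a ∧ a * h * a = a ∧ h * a * h = h := by
    obtain ⟨a, ha, hha⟩ := hreg h hh
    have hha' : h * σ a * h = h := by
      have := congrArg σ hha
      rwa [hσ.map_mul, hσ.map_mul, hsh, ← mul_assoc] at this
    set c := (2 : ℂ)⁻¹ • (a + σ a)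
    have hc : h * c * h = h := by
      simp only [c, mul_smul_comm, smul_mul_assoc, mul_add, add_mul, hha, hha']
      module
    have hcA : c ∈ A := A.smul_mem (A.add_mem ha (hA a ha)) _
    have hc' : ∀ z, h * (c * (h * z)) = h * z := fun z => by
      rw [← mul_assoc c, ← mul_assoc, ← mul_assoc, hc]
    have hsc : σ c = c := by
      simp only [c, map_smul, map_add, hσ.invol, add_comm]
    refine ⟨c * h * c, A.mul_mem (A.mul_mem hcA hh) hcA, ?_, ?_, ?_⟩
    · rw [hσ.map_mul, hσ.map_mul, hsc, hsh, mul_assoc]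
    · simp only [mul_assoc, hc']
    · calc h * (c * h * c) * h = (h * c * h) * c * h := by noncomm_ring
        _ = h := by rw [hc, hc]
  have e1 : ∀ z, h * (h * z) = 0 := fun z => by rw [← mul_assoc, hsq, zero_mul]
  have e2 : ∀ z, h * (a * (h * z)) = h * z := fun z => by
    rw [← mul_assoc a, ← mul_assoc, ← mul_assoc, hhah]
  have e3 : ∀ z, a * (h * (a * z)) = a * z := fun z => by
    rw [← mul_assoc h, ← mul_assoc, ← mul_assoc, haha]
  have e2' : h * (a * h) = h := by rw [← mul_assoc, hhah]
  have e3' : a * (h * a) = a := by rw [← mul_assoc, haha]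
  obtain ⟨c, hcA, hsc, hchc, hhch, hcc⟩ :
      ∃ c ∈ A, σ c = c ∧ c * h * c = c ∧ h * c * h = h ∧ c * c = 0 := by
    -- `q` projects onto a complement of `ker h`; correct it to an isotropic one
    set q := a * h - (2 : ℂ)⁻¹ • (h * a * (a * h)) with hq
    set p := h * a - (2 : ℂ)⁻¹ • (h * a * (a * h)) with hp
    have hqA : q ∈ A := A.sub_mem (A.mul_mem ha hh)
      (A.smul_mem (A.mul_mem (A.mul_mem hh ha) (A.mul_mem ha hh)) _)
    have hpA : p ∈ A := A.sub_mem (A.mul_mem hh ha)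
      (A.smul_mem (A.mul_mem (A.mul_mem hh ha) (A.mul_mem ha hh)) _)
    have hsq' : σ q = p := by
      simp only [hq, hp, map_sub, map_smul, hσ.map_mul, hsh, hsa]
    have hsp : σ p = q := by rw [← hsq', hσ.invol]
    have hpq : p * q = 0 := by
      simp only [hp, hq, sub_mul, mul_sub, smul_mul_assoc, mul_smul_comm, mul_assoc, e1, e3,
        e2', mul_zero, smul_zero]
      module
    have hph : p * h = h := by
      simp only [hp, sub_mul, smul_mul_assoc, mul_assoc, e2', hsq, mul_zero, smul_zero, sub_zero]
    have hhq : h * q = h := by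
      simp only [hq, mul_sub, mul_smul_comm, mul_assoc, e1, e2', smul_zero, sub_zero]
    have hhp : h * p = 0 := by
      simp only [hp, mul_sub, mul_smul_comm, mul_assoc, e1, smul_zero, sub_zero]
    refine ⟨q * a * p, A.mul_mem (A.mul_mem hqA ha) hpA, ?_, ?_, ?_, ?_⟩
    · rw [hσ.map_mul, hσ.map_mul, hsp, hsq', hsa, mul_assoc]
    · calc q * a * p * h * (q * a * p) = q * a * ((p * h) * q) * a * p := by noncomm_ring
        _ = q * (a * h * a) * p := by rw [hph, hhq]; noncomm_ring
        _ = _ := by rw [haha]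
    · calc h * (q * a * p) * h = (h * q) * a * (p * h) := by noncomm_ring
        _ = h := by rw [hph, hhq, hhah]
    · calc q * a * p * (q * a * p) = q * a * (p * q) * a * p := by noncomm_ring
        _ = 0 := by rw [hpq]; noncomm_ring
  -- `y = h + c` satisfies `y ^ 3 = y`, so it is a combination of Hermitian idempotents
  have hyy : (h + c) * (h + c) = h * c + c * h := by
    rw [add_mul, mul_add, mul_add, hsq, hcc, zero_add, add_zero]
  have hy3 : (h + c) * (h * c + c * h) = h + c := by
    rw [add_mul, mul_add, mul_add, ← mul_assoc h h, hsq, zero_mul, ← mul_assoc c c, hcc,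
      zero_mul, ← mul_assoc, ← mul_assoc, hhch, hchc, zero_add, add_zero]
  set y := h + c
  set f := h * c + c * h
  have hyA : y ∈ A := A.add_mem hh hcA
  have hfA : f ∈ A := A.add_mem (A.mul_mem hh hcA) (A.mul_mem hcA hh)
  have hsy : σ y = y := by simp only [y, map_add, hsh, hsc]
  have hsf : σ f = f := by rw [← hyy, hσ.map_mul, hsy]
  have hfy : f * y = y := by rw [← hyy, mul_assoc, hyy, hy3]
  have hff : f * f = f := by
    calc f * f = y * y * f := by rw [hyy]
      _ = y * y := by rw [mul_assoc, hy3]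
      _ = f := hyy
  have hmem : ∀ s : ℂ, s * s = 1 → (2 : ℂ)⁻¹ • (f + s • y) ∈ B := by
    intro s hs
    refine idempotent_mem_of_unitary_mem hσ hB
      (A.smul_mem (A.add_mem hfA (A.smul_mem hyA _)) _) ?_ ?_
    · rw [map_smul, map_add, map_smul, hsf, hsy]
    · simp only [smul_mul_assoc, mul_smul_comm, add_mul, mul_add, hff, hfy, hy3, hyy, smul_smul,
        smul_add]
      match_scalars <;> first | linear_combination (1 / 4 : ℂ) * hs | ring
  have hyB : y ∈ B := by
    have : y = (2 : ℂ)⁻¹ • (f + (1 : ℂ) • y) - (2 : ℂ)⁻¹ • (f + (-1 : ℂ) • y) := by module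
    rw [this]
    exact B.sub_mem (hmem 1 (by norm_num)) (hmem (-1) (by norm_num))
  -- the trace of `h * y = h * c` vanishes, and this is an idempotent
  have ht := hN y hyB
  rw [mul_add, hsq, zero_add] at ht
  have hid : IsIdempotentElem (h * c) := by rw [IsIdempotentElem, ← mul_assoc, hhch]
  have := (LinearMap.IsIdempotentElem.trace_eq_zero_iff hid).mp ht
  rw [← hhch, this, zero_mul]

include hσ in
/-- A von Neumann regular (that is, semisimple) algebra with involution is generated by its
unitary elements. -/
theorem le_of_unitary_mem (hA : ∀ a ∈ A, σ a ∈ A) (hreg : IsRegularAlg A)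
    (hB : ∀ u ∈ A, σ u * u = 1 → u ∈ B) : A ≤ B := by
  suffices h : A ≤ A ⊓ B from h.trans inf_le_right
  have hB' : ∀ u ∈ A, σ u * u = 1 → u ∈ A ⊓ B := fun u hu h => ⟨hu, hB u hu h⟩
  set C := A ⊓ B
  have hCA : C ≤ A := inf_le_left
  let F : A.toSubmodule →ₗ[ℂ] Module.Dual ℂ C.toSubmodule :=
    LinearMap.mk₂ ℂ (fun a b => LinearMap.trace ℂ W ((a : Module.End ℂ W) * b))
      (fun _ _ _ => by simp [add_mul]) (fun _ _ _ => by simp)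
      (fun _ _ _ => by simp [mul_add]) (fun _ _ _ => by simp)
  have hF : Function.Injective F := by
    rw [← LinearMap.ker_eq_bot, LinearMap.ker_eq_bot']
    intro a ha
    ext1
    exact eq_zero_of_trace_mul_unitary hσ hA hreg hB' a.2
      fun b hb => LinearMap.congr_fun ha ⟨b, hb⟩
  have hdim := LinearMap.finrank_le_finrank_of_injective hF
  rw [Subspace.dual_finrank_eq] at hdim
  have := Submodule.eq_of_le_of_finrank_le (S₁ := C.toSubmodule) (S₂ := A.toSubmodule)
    (fun x hx => hCA hx) hdim
  intro x hx
  have : x ∈ C.toSubmodule := by rw [this]; exact hx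
  exact this

end Spanning

/-! ### Adjoints, isometries and semisimple algebras -/

section Adjoint

variable {V : Type u} [AddCommGroup V] [Module ℂ V] [FiniteDimensional ℂ V]

/-- The adjoint of an endomorphism with respect to a nondegenerate form. -/
noncomputable def adj (B : LinearMap.BilinForm ℂ V) (hB : B.Nondegenerate) :
    Module.End ℂ V →ₗ[ℂ] Module.End ℂ V where
  toFun a := ((B.toDual hB).symm : Module.Dual ℂ V →ₗ[ℂ] V) ∘ₗ a.dualMap ∘ₗ
    (B.toDual hB : V →ₗ[ℂ] Module.Dual ℂ V)
  map_add' a b := by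
    ext x
    have h : (a + b).dualMap (B.toDual hB x) =
        a.dualMap (B.toDual hB x) + b.dualMap (B.toDual hB x) := by ext; simp
    simp [h]
  map_smul' c a := by
    ext x
    have h : (c • a).dualMap (B.toDual hB x) = c • a.dualMap (B.toDual hB x) := by ext; simp
    simp [h]

variable {B : LinearMap.BilinForm ℂ V} (hB : B.Nondegenerate)

theorem apply_adj_left (a : Module.End ℂ V) (x y : V) : B (adj B hB a y) x = B y (a x) := by
  rw [← LinearMap.BilinForm.toDual_def hB]
  simp [adj, LinearMap.BilinForm.toDual_def]

variable {ε : ℂ} (hε : ∀ x y, B x y = ε * B y x)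

include hε in
theorem apply_adj (a : Module.End ℂ V) (x y : V) : B (a x) y = B x (adj B hB a y) := by
  rw [hε, hε x, apply_adj_left]

include hB in
theorem eq_of_forall_form {x y : V} (h : ∀ z, B x z = B y z) : x = y :=
  (B.toDual hB).injective (LinearMap.ext fun z => by
    rw [LinearMap.BilinForm.toDual_def, LinearMap.BilinForm.toDual_def, h])

theorem adj_eq_of_forall {a b : Module.End ℂ V} (h : ∀ x y, B (b y) x = B y (a x)) :
    adj B hB a = b := by
  ext y
  exact eq_of_forall_form hB fun z => by rw [apply_adj_left, h]

include hε in
/-- For a form with `ω x y = ε * ω y x` the adjoint is an anti-involution, and it preserves the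
trace because it is conjugate to the transpose. -/
theorem isTraceInvolution_adj : IsTraceInvolution (adj B hB) where
  map_mul a b := adj_eq_of_forall hB fun x y => by
    rw [Module.End.mul_apply, Module.End.mul_apply, apply_adj_left, apply_adj_left]
  invol a := adj_eq_of_forall hB fun x y => by
    rw [apply_adj hB hε]
  trace a := by
    have h : adj B hB a = ((B.toDual hB).symm).conj a.dualMap := by
      rw [LinearEquiv.conj_apply, LinearEquiv.symm_symm]
      rfl
    rw [h, LinearMap.trace_conj', ← LinearMap.trace_transpose' a]
    rfl

include hε in
/-- The isometries are the unitary elements for the adjoint. -/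
theorem adj_mul_self_eq_one_iff {a : Module.End ℂ V} :
    adj B hB a * a = 1 ↔ ∀ x y, B (a x) (a y) = B x y := by
  constructor
  · intro h x y
    rw [apply_adj hB hε, ← Module.End.mul_apply, h, Module.End.one_apply]
  · intro h
    ext x
    exact eq_of_forall_form hB fun z => by
      rw [Module.End.mul_apply, apply_adj_left, h, Module.End.one_apply]

end Adjoint

section Isometries

variable {W : Type u} [AddCommGroup W] [Module ℂ W] {ω : LinearMap.BilinForm ℂ W}

/-- The endomorphism of `W` underlying an isometry. -/
def toEnd : isometryGroup ω →* Module.End ℂ W :=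
  LinearEquiv.automorphismGroup.toLinearMapMonoidHom.comp (isometryGroup ω).subtype

@[simp]
theorem toEnd_apply (g : isometryGroup ω) (w : W) : toEnd g w = (g : W ≃ₗ[ℂ] W) w := rfl

theorem toEnd_injective : Function.Injective (toEnd (ω := ω)) := by
  intro g h hgh
  ext w
  exact LinearMap.congr_fun hgh w

theorem tautRep_apply (G : Subgroup (isometryGroup ω)) (g : G) :
    tautRep G g = toEnd (g : isometryGroup ω) := rfl

theorem exists_toEnd_eq [FiniteDimensional ℂ W] (hω : ω.Nondegenerate) {a : Module.End ℂ W}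
    (h : ∀ x y, ω (a x) (a y) = ω x y) : ∃ g : isometryGroup ω, toEnd g = a := by
  have hinj : Function.Injective a := by
    intro x y hxy
    exact eq_of_forall_form hω fun z => by rw [← h, hxy, h]
  exact ⟨⟨LinearEquiv.ofInjectiveEndo a hinj, h⟩, rfl⟩

/-- The algebra of endomorphisms generated by a group of isometries. -/
def groupAlg (G : Subgroup (isometryGroup ω)) : Subalgebra ℂ (Module.End ℂ W) :=
  Algebra.adjoin ℂ (toEnd '' (G : Set (isometryGroup ω)))

theorem toEnd_mem_groupAlg {G : Subgroup (isometryGroup ω)} {g : isometryGroup ω} (hg : g ∈ G) :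
    toEnd g ∈ groupAlg G :=
  Algebra.subset_adjoin ⟨g, hg, rfl⟩

theorem groupAlg_induction {G : Subgroup (isometryGroup ω)} {p : Module.End ℂ W → Prop}
    (hg : ∀ g ∈ G, p (toEnd g)) (h0 : p 0) (hadd : ∀ a b, p a → p b → p (a + b))
    (hsmul : ∀ (c : ℂ) a, p a → p (c • a)) {a : Module.End ℂ W} (ha : a ∈ groupAlg G) : p a := by
  have : (groupAlg G).toSubmodule = Submodule.span ℂ (toEnd '' (G : Set (isometryGroup ω))) := by
    have := Algebra.adjoin_eq_span_of_subset (R := ℂ)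
      (s := toEnd '' (G : Set (isometryGroup ω))) (by
        have hc : (Submonoid.closure (toEnd '' (G : Set (isometryGroup ω)))) =
            G.toSubmonoid.map toEnd := by
          rw [← Subgroup.coe_toSubmonoid, ← Submonoid.coe_map, Submonoid.closure_eq]
        rw [hc, Submonoid.coe_map]
        exact Submodule.subset_span)
    exact this
  have ha' : a ∈ Submodule.span ℂ (toEnd '' (G : Set (isometryGroup ω))) := by
    rw [← this]; exact ha
  induction ha' using Submodule.span_induction with
  | mem x hx => obtain ⟨g, hgG, rfl⟩ := hx; exact hg g hgG
  | zero => exact h0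
  | add x y hx hy ihx ihy =>
    exact hadd x y (ihx (by rw [← this] at hx; exact hx)) (ihy (by rw [← this] at hy; exact hy))
  | smul c x hx ih => exact hsmul c x (ih (by rw [← this] at hx; exact hx))

theorem mem_commutant_iff {G : Subgroup (isometryGroup ω)} {g : isometryGroup ω} :
    g ∈ commutant G ↔ ∀ h ∈ G, toEnd h * toEnd g = toEnd g * toEnd h := by
  rw [Subgroup.mem_centralizer_iff]
  refine forall₂_congr fun h _ => ?_
  rw [← map_mul, ← map_mul, toEnd_injective.eq_iff]

theorem mem_commutant_iff_mem_centralizer {G : Subgroup (isometryGroup ω)}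
    {g : isometryGroup ω} :
    g ∈ commutant G ↔ toEnd g ∈ Subalgebra.centralizer ℂ (groupAlg G : Set (Module.End ℂ W)) := by
  rw [mem_commutant_iff, Subalgebra.mem_centralizer_iff]
  constructor
  · intro h a ha
    refine groupAlg_induction (p := fun a => a * toEnd g = toEnd g * a) h ?_ ?_ ?_ ha
    · simp
    · intro a b ha hb; rw [add_mul, mul_add, ha, hb]
    · intro c a ha; rw [smul_mul_assoc, mul_smul_comm, ha]
  · intro h x hx
    exact h _ (toEnd_mem_groupAlg hx)

variable [FiniteDimensional ℂ W]

/-- The isometries contained in a subalgebra of `End W`. -/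
def unitaries (ω : LinearMap.BilinForm ℂ W) (A : Subalgebra ℂ (Module.End ℂ W)) :
    Subgroup (isometryGroup ω) where
  carrier := {g | toEnd g ∈ A}
  one_mem' := by simp
  mul_mem' {g h} hg hh := by
    have : toEnd g * toEnd h ∈ A := A.mul_mem hg hh
    simpa using this
  inv_mem' {g} hg := by
    refine inv_mem_subalgebra (y := toEnd g) hg ?_
    rw [← map_mul, mul_inv_cancel, map_one]

theorem mem_unitaries {A : Subalgebra ℂ (Module.End ℂ W)} {g : isometryGroup ω} :
    g ∈ unitaries ω A ↔ toEnd g ∈ A := Iff.rfl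

theorem commutant_eq_unitaries (G : Subgroup (isometryGroup ω)) :
    commutant G = unitaries ω (Subalgebra.centralizer ℂ (groupAlg G : Set (Module.End ℂ W))) := by
  ext g
  exact mem_commutant_iff_mem_centralizer

end Isometries

section Semisimple

/-- A ring in which every left ideal `L` has a right unit is semisimple: the left annihilator of the
right unit is a complement of `L`. -/
theorem isSemisimpleRing_of_idempotents {R : Type*} [Ring R]
    (h : ∀ L : Ideal R, ∃ e ∈ L, ∀ x ∈ L, x * e = x) : IsSemisimpleRing R := by
  rw [IsSemisimpleRing, isSemisimpleModule_iff]
  refine ⟨fun L => ?_⟩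
  obtain ⟨e, he, hL⟩ := h L
  refine ⟨LinearMap.ker (LinearMap.toSpanSingleton R R e), ?_, ?_⟩
  · rw [Submodule.disjoint_def]
    intro x hx hx'
    rw [← hL x hx]
    simpa using hx'
  · rw [codisjoint_iff, Submodule.eq_top_iff']
    intro x
    refine Submodule.mem_sup.mpr ⟨x * e, L.smul_mem x he, x - x * e, ?_, by abel⟩
    simp [sub_mul, mul_assoc, hL e he]

theorem exists_idempotent_of_isSemisimpleRing {R : Type*} [Ring R] [IsSemisimpleRing R]
    (L : Ideal R) : ∃ e ∈ L, ∀ x ∈ L, x * e = x := by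
  obtain ⟨e, he, rfl⟩ := IsSemisimpleRing.ideal_eq_span_idempotent L
  refine ⟨e, Ideal.subset_span rfl, fun x hx => ?_⟩
  obtain ⟨a, rfl⟩ := Ideal.mem_span_singleton'.mp hx
  rw [mul_assoc, he.eq]

variable {W : Type u} [AddCommGroup W] [Module ℂ W] {A : Subalgebra ℂ (Module.End ℂ W)}

/-- A left ideal of a semisimple subalgebra `A` of `End W`, given as a subspace of `End W`, has
a right unit. -/
theorem exists_right_unit [IsSemisimpleRing A] (L : Submodule ℂ (Module.End ℂ W))
    (hLA : ∀ x ∈ L, x ∈ A) (hL : ∀ a ∈ A, ∀ x ∈ L, a * x ∈ L) :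
    ∃ e ∈ L, ∀ x ∈ L, x * e = x := by
  let L' : Ideal A :=
    { carrier := {x | (x : Module.End ℂ W) ∈ L}
      add_mem' := fun hx hy => L.add_mem hx hy
      zero_mem' := L.zero_mem
      smul_mem' := fun a x hx => hL a a.2 x hx }
  obtain ⟨e, he, h⟩ := exists_idempotent_of_isSemisimpleRing L'
  exact ⟨e, he, fun x hx => congrArg Subtype.val (h ⟨x, hLA x hx⟩ hx)⟩

theorem isRegularAlg_of_isSemisimpleRing [IsSemisimpleRing A] : IsRegularAlg A := by
  intro h hh
  let L : Submodule ℂ (Module.End ℂ W) := A.toSubmodule.map (LinearMap.mulRight ℂ h)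
  obtain ⟨e, he, hL⟩ := exists_right_unit (A := A) L
    (by rintro _ ⟨a, ha, rfl⟩; exact A.mul_mem ha hh)
    (by
      rintro b hb _ ⟨a, ha, rfl⟩
      exact ⟨b * a, A.mul_mem hb ha, by simp [mul_assoc]⟩)
  obtain ⟨a, ha, rfl⟩ := he
  refine ⟨a, ha, ?_⟩
  have := hL h ⟨1, A.one_mem, by simp⟩
  simpa [mul_assoc] using this

/-- An algebra acting faithfully and semisimply on the finite-dimensional space `W` is semisimple,
since it embeds into a power of `W`. -/
theorem isSemisimpleRing_of_isSemisimpleModule [FiniteDimensional ℂ W]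
    [IsSemisimpleModule A W] : IsSemisimpleRing A := by
  let b := Module.finBasis ℂ W
  let f : A →ₗ[A] (Fin (Module.finrank ℂ W) → W) :=
    LinearMap.pi fun i => LinearMap.toSpanSingleton A W (b i)
  refine IsSemisimpleModule.of_injective f fun x y hxy => ?_
  ext1
  refine b.ext fun i => ?_
  exact congrFun hxy i

/-- The endomorphism ring of the `A`-module `W` is the centralizer of `A`. -/
def moduleEndEquivCentralizer (A : Subalgebra ℂ (Module.End ℂ W)) :
    Module.End A W ≃+* Subalgebra.centralizer ℂ (A : Set (Module.End ℂ W)) where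
  toFun f := ⟨f.restrictScalars ℂ, by
    rw [Subalgebra.mem_centralizer_iff]
    intro a ha
    ext w
    exact (f.map_smul (⟨a, ha⟩ : A) w).symm⟩
  invFun c :=
    { toFun := c.1
      map_add' := map_add _
      map_smul' := fun a w => by
        have := (Subalgebra.mem_centralizer_iff ℂ).mp c.2 a a.2
        exact (LinearMap.congr_fun this w).symm }
  left_inv _ := rfl
  right_inv _ := rfl
  map_mul' _ _ := rfl
  map_add' _ _ := rfl

variable [FiniteDimensional ℂ W]

theorem isSemisimpleRing_centralizer [IsSemisimpleRing A] :
    IsSemisimpleRing (Subalgebra.centralizer ℂ (A : Set (Module.End ℂ W))) := by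
  have : Module.Finite A W := Module.Finite.of_restrictScalars_finite ℂ A W
  have := IsSemisimpleRing.moduleEnd A W
  exact (moduleEndEquivCentralizer A).isSemisimpleRing

/-- The double centralizer theorem. -/
theorem centralizer_centralizer_eq [IsSemisimpleRing A] :
    Subalgebra.centralizer ℂ
      (Subalgebra.centralizer ℂ (A : Set (Module.End ℂ W)) : Set (Module.End ℂ W)) = A := by
  classical
  refine le_antisymm (fun c hc => ?_) (Subalgebra.le_centralizer_centralizer ℂ)
  rw [Subalgebra.mem_centralizer_iff] at hc
  let f : Module.End (Module.End A W) W :=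
    { toFun := c
      map_add' := map_add _
      map_smul' := fun φ w =>
        (LinearMap.congr_fun (hc _ (moduleEndEquivCentralizer A φ).2) w).symm }
  let b := Module.finBasis ℂ W
  obtain ⟨r, hr⟩ := jacobson_density f (Finset.univ.image b)
  have : c = (r : Module.End ℂ W) :=
    b.ext fun i => hr (b i) (Finset.mem_image_of_mem b (Finset.mem_univ i))
  rw [this]
  exact r.2

end Semisimple

/-! ### Dual pairs and involutions of semisimple algebras -/

section DualPairs

variable {W : Type u} [AddCommGroup W] [Module ℂ W] {ω : LinearMap.BilinForm ℂ W}

/-- The subspaces stable under a group of isometries are those stable under the algebra it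
generates. -/
def subrepresentationOrderIso (G : Subgroup (isometryGroup ω)) :
    Subrepresentation (tautRep G) ≃o Submodule (groupAlg G) W where
  toFun N :=
    { N.toSubmodule with
      smul_mem' := fun a w hw => by
        refine groupAlg_induction (G := G) (p := fun a => a w ∈ N.toSubmodule)
          ?_ ?_ ?_ ?_ a.2
        · intro g hg
          exact N.apply_mem_toSubmodule ⟨g, hg⟩ hw
        · exact N.toSubmodule.zero_mem
        · intro a b ha hb
          exact N.toSubmodule.add_mem ha hb
        · intro c a ha
          exact N.toSubmodule.smul_mem c ha }
  invFun N :=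
    { toSubmodule := N.restrictScalars ℂ
      apply_mem_toSubmodule := fun g w hw =>
        N.smul_mem ⟨toEnd (g : isometryGroup ω), toEnd_mem_groupAlg g.2⟩ hw }
  left_inv _ := rfl
  right_inv _ := rfl
  map_rel_iff' := Iff.rfl

variable [FiniteDimensional ℂ W]

theorem isSemisimpleRepresentation_iff (G : Subgroup (isometryGroup ω)) :
    Representation.IsSemisimpleRepresentation (tautRep G) ↔ IsSemisimpleRing (groupAlg G) := by
  rw [Representation.IsSemisimpleRepresentation,
    (subrepresentationOrderIso G).complementedLattice_iff, ← isSemisimpleModule_iff]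
  exact ⟨fun _ => isSemisimpleRing_of_isSemisimpleModule, fun _ => inferInstance⟩

variable (hω : ω.Nondegenerate)

theorem adj_toEnd (g : isometryGroup ω) : adj ω hω (toEnd g) = toEnd g⁻¹ := by
  refine adj_eq_of_forall hω fun x y => ?_
  have h1 : toEnd g (toEnd g⁻¹ y) = y := by
    rw [← Module.End.mul_apply, ← map_mul, mul_inv_cancel, map_one, Module.End.one_apply]
  have h2 := g.2 (toEnd g⁻¹ y) x
  rw [← toEnd_apply g, ← toEnd_apply g, h1] at h2
  exact h2.symm

theorem adj_mem_groupAlg {G : Subgroup (isometryGroup ω)} {a : Module.End ℂ W}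
    (ha : a ∈ groupAlg G) : adj ω hω a ∈ groupAlg G := by
  refine groupAlg_induction (p := fun a => adj ω hω a ∈ groupAlg G) ?_ ?_ ?_ ?_ ha
  · intro g hg
    rw [adj_toEnd]
    exact toEnd_mem_groupAlg (G.inv_mem hg)
  · rw [map_zero]; exact (groupAlg G).zero_mem
  · intro a b ha hb
    rw [map_add]; exact (groupAlg G).add_mem ha hb
  · intro c a ha
    rw [map_smul]; exact (groupAlg G).smul_mem ha c

variable {ε : ℂ} (hε : ∀ x y, ω x y = ε * ω y x) {A : Subalgebra ℂ (Module.End ℂ W)}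

include hε in
theorem adj_mem_centralizer (hA : ∀ a ∈ A, adj ω hω a ∈ A) {c : Module.End ℂ W}
    (hc : c ∈ Subalgebra.centralizer ℂ (A : Set (Module.End ℂ W))) :
    adj ω hω c ∈ Subalgebra.centralizer ℂ (A : Set (Module.End ℂ W)) := by
  have hσ := isTraceInvolution_adj hω hε
  rw [Subalgebra.mem_centralizer_iff] at hc ⊢
  intro a ha
  have := congrArg (adj ω hω) (hc _ (hA a ha))
  rw [hσ.map_mul, hσ.map_mul, hσ.invol] at this
  exact this.symm

include hε in
/-- A semisimple algebra stable under the adjoint is recovered from the group of isometries it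
contains. -/
theorem groupAlg_unitaries [IsSemisimpleRing A] (hA : ∀ a ∈ A, adj ω hω a ∈ A) :
    groupAlg (unitaries ω A) = A := by
  refine le_antisymm (Algebra.adjoin_le ?_) ?_
  · rintro _ ⟨g, hg, rfl⟩
    exact hg
  · refine le_of_unitary_mem (isTraceInvolution_adj hω hε) hA isRegularAlg_of_isSemisimpleRing
      fun u hu hu1 => ?_
    obtain ⟨g, rfl⟩ := exists_toEnd_eq hω ((adj_mul_self_eq_one_iff hω hε).mp hu1)
    exact toEnd_mem_groupAlg (G := unitaries ω A) hu

include hω hε in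
/-- The isometries in a semisimple algebra with involution and the isometries in its centralizer
form a dual pair. -/
theorem isDualPair_unitaries [IsSemisimpleRing A] (hA : ∀ a ∈ A, adj ω hω a ∈ A) :
    IsDualPair (unitaries ω A) (commutant (unitaries ω A)) := by
  have h1 := groupAlg_unitaries hω hε hA
  have hss := isSemisimpleRing_centralizer (A := A)
  have h2 : commutant (unitaries ω A) =
      unitaries ω (Subalgebra.centralizer ℂ (A : Set (Module.End ℂ W))) := by
    rw [commutant_eq_unitaries, h1]
  have h3 := groupAlg_unitaries hω hε (A := Subalgebra.centralizer ℂ (A : Set (Module.End ℂ W)))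
    fun a ha => adj_mem_centralizer hω hε hA ha
  refine ⟨?_, rfl, ?_, ?_⟩
  · rw [h2, commutant_eq_unitaries, h3, centralizer_centralizer_eq]
  · rw [isSemisimpleRepresentation_iff, h1]; infer_instance
  · rw [isSemisimpleRepresentation_iff, h2, h3]; exact hss

end DualPairs

section Involution

variable {W : Type u} [AddCommGroup W] [Module ℂ W]

/-- `T` restricts to an involutive algebra automorphism of the subalgebra `A`. -/
structure IsAlgInvolution (A : Subalgebra ℂ (Module.End ℂ W))
    (T : Module.End ℂ W →ₗ[ℂ] Module.End ℂ W) : Prop where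
  mem : ∀ a ∈ A, T a ∈ A
  map_mul : ∀ a ∈ A, ∀ b ∈ A, T (a * b) = T a * T b
  map_one : T 1 = 1
  invol : ∀ a ∈ A, T (T a) = a

namespace IsAlgInvolution

variable {A : Subalgebra ℂ (Module.End ℂ W)} {T : Module.End ℂ W →ₗ[ℂ] Module.End ℂ W}
  (hT : IsAlgInvolution A T)

/-- The even part of `A`: the fixed subalgebra of the involution. -/
def even : Subalgebra ℂ (Module.End ℂ W) where
  carrier := {a | a ∈ A ∧ T a = a}
  mul_mem' {a b} ha hb :=
    ⟨A.mul_mem ha.1 hb.1, by rw [hT.map_mul a ha.1 b hb.1, ha.2, hb.2]⟩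
  add_mem' {a b} ha hb := ⟨A.add_mem ha.1 hb.1, by rw [map_add, ha.2, hb.2]⟩
  algebraMap_mem' c := ⟨A.algebraMap_mem c, by
    rw [Algebra.algebraMap_eq_smul_one, map_smul, hT.map_one]⟩

theorem add_mem_even {a : Module.End ℂ W} (ha : a ∈ A) : a + T a ∈ hT.even :=
  ⟨A.add_mem ha (hT.mem a ha), by rw [map_add, hT.invol a ha, add_comm]⟩

/-- The fixed algebra of an involution of a semisimple algebra is semisimple: the even part of a
right unit of `A * L` is a right unit of the left ideal `L` of the fixed algebra. -/
theorem isSemisimpleRing_even [IsSemisimpleRing A] : IsSemisimpleRing hT.even := by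
  refine isSemisimpleRing_of_idempotents fun L => ?_
  let ι : hT.even →+* A := (Subalgebra.inclusion (fun a (ha : a ∈ hT.even) => ha.1)).toRingHom
  obtain ⟨f, hf, hfx⟩ := exists_idempotent_of_isSemisimpleRing (Ideal.span (ι '' L))
  have key : ∀ m ∈ Ideal.span (ι '' (L : Set hT.even)), ∀ a : A,
      ∃ l ∈ L, (l : Module.End ℂ W) =
        (a : Module.End ℂ W) * m + T ((a : Module.End ℂ W) * m) := by
    intro m hm
    induction hm using Submodule.span_induction with
    | mem x hx =>
      obtain ⟨l, hl, rfl⟩ := hx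
      intro a
      refine ⟨⟨a + T a, hT.add_mem_even a.2⟩ * l, L.smul_mem _ hl, ?_⟩
      change ((a : Module.End ℂ W) + T a) * (l : Module.End ℂ W) = a * l + T (a * l)
      rw [hT.map_mul a a.2 _ l.2.1, l.2.2, add_mul]
    | zero => exact fun a => ⟨0, L.zero_mem, by simp⟩
    | add x y _ _ hx hy =>
      intro a
      obtain ⟨l, hl, h1⟩ := hx a
      obtain ⟨l', hl', h2⟩ := hy a
      refine ⟨l + l', L.add_mem hl hl', ?_⟩
      change (l : Module.End ℂ W) + l' = a * (x + y) + T (a * (x + y))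
      rw [h1, h2, mul_add, map_add]
      abel
    | smul b x _ hx =>
      intro a
      obtain ⟨l, hl, h1⟩ := hx (a * b)
      refine ⟨l, hl, ?_⟩
      rw [h1]
      simp [mul_assoc]
  obtain ⟨l, hl, hlf⟩ := key f hf 1
  have hlf' : (l : Module.End ℂ W) = f + T f := by simpa using hlf
  refine ⟨(2 : ℂ)⁻¹ • l, ?_, fun x hx => ?_⟩
  · rw [← smul_one_mul (2 : ℂ)⁻¹ l]
    exact L.smul_mem _ hl
  · ext1
    have hxf : (x : Module.End ℂ W) * f = x :=
      congrArg Subtype.val (hfx (ι x) (Ideal.subset_span ⟨x, hx, rfl⟩))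
    have hxf' : (x : Module.End ℂ W) * T f = x := by
      have := congrArg T hxf
      rwa [hT.map_mul _ x.2.1 _ f.2, x.2.2] at this
    change (x : Module.End ℂ W) * ((2 : ℂ)⁻¹ • (l : Module.End ℂ W)) = x
    rw [hlf', mul_smul_comm, mul_add, hxf, hxf']
    module

/-- The odd part of `A`. -/
def odd (_ : IsAlgInvolution A T) : Submodule ℂ (Module.End ℂ W) where
  carrier := {a | a ∈ A ∧ T a = -a}
  add_mem' {a b} ha hb := ⟨A.add_mem ha.1 hb.1, by rw [map_add, ha.2, hb.2, neg_add]⟩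
  zero_mem' := ⟨A.zero_mem, by simp⟩
  smul_mem' c a ha := ⟨A.smul_mem ha.1 c, by rw [map_smul, ha.2, smul_neg]⟩

theorem odd_mul_odd {a b : Module.End ℂ W} (ha : a ∈ hT.odd) (hb : b ∈ hT.odd) :
    a * b ∈ hT.even :=
  ⟨A.mul_mem ha.1 hb.1, by rw [hT.map_mul a ha.1 b hb.1, ha.2, hb.2, neg_mul_neg]⟩

theorem even_mul_odd {a b : Module.End ℂ W} (ha : a ∈ hT.even) (hb : b ∈ hT.odd) :
    a * b ∈ hT.odd :=
  ⟨A.mul_mem ha.1 hb.1, by rw [hT.map_mul a ha.1 b hb.1, ha.2, hb.2, mul_neg]⟩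

theorem odd_mul_even {a b : Module.End ℂ W} (ha : a ∈ hT.odd) (hb : b ∈ hT.even) :
    a * b ∈ hT.odd :=
  ⟨A.mul_mem ha.1 hb.1, by rw [hT.map_mul a ha.1 b hb.1, ha.2, hb.2, neg_mul]⟩

theorem mul_odd_odd_le_even {x : Module.End ℂ W} (hx : x ∈ hT.odd * hT.odd) : x ∈ hT.even := by
  refine Submodule.mul_induction_on hx (fun a ha b hb => hT.odd_mul_odd ha hb) fun a b ha hb => ?_
  exact hT.even.add_mem ha hb

theorem exists_even_add_odd {a : Module.End ℂ W} (ha : a ∈ A) :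
    ∃ b ∈ hT.even, ∃ c ∈ hT.odd, a = b + c := by
  refine ⟨(2 : ℂ)⁻¹ • (a + T a), hT.even.smul_mem (hT.add_mem_even ha) _,
    (2 : ℂ)⁻¹ • (a - T a), hT.odd.smul_mem _ ⟨A.sub_mem ha (hT.mem a ha), ?_⟩, by module⟩
  rw [map_sub, hT.invol a ha, neg_sub]

variable {σ : Module.End ℂ W →ₗ[ℂ] Module.End ℂ W} (hσ : IsTraceInvolution σ)
  (hσA : ∀ a ∈ A, σ a ∈ A) (hσT : ∀ a ∈ A, T (σ a) = σ (T a))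

include hσA hσT in
theorem anti_mem_even {a : Module.End ℂ W} (ha : a ∈ hT.even) : σ a ∈ hT.even :=
  ⟨hσA a ha.1, by rw [hσT a ha.1, ha.2]⟩

include hσA hσT in
theorem anti_mem_odd {a : Module.End ℂ W} (ha : a ∈ hT.odd) : σ a ∈ hT.odd :=
  ⟨hσA a ha.1, by rw [hσT a ha.1, ha.2, map_neg]⟩

include hσ hσA hσT in
/-- The ideal generated by the odd part has a unit, which is a sum of products of odd elements. -/
theorem exists_unit_odd [IsSemisimpleRing A] :
    ∃ e ∈ hT.odd * hT.odd, σ e = e ∧ ∀ z ∈ hT.odd, e * z = z ∧ z * e = z := by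
  set I := hT.odd * hT.odd ⊔ hT.odd with hI
  have hOI : hT.odd ≤ I := le_sup_right
  have hOOI : hT.odd * hT.odd ≤ I := le_sup_left
  have hIA : ∀ x ∈ I, x ∈ A := by
    intro x hx
    obtain ⟨y, hy, z, hz, rfl⟩ := Submodule.mem_sup.mp hx
    exact A.add_mem (hT.mul_odd_odd_le_even hy).1 hz.1
  have hOOO : ∀ a ∈ hT.odd, ∀ x ∈ hT.odd * hT.odd, a * x ∈ hT.odd := fun a ha x hx =>
    hT.odd_mul_even ha (hT.mul_odd_odd_le_even hx)
  have hEOO : ∀ a ∈ hT.even, ∀ x ∈ hT.odd * hT.odd, a * x ∈ hT.odd * hT.odd := by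
    intro a ha x hx
    refine Submodule.mul_induction_on hx (fun b hb c hc => ?_) fun b c hb hc => ?_
    · rw [← mul_assoc]
      exact Submodule.mul_mem_mul (hT.even_mul_odd ha hb) hc
    · rw [mul_add]; exact Submodule.add_mem _ hb hc
  have hleft : ∀ a ∈ A, ∀ x ∈ I, a * x ∈ I := by
    intro a ha x hx
    obtain ⟨b, hb, c, hc, rfl⟩ := hT.exists_even_add_odd ha
    obtain ⟨y, hy, z, hz, rfl⟩ := Submodule.mem_sup.mp hx
    rw [add_mul, mul_add, mul_add]
    refine I.add_mem (I.add_mem (hOOI (hEOO b hb y hy)) (hOI (hT.even_mul_odd hb hz)))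
      (I.add_mem (hOI (hOOO c hc y hy)) (hOOI (Submodule.mul_mem_mul hc hz)))
  have hσOO : ∀ x ∈ hT.odd * hT.odd, σ x ∈ hT.odd * hT.odd := by
    intro x hx
    refine Submodule.mul_induction_on hx (fun b hb c hc => ?_) fun b c hb hc => ?_
    · rw [hσ.map_mul]
      exact Submodule.mul_mem_mul (hT.anti_mem_odd hσA hσT hc) (hT.anti_mem_odd hσA hσT hb)
    · rw [map_add]; exact Submodule.add_mem _ hb hc
  have hσI : ∀ x ∈ I, σ x ∈ I := by
    intro x hx
    obtain ⟨y, hy, z, hz, rfl⟩ := Submodule.mem_sup.mp hx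
    rw [map_add]
    exact I.add_mem (hOOI (hσOO y hy)) (hOI (hT.anti_mem_odd hσA hσT hz))
  obtain ⟨e, heI, he⟩ := exists_right_unit (A := A) I hIA hleft
  have he' : ∀ x ∈ I, σ e * x = x := by
    intro x hx
    have := congrArg σ (he (σ x) (hσI x hx))
    rwa [hσ.map_mul, hσ.invol] at this
  have hσe : σ e = e := by rw [← he (σ e) (hσI e heI), he' e heI]
  rw [hσe] at he'
  have hTI : ∀ x ∈ I, T x ∈ I := by
    intro x hx
    obtain ⟨y, hy, z, hz, rfl⟩ := Submodule.mem_sup.mp hx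
    rw [map_add, (hT.mul_odd_odd_le_even hy).2, hz.2]
    exact I.add_mem (hOOI hy) (I.neg_mem (hOI hz))
  have hTe : T e = e := by
    have h1 : e * T e = e := by
      have := congrArg T (he (T e) (hTI e heI))
      rw [hT.map_mul _ (hT.mem _ (hIA e heI)) _ (hIA e heI), hT.invol _ (hIA e heI)] at this
      exact this
    rw [← he' (T e) (hTI e heI), h1]
  refine ⟨e, ?_, hσe, fun z hz => ⟨he' z (hOI hz), he z (hOI hz)⟩⟩
  obtain ⟨y, hy, z, hz, hyz⟩ := Submodule.mem_sup.mp heI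
  have h1 : T e = y - z := by
    rw [← hyz, map_add, (hT.mul_odd_odd_le_even hy).2, hz.2, sub_eq_add_neg]
  have hz0 : z = 0 := by
    have h2 : (2 : ℂ) • z = 0 := by
      have : y + z = y - z := by rw [hyz, ← h1, hTe]
      have h3 : (2 : ℂ) • z = (y + z) - (y - z) := by module
      rw [h3, this, sub_self]
    exact (smul_eq_zero.mp h2).resolve_left two_ne_zero
  rw [← hyz, hz0, add_zero]
  exact hy

/-- If `e = ∑ xᵢ yᵢ` with odd `xᵢ`, `yᵢ`, the map `S b = ∑ xᵢ b yᵢ` satisfies `S b z = e z b` and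
`z S b = b z e` for odd `z`, because `yᵢ z` and `z xᵢ` are even and so commute with `b`. -/
theorem exists_sandwich {e₀ e : Module.End ℂ W} (he₀ : ∀ z ∈ hT.odd, e₀ * z = z ∧ z * e₀ = z)
    (he : e ∈ hT.odd * hT.odd) :
    ∃ S : Module.End ℂ W →ₗ[ℂ] Module.End ℂ W,
      ∀ b ∈ Subalgebra.centralizer ℂ (hT.even : Set (Module.End ℂ W)),
        e₀ * S b = S b ∧ S b * e₀ = S b ∧ (∀ z ∈ hT.odd, S b * z = e * z * b) ∧
          (∀ z ∈ hT.odd, z * S b = b * z * e) := by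
  refine Submodule.mul_induction_on he (fun x hx y hy => ?_) ?_
  · refine ⟨LinearMap.mulLeft ℂ x ∘ₗ LinearMap.mulRight ℂ y, fun b hb => ⟨?_, ?_, ?_, ?_⟩⟩
    · simp only [LinearMap.comp_apply, LinearMap.mulLeft_apply, LinearMap.mulRight_apply,
        ← mul_assoc, (he₀ x hx).1]
    · simp only [LinearMap.comp_apply, LinearMap.mulLeft_apply, LinearMap.mulRight_apply,
        mul_assoc, (he₀ y hy).2]
    · intro z hz
      have := (Subalgebra.mem_centralizer_iff ℂ).mp hb _ (hT.odd_mul_odd hy hz)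
      simp only [LinearMap.comp_apply, LinearMap.mulLeft_apply, LinearMap.mulRight_apply]
      rw [mul_assoc, mul_assoc, ← this]
      simp only [mul_assoc]
    · intro z hz
      have := (Subalgebra.mem_centralizer_iff ℂ).mp hb _ (hT.odd_mul_odd hz hx)
      simp only [LinearMap.comp_apply, LinearMap.mulLeft_apply, LinearMap.mulRight_apply]
      rw [← mul_assoc, ← mul_assoc, this]
      simp only [mul_assoc]
  · rintro x y ⟨S, hS⟩ ⟨S', hS'⟩
    refine ⟨S + S', fun b hb => ⟨?_, ?_, fun z hz => ?_, fun z hz => ?_⟩⟩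
    · rw [LinearMap.add_apply, mul_add, (hS b hb).1, (hS' b hb).1]
    · rw [LinearMap.add_apply, add_mul, (hS b hb).2.1, (hS' b hb).2.1]
    · rw [LinearMap.add_apply, add_mul, (hS b hb).2.2.1 z hz, (hS' b hb).2.2.1 z hz, add_mul,
        add_mul]
    · rw [LinearMap.add_apply, mul_add, (hS b hb).2.2.2 z hz, (hS' b hb).2.2.2 z hz, mul_add]

include hσ hσA hσT in
/-- The reciprocal involution: an involution of the centralizer of the even part of `A`, compatible
with the anti-involution, whose fixed algebra is the centralizer of `A`. It is
`b ↦ b (1 - e) + ∑ xᵢ b yᵢ`, where `e = ∑ xᵢ yᵢ`, with `xᵢ` and `yᵢ` odd, is the unit of the ideal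
generated by the odd part. -/
theorem exists_reciprocal [IsSemisimpleRing A] :
    ∃ S : Module.End ℂ W →ₗ[ℂ] Module.End ℂ W,
      IsAlgInvolution (Subalgebra.centralizer ℂ (hT.even : Set (Module.End ℂ W))) S ∧
      (∀ b ∈ Subalgebra.centralizer ℂ (hT.even : Set (Module.End ℂ W)), S (σ b) = σ (S b)) ∧
      (∀ b ∈ Subalgebra.centralizer ℂ (hT.even : Set (Module.End ℂ W)),
        S b = b ↔ b ∈ Subalgebra.centralizer ℂ (A : Set (Module.End ℂ W))) := by
  obtain ⟨e, heO, hσe, he⟩ := hT.exists_unit_odd hσ hσA hσT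
  obtain ⟨S, hS⟩ := hT.exists_sandwich he heO
  have heE := hT.mul_odd_odd_le_even heO
  set B := Subalgebra.centralizer ℂ (hT.even : Set (Module.End ℂ W)) with hB
  have hcomm : ∀ b ∈ B, ∀ a ∈ hT.even, a * b = b * a := fun b hb a ha =>
    (Subalgebra.mem_centralizer_iff ℂ).mp hb a ha
  -- an element is determined by its products with odd elements and with `1 - e`
  have huniq : ∀ u v : Module.End ℂ W, (∀ z ∈ hT.odd, u * z = v * z) →
      u * (1 - e) = v * (1 - e) → u = v := by
    intro u v h1 h2
    have h3 : u * e = v * e := by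
      refine Submodule.mul_induction_on (C := fun e => u * e = v * e) heO (fun x hx y _ => ?_)
        fun x y hx hy => ?_
      · rw [← mul_assoc, h1 x hx, mul_assoc]
      · rw [mul_add, mul_add, hx, hy]
    have h4 : ∀ w : Module.End ℂ W, w = w * (1 - e) + w * e := fun w => by noncomm_ring
    rw [h4 u, h4 v, h2, h3]
  have hσB : ∀ b ∈ B, σ b ∈ B := by
    intro b hb
    rw [hB, Subalgebra.mem_centralizer_iff]
    intro a ha
    have := congrArg σ (hcomm b hb (σ a) (hT.anti_mem_even hσA hσT ha))
    rw [hσ.map_mul, hσ.map_mul, hσ.invol] at this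
    exact this.symm
  have hOO : ∀ x ∈ hT.odd * hT.odd, e * x = x ∧ x * e = x := by
    intro x hx
    refine Submodule.mul_induction_on (C := fun x => e * x = x ∧ x * e = x) hx
      (fun x hx y hy => ?_) fun x y hx hy => ?_
    · rw [← mul_assoc, (he x hx).1, mul_assoc, (he y hy).2]
      exact ⟨rfl, rfl⟩
    · rw [mul_add, add_mul, hx.1, hx.2, hy.1, hy.2]
      exact ⟨rfl, rfl⟩
  have hee : e * e = e := (hOO e heO).1
  have hecomm : ∀ a ∈ hT.even, a * e = e * a := by
    intro a ha
    have hl : a * e ∈ hT.odd * hT.odd := by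
      refine Submodule.mul_induction_on (C := fun e => a * e ∈ hT.odd * hT.odd) heO
        (fun x hx y hy => ?_) fun x y hx hy => ?_
      · rw [← mul_assoc]; exact Submodule.mul_mem_mul (hT.even_mul_odd ha hx) hy
      · rw [mul_add]; exact Submodule.add_mem _ hx hy
    have hr : e * a ∈ hT.odd * hT.odd := by
      refine Submodule.mul_induction_on (C := fun e => e * a ∈ hT.odd * hT.odd) heO
        (fun x hx y hy => ?_) fun x y hx hy => ?_
      · rw [mul_assoc]; exact Submodule.mul_mem_mul hx (hT.odd_mul_even hy ha)
      · rw [add_mul]; exact Submodule.add_mem _ hx hy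
    rw [← (hOO _ hl).1, ← mul_assoc, (hOO _ hr).2]
  let S' : Module.End ℂ W →ₗ[ℂ] Module.End ℂ W := LinearMap.mulRight ℂ (1 - e) + S
  have hS' : ∀ b, S' b = b * (1 - e) + S b := fun b => rfl
  -- `S' b` is characterized by `S' b * z = z * b` for odd `z` and by agreeing with `b` on `1 - e`
  have h1 : ∀ b ∈ B, ∀ z ∈ hT.odd, S' b * z = z * b := by
    intro b hb z hz
    rw [hS', add_mul, (hS b hb).2.2.1 z hz, (he z hz).1, mul_assoc b, sub_mul, one_mul, (he z hz).1,
      sub_self, mul_zero, zero_add]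
  have h2 : ∀ b ∈ B, ∀ z ∈ hT.odd, z * S' b = b * z := by
    intro b hb z hz
    rw [hS', mul_add, (hS b hb).2.2.2 z hz, mul_sub, mul_one, ← hcomm b hb e heE, mul_sub,
      ← mul_assoc, (he z hz).2, sub_self, zero_add, mul_assoc, (he z hz).2]
  have h3 : ∀ b ∈ B, (1 - e) * S' b = b * (1 - e) := by
    intro b hb
    rw [hS', mul_add, sub_mul 1 e (S b), (hS b hb).1, one_mul, sub_self, add_zero, mul_sub, mul_one,
      ← hcomm b hb e heE, sub_mul, one_mul, mul_sub, ← mul_assoc, hee, sub_self, sub_zero]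
  have h4 : ∀ b ∈ B, S' b * (1 - e) = b * (1 - e) := by
    intro b hb
    rw [hS', add_mul, mul_sub (S b), mul_one, (hS b hb).2.1, sub_self, add_zero, mul_assoc]
    congr 1
    rw [mul_sub, mul_one, sub_mul, one_mul, hee, sub_self, sub_zero]
  have hmem : ∀ b ∈ B, S' b ∈ B := by
    intro b hb
    rw [hB, Subalgebra.mem_centralizer_iff]
    intro a ha
    refine huniq _ _ (fun z hz => ?_) ?_
    · rw [mul_assoc, h1 b hb z hz, mul_assoc, h1 b hb _ (hT.even_mul_odd ha hz), mul_assoc]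
    · have hae : a * (1 - e) = (1 - e) * a := by
        rw [mul_sub, sub_mul, mul_one, one_mul, hecomm a ha]
      rw [mul_assoc a, h4 b hb, ← mul_assoc, hcomm b hb a ha, mul_assoc (S' b), hae, ← mul_assoc,
        h4 b hb, mul_assoc b a, hae, mul_assoc]
  refine ⟨S', ⟨hmem, fun a ha b hb => ?_, ?_, fun b hb => ?_⟩, fun b hb => ?_, fun b hb => ?_⟩
  · refine huniq _ _ (fun z hz => ?_) ?_
    · rw [h1 _ (B.mul_mem ha hb) z hz, mul_assoc (S' a), h1 b hb z hz, ← mul_assoc (S' a),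
        h1 a ha z hz, mul_assoc]
    · have hbe : b * (1 - e) = (1 - e) * b := by
        rw [mul_sub, sub_mul, mul_one, one_mul, hcomm b hb e heE]
      rw [h4 _ (B.mul_mem ha hb), mul_assoc (S' a), h4 b hb, hbe, ← mul_assoc (S' a), h4 a ha,
        mul_assoc a b, hbe, mul_assoc]
  · refine huniq _ _ (fun z hz => ?_) ?_
    · rw [h1 1 B.one_mem z hz, mul_one, one_mul]
    · rw [h4 1 B.one_mem]
  · refine huniq _ _ (fun z hz => ?_) ?_
    · rw [h1 _ (hmem b hb) z hz, h2 b hb z hz]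
    · rw [h4 _ (hmem b hb), h4 b hb]
  · refine huniq _ _ (fun z hz => ?_) ?_
    · have := congrArg σ (h2 b hb (σ z) (hT.anti_mem_odd hσA hσT hz))
      rw [hσ.map_mul, hσ.map_mul, hσ.invol] at this
      rw [h1 _ (hσB b hb) z hz, this]
    · have := congrArg σ (h3 b hb)
      rw [hσ.map_mul, hσ.map_mul, map_sub, hσ.map_one, hσe] at this
      rw [h4 _ (hσB b hb), this, sub_mul, mul_sub, one_mul, mul_one, hcomm _ (hσB b hb) e heE]
  · rw [Subalgebra.mem_centralizer_iff]
    constructor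
    · intro h a ha
      obtain ⟨c, hc, z, hz, rfl⟩ := hT.exists_even_add_odd ha
      have := h1 b hb z hz
      rw [h] at this
      rw [add_mul, mul_add, hcomm b hb c hc, this]
    · intro h
      refine huniq _ _ (fun z hz => ?_) (h4 b hb)
      rw [h1 b hb z hz, h z hz.1]

end IsAlgInvolution

end Involution

/-! ### Reciprocity for dual pairs -/

section SymmetricSubgroups

variable {W : Type u} [AddCommGroup W] [Module ℂ W] {ω : LinearMap.BilinForm ℂ W}

/-- A linear endomorphism of `End W` implementing an involution of a group of isometries is an
involution of the algebra generated by that group. -/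
theorem isAlgInvolution_of_linear {G : Subgroup (isometryGroup ω)} {θ : G ≃* G}
    (hθ : ∀ g, θ (θ g) = g) {T : Module.End ℂ W →ₗ[ℂ] Module.End ℂ W}
    (hT : ∀ g : G, T (tautRep G g) = tautRep G (θ g)) : IsAlgInvolution (groupAlg G) T where
  mem a ha := by
    refine groupAlg_induction (p := fun a => T a ∈ groupAlg G) ?_ ?_ ?_ ?_ ha
    · intro g hg
      have := hT ⟨g, hg⟩
      rw [tautRep_apply, tautRep_apply] at this
      rw [this]
      exact toEnd_mem_groupAlg (θ ⟨g, hg⟩).2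
    · rw [map_zero]; exact (groupAlg G).zero_mem
    · intro a b ha hb
      rw [map_add]; exact (groupAlg G).add_mem ha hb
    · intro c a ha
      rw [map_smul]; exact (groupAlg G).smul_mem ha c
  map_mul a ha b hb := by
    refine groupAlg_induction (p := fun a => T (a * b) = T a * T b) ?_ ?_ ?_ ?_ ha
    · intro g hg
      refine groupAlg_induction (p := fun b => T (toEnd g * b) = T (toEnd g) * T b)
        ?_ ?_ ?_ ?_ hb
      · intro h hh
        have h1 := hT ⟨g, hg⟩
        have h2 := hT ⟨h, hh⟩
        have h3 := hT (⟨g, hg⟩ * ⟨h, hh⟩)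
        rw [map_mul (tautRep G), map_mul θ, map_mul (tautRep G), ← h1, ← h2] at h3
        exact h3
      · simp
      · intro a b ha hb; rw [mul_add, map_add, ha, hb, map_add, mul_add]
      · intro c a ha; rw [mul_smul_comm, map_smul, ha, map_smul, mul_smul_comm]
    · simp
    · intro a b ha hb; rw [add_mul, map_add, ha, hb, map_add, add_mul]
    · intro c a ha; rw [smul_mul_assoc, map_smul, ha, map_smul, smul_mul_assoc]
  map_one := by simpa using hT 1
  invol a ha := by
    refine groupAlg_induction (p := fun a => T (T a) = a) ?_ ?_ ?_ ?_ ha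
    · intro g hg
      have h1 := hT ⟨g, hg⟩
      have h2 := hT (θ ⟨g, hg⟩)
      rw [← h1, hθ] at h2
      exact h2
    · simp
    · intro a b ha hb; rw [map_add, map_add, ha, hb]
    · intro c a ha; rw [map_smul, map_smul, ha]

variable [FiniteDimensional ℂ W]

/-- An automorphism of `G` which extends linearly commutes with the adjoint, since the adjoint is
the inversion on `G`. -/
theorem adj_comm_of_linear (hω : ω.Nondegenerate) {G : Subgroup (isometryGroup ω)} {θ : G ≃* G}
    {T : Module.End ℂ W →ₗ[ℂ] Module.End ℂ W}
    (hT : ∀ g : G, T (tautRep G g) = tautRep G (θ g)) :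
    ∀ a ∈ groupAlg G, T (adj ω hω a) = adj ω hω (T a) := by
  intro a ha
  refine groupAlg_induction (p := fun a => T (adj ω hω a) = adj ω hω (T a)) ?_ ?_ ?_ ?_ ha
  · intro g hg
    have h1 := hT ⟨g, hg⟩
    have h2 := hT ⟨g, hg⟩⁻¹
    rw [map_inv θ, tautRep_apply, tautRep_apply] at h2
    rw [tautRep_apply, tautRep_apply] at h1
    rw [h1, adj_toEnd, adj_toEnd]
    exact h2
  · simp
  · intro a b ha hb; simp only [map_add, ha, hb]
  · intro c a ha; simp only [map_smul, ha]

/-- An involution of an algebra `B` with anti-involution induces an involution of the group of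
isometries in `B`, with fixed points the isometries in the fixed algebra. -/
theorem isSymmetricSubgroup_unitaries (hω : ω.Nondegenerate) {ε : ℂ}
    (hε : ∀ x y, ω x y = ε * ω y x) {B C : Subalgebra ℂ (Module.End ℂ W)}
    {S : Module.End ℂ W →ₗ[ℂ] Module.End ℂ W} (hS : IsAlgInvolution B S)
    (hSσ : ∀ b ∈ B, S (adj ω hω b) = adj ω hω (S b)) (hCB : C ≤ B)
    (hBσ : ∀ b ∈ B, adj ω hω b ∈ B)
    (hC : ∀ b ∈ B, S b = b ↔ b ∈ C) :
    IsSymmetricSubgroup (unitaries ω C) (unitaries ω B) := by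
  have hex : ∀ g : unitaries ω B, ∃ h : unitaries ω B,
      toEnd (h : isometryGroup ω) = S (toEnd (g : isometryGroup ω)) := by
    intro g
    have hg : toEnd (g : isometryGroup ω) ∈ B := g.2
    have h1 : adj ω hω (S (toEnd (g : isometryGroup ω))) * S (toEnd (g : isometryGroup ω)) = 1 := by
      rw [← hSσ _ hg, ← hS.map_mul _ (hBσ _ hg) _ hg, adj_toEnd, ← map_mul, inv_mul_cancel,
        map_one, hS.map_one]
    obtain ⟨h, hh⟩ := exists_toEnd_eq hω ((adj_mul_self_eq_one_iff hω hε).mp h1)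
    exact ⟨⟨h, by rw [mem_unitaries, hh]; exact hS.mem _ hg⟩, hh⟩
  choose θ hθ using hex
  have hinj : ∀ g h : unitaries ω B,
      toEnd (g : isometryGroup ω) = toEnd (h : isometryGroup ω) → g = h := fun g h e =>
    Subtype.ext (toEnd_injective e)
  have hinv : ∀ g, θ (θ g) = g := fun g => hinj _ _ (by rw [hθ, hθ, hS.invol _ g.2])
  refine ⟨⟨⟨θ, θ, hinv, hinv⟩, fun g h => hinj _ _ ?_⟩, hinv, ⟨S, fun g => (hθ g).symm⟩, ?_⟩
  · change toEnd (θ (g * h) : isometryGroup ω) =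
      toEnd ((θ g : isometryGroup ω) * (θ h : isometryGroup ω))
    rw [hθ, map_mul, hθ, hθ, ← hS.map_mul _ g.2 _ h.2, ← map_mul toEnd]
    rfl
  · ext g
    rw [Subgroup.mem_map]
    constructor
    · intro hg
      have hgB : toEnd g ∈ B := hCB hg
      refine ⟨⟨g, hgB⟩, hinj _ _ ?_, rfl⟩
      change toEnd (θ ⟨g, hgB⟩ : isometryGroup ω) = toEnd g
      rw [hθ]
      exact (hC _ hgB).mpr hg
    · rintro ⟨g, hg, rfl⟩
      have h1 : θ g = g := hg
      have h2 := hθ g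
      rw [h1] at h2
      exact (hC _ g.2).mp h2.symm

/-- Reciprocity for a dual pair `(G, G')`: a symmetric subgroup `H` of `G` belongs to a dual pair
`(H, H')`, and `G'` is a symmetric subgroup of `H'`. -/
theorem reciprocity (hω : ω.Nondegenerate) {ε : ℂ}
    (hε : ∀ x y, ω x y = ε * ω y x) {G G' H : Subgroup (isometryGroup ω)} (hG : IsDualPair G G')
    (hH : IsSymmetricSubgroup H G) :
    IsDualPair H (commutant H) ∧ IsSymmetricSubgroup G' (commutant H) := by
  obtain ⟨θ, hθ, ⟨T, hTθ⟩, rfl⟩ := hH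
  have hσ := isTraceInvolution_adj hω hε
  have hT := isAlgInvolution_of_linear hθ hTθ
  have hσT := adj_comm_of_linear hω hTθ
  have hss : IsSemisimpleRing (groupAlg G) :=
    (isSemisimpleRepresentation_iff G).mp hG.reductive_left
  have hss0 := hT.isSemisimpleRing_even
  have hσA : ∀ a ∈ groupAlg G, adj ω hω a ∈ groupAlg G := fun a ha => adj_mem_groupAlg hω ha
  have hσ0 : ∀ a ∈ hT.even, adj ω hω a ∈ hT.even := fun a ha => hT.anti_mem_even hσA hσT ha
  have hGA : ∀ g, toEnd g ∈ groupAlg G → g ∈ G := by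
    intro g hg
    rw [hG.eq_left, mem_commutant_iff]
    intro h hh
    rw [hG.eq_right, mem_commutant_iff_mem_centralizer, Subalgebra.mem_centralizer_iff] at hh
    exact (hh _ hg).symm
  have hHeven : (MonoidHom.eqLocus θ.toMonoidHom (MonoidHom.id G)).map G.subtype =
      unitaries ω hT.even := by
    ext g
    rw [Subgroup.mem_map]
    constructor
    · rintro ⟨g, hg, rfl⟩
      refine ⟨toEnd_mem_groupAlg g.2, ?_⟩
      have h1 : θ g = g := hg
      have h2 := hTθ g
      rw [h1] at h2
      exact h2
    · intro hg
      refine ⟨⟨g, hGA g hg.1⟩, ?_, rfl⟩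
      have h2 := hTθ ⟨g, hGA g hg.1⟩
      have h3 : T (toEnd g) = toEnd g := hg.2
      exact Subtype.ext (toEnd_injective (h2.symm.trans h3))
  rw [hHeven]
  refine ⟨isDualPair_unitaries hω hε hσ0, ?_⟩
  obtain ⟨S, hS, hSσ, hfix⟩ := hT.exists_reciprocal hσ hσA hσT
  rw [commutant_eq_unitaries, groupAlg_unitaries hω hε hσ0, hG.eq_right, commutant_eq_unitaries]
  refine isSymmetricSubgroup_unitaries hω hε hS hSσ ?_
    (fun b hb => adj_mem_centralizer hω hε hσ0 hb) hfix
  intro c hc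
  rw [Subalgebra.mem_centralizer_iff] at hc ⊢
  exact fun a ha => hc a ha.1

end SymmetricSubgroups

/-! ### Families of automorphisms and contragredients -/

section Blocks

variable {W : Type u} [AddCommGroup W] [Module ℂ W] {ω : LinearMap.BilinForm ℂ W}
  {ι : Type*} {U : Type*} [AddCommGroup U] [Module ℂ U] (e : W ≃ₗ[ℂ] (ι → U))

/-- The automorphism of `W ≃ (ι → U)` acting on the component of index `s` by `y s`. -/
def fam : (ι → (U ≃ₗ[ℂ] U)) →* (W ≃ₗ[ℂ] W) where
  toFun y := e.trans ((LinearEquiv.piCongrRight y).trans e.symm)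
  map_one' := by
    ext w
    apply e.injective
    ext s
    simp
  map_mul' y z := by
    ext w
    apply e.injective
    ext s
    simp

@[simp]
theorem fam_apply (y : ι → (U ≃ₗ[ℂ] U)) (w : W) (s : ι) : e (fam e y w) s = y s (e w s) := by
  simp [fam]

theorem fam_injective : Function.Injective (fam e) := by
  intro y z h
  ext s m
  have := congrFun (congrArg e (LinearEquiv.congr_fun h (e.symm fun _ => m))) s
  simpa using this

theorem eq_fam_iff {f : W ≃ₗ[ℂ] W} {y : ι → (U ≃ₗ[ℂ] U)} :
    f = fam e y ↔ ∀ w s, e (f w) s = y s (e w s) := by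
  constructor
  · rintro rfl w s
    exact fam_apply e y w s
  · intro h
    ext w
    apply e.injective
    ext s
    rw [h, fam_apply]

variable [DecidableEq ι]

/-- The elementary endomorphism of `W ≃ (ι → U)` carrying the component of index `t` to that of
index `s`. -/
def elem (s t : ι) : Module.End ℂ W :=
  (e.symm : (ι → U) →ₗ[ℂ] W) ∘ₗ LinearMap.single ℂ (fun _ => U) s ∘ₗ
    LinearMap.proj t ∘ₗ (e : W →ₗ[ℂ] (ι → U))

@[simp]
theorem elem_apply (s t : ι) (w : W) : e (elem e s t w) = Pi.single s (e w t) := by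
  simp [elem]

/-- An endomorphism commuting with the elementary endomorphisms inside each class of indices
acts componentwise, through one endomorphism of `U` for each class. -/
theorem exists_of_commute_elem {T : Type*} {c : ι → T} (hc : Function.Surjective c)
    {x : Module.End ℂ W} (hx : ∀ s t, c s = c t → Commute x (elem e s t)) :
    ∃ y : T → Module.End ℂ U, ∀ w s, e (x w) s = y (c s) (e w s) := by
  obtain ⟨r, hr⟩ := hc.hasRightInverse
  refine ⟨fun τ => LinearMap.proj (r τ) ∘ₗ (e : W →ₗ[ℂ] (ι → U)) ∘ₗ x ∘ₗ
    (e.symm : (ι → U) →ₗ[ℂ] W) ∘ₗ LinearMap.single ℂ (fun _ => U) (r τ), fun w s => ?_⟩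
  have h := LinearMap.congr_fun (hx (r (c s)) s (hr _)).eq w
  have h' := congrFun (congrArg e h) (r (c s))
  simp only [Module.End.mul_apply, elem_apply, Pi.single_eq_same] at h'
  rw [← h']
  simp [elem]

theorem toEnd_inv_eq (g : isometryGroup ω) : toEnd g * toEnd g⁻¹ = 1 := by
  rw [← map_mul, mul_inv_cancel, map_one]

/-- The commutant of a group of isometries which acts on `W ≃ (ι → U)` by matrices that are
block diagonal for a partition of `ι`, and which generates all such matrices. -/
theorem mem_commutant_iff_fam [Fintype ι] {T : Type*} {c : ι → T} (hc : Function.Surjective c)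
    {H : Subgroup (isometryGroup ω)}
    (hel : ∀ x : Module.End ℂ W, (∀ h ∈ H, Commute x (toEnd h)) →
      ∀ s t, c s = c t → Commute x (elem e s t))
    (hmat : ∀ h ∈ H, ∃ a : ι → ι → ℂ, (∀ s t, c s ≠ c t → a s t = 0) ∧
      ∀ w s, e (toEnd h w) s = ∑ t, a s t • e w t) (g : isometryGroup ω) :
    g ∈ commutant H ↔ ∃ y : T → (U ≃ₗ[ℂ] U), (g : W ≃ₗ[ℂ] W) = fam e (y ∘ c) := by
  constructor
  · intro hg
    have h1 : ∀ g ∈ commutant H, ∃ y : T → Module.End ℂ U,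
        ∀ w s, e (toEnd g w) s = y (c s) (e w s) := by
      intro g hg
      rw [mem_commutant_iff] at hg
      exact exists_of_commute_elem e hc (hel _ fun h hh => (hg h hh).symm)
    obtain ⟨y, hy⟩ := h1 g hg
    obtain ⟨z, hz⟩ := h1 g⁻¹ (Subgroup.inv_mem _ hg)
    have hyz : ∀ τ, y τ * z τ = 1 ∧ z τ * y τ = 1 := by
      intro τ
      obtain ⟨s, rfl⟩ := hc τ
      constructor
      · ext m
        have := hy (toEnd g⁻¹ (e.symm fun _ => m)) s
        rw [hz, ← Module.End.mul_apply, toEnd_inv_eq] at this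
        simpa using this.symm
      · ext m
        have := hz (toEnd g (e.symm fun _ => m)) s
        have h2 := toEnd_inv_eq g⁻¹
        rw [inv_inv] at h2
        rw [hy, ← Module.End.mul_apply, h2] at this
        simpa using this.symm
    refine ⟨fun τ => LinearEquiv.ofLinearMap (y τ) (z τ) (hyz τ).1 (hyz τ).2, ?_⟩
    rw [eq_fam_iff]
    exact hy
  · rintro ⟨y, hy⟩
    rw [eq_fam_iff] at hy
    rw [mem_commutant_iff]
    intro h hh
    obtain ⟨a, ha0, ha⟩ := hmat h hh
    ext w
    apply e.injective
    ext s
    have h1 : ∀ w s, e (toEnd g w) s = y (c s) (e w s) := hy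
    rw [Module.End.mul_apply, Module.End.mul_apply, ha, h1, ha, map_sum]
    refine Finset.sum_congr rfl fun t _ => ?_
    rw [h1, map_smul]
    by_cases hst : c s = c t
    · rw [hst]
    · rw [ha0 s t hst, zero_smul, zero_smul]

variable [Fintype ι] {B : ι → ι → ℂ} {β : LinearMap.BilinForm ℂ U}
  (hform : ∀ w w', ω w w' = ∑ s, ∑ t, B s t * β (e w s) (e w' t))

include hform in
theorem form_single (s t : ι) (m m' : U) :
    ω (e.symm (Pi.single s m)) (e.symm (Pi.single t m')) = B s t * β m m' := by
  rw [hform, Finset.sum_eq_single s, Finset.sum_eq_single t]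
  · simp
  · intro t' _ ht'; simp [ht']
  · simp
  · intro s' _ hs'; simp [hs']
  · simp

include hform in
/-- For a form on `W` which is the product of a matrix `B` and a form `β` on `U`, componentwise
automorphisms are isometries when they preserve `β` between the components paired by `B`. -/
theorem fam_mem_isometryGroup_iff (y : ι → (U ≃ₗ[ℂ] U)) :
    fam e y ∈ isometryGroup ω ↔
      ∀ s t, B s t ≠ 0 → ∀ m m', β (y s m) (y t m') = β m m' := by
  constructor
  · intro h s t hst m m'
    have h1 := h (e.symm (Pi.single s m)) (e.symm (Pi.single t m'))
    have h2 : ∀ s m, fam e y (e.symm (Pi.single s m)) = e.symm (Pi.single s (y s m)) := by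
      intro s m
      apply e.injective
      ext s'
      rw [fam_apply, LinearEquiv.apply_symm_apply, LinearEquiv.apply_symm_apply]
      by_cases hs : s' = s
      · subst hs; simp
      · simp [hs]
    rw [h2, h2, form_single e hform, form_single e hform] at h1
    exact mul_left_cancel₀ hst h1
  · intro h w w'
    rw [hform, hform]
    refine Finset.sum_congr rfl fun s _ => Finset.sum_congr rfl fun t _ => ?_
    by_cases hst : B s t = 0
    · rw [hst, zero_mul, zero_mul]
    · rw [fam_apply, fam_apply, h s t hst]

include hform in
theorem form_swap (hω : ω.IsAlt) {ε : ℂ} (hB : ∀ s t, B s t = ε * B t s)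
    {s₀ t₀ : ι} (h0 : B s₀ t₀ ≠ 0) (m m' : U) : β m m' = -ε * β m' m := by
  have h1 := hω.neg_eq (e.symm (Pi.single t₀ m')) (e.symm (Pi.single s₀ m))
  rw [form_single e hform, form_single e hform, hB] at h1
  refine mul_left_cancel₀ h0 ?_
  linear_combination -h1

include hform in
theorem form_nondegenerate [FiniteDimensional ℂ U] (hω : ω.Nondegenerate) [Nonempty ι] :
    β.Nondegenerate := by
  refine LinearMap.BilinForm.nondegenerate_iff_ker_eq_bot.mpr ?_
  rw [LinearMap.ker_eq_bot']
  intro m hm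
  obtain ⟨s⟩ := ‹Nonempty ι›
  have h : e.symm (Pi.single s m) = 0 := by
    refine hω.1 _ fun w' => ?_
    rw [hform]
    refine Finset.sum_eq_zero fun s' _ => Finset.sum_eq_zero fun t _ => ?_
    rw [LinearEquiv.apply_symm_apply]
    by_cases hs : s' = s
    · subst hs; simp [hm]
    · simp [hs]
  have h2 : (Pi.single s m : ι → U) = 0 := by simpa using h
  simpa using h2

theorem isAlt_of_swap (h : ∀ m m', β m m' = -1 * β m' m) : β.IsAlt := by
  intro m
  have := h m m
  linear_combination this / 2

theorem isSymm_of_swap (h : ∀ m m', β m m' = -(-1) * β m' m) : β.IsSymm :=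
  ⟨fun m m' => by simpa using h m m'⟩

theorem swap_of_isAlt (h : β.IsAlt) (m m' : U) : β m m' = -1 * β m' m := by
  rw [← h.neg_eq m' m]; ring

theorem swap_of_isSymm (h : β.IsSymm) (m m' : U) : β m m' = 1 * β m' m := by
  rw [h.eq m m', one_mul]

end Blocks

section Contragredient

variable {U : Type*} [AddCommGroup U] [Module ℂ U] [FiniteDimensional ℂ U]
  {β : LinearMap.BilinForm ℂ U} (hβ : β.Nondegenerate)

/-- The contragredient of an automorphism with respect to a nondegenerate form `β`: the inverse
transpose, transported from the dual space to the space itself by `β`. -/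
noncomputable def contra : (U ≃ₗ[ℂ] U) →* (U ≃ₗ[ℂ] U) where
  toFun y := (β.toDual hβ).trans (y.symm.dualMap.trans (β.toDual hβ).symm)
  map_one' := by
    ext m
    apply (β.toDual hβ).injective
    ext m'
    simp [LinearMap.BilinForm.toDual_def]
    rfl
  map_mul' y z := by
    ext m
    apply (β.toDual hβ).injective
    ext m'
    simp [LinearMap.BilinForm.toDual_def]
    rfl

theorem form_contra (y : U ≃ₗ[ℂ] U) (m m' : U) : β (contra hβ y m) m' = β m (y⁻¹ m') := by
  rw [← LinearMap.BilinForm.toDual_def hβ]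
  simp [contra, LinearMap.BilinForm.toDual_def]

theorem form_contra_apply (y : U ≃ₗ[ℂ] U) (m m' : U) : β (contra hβ y m) (y m') = β m m' := by
  rw [form_contra, ← LinearEquiv.mul_apply, inv_mul_cancel, LinearEquiv.coe_one, id]

theorem eq_contra_of_forall {y z : U ≃ₗ[ℂ] U} (h : ∀ m m', β (z m) (y m') = β m m') :
    z = contra hβ y := by
  ext m
  refine eq_of_forall_form hβ fun m' => ?_
  have := h m (y⁻¹ m')
  rw [← LinearEquiv.mul_apply, mul_inv_cancel, LinearEquiv.coe_one, id] at this
  rw [this, form_contra]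

end Contragredient

/-! ### Sums of copies of a space with a form -/

section FormType

variable {V : Type v} [AddCommGroup V] [Module ℂ V] [FiniteDimensional ℂ V]
  {Bf : LinearMap.BilinForm ℂ V} (hBf : Bf.Nondegenerate)
  {ε : ℂ} (hε : ∀ x y, Bf x y = ε * Bf y x)

/-- The endomorphisms commuting with an idempotent form a von Neumann regular algebra. -/
theorem isRegularAlg_centralizer_idempotent {π : Module.End ℂ V} (hπ : π * π = π) :
    IsRegularAlg (Subalgebra.centralizer ℂ {π}) := by
  intro h hh
  rw [Subalgebra.mem_centralizer_iff] at hh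
  have hc : π * h = h * π := hh π rfl
  have : IsSemisimpleRing (Module.End ℂ V) := IsSemisimpleRing.moduleEnd ℂ V
  have : IsSemisimpleRing (⊤ : Subalgebra ℂ (Module.End ℂ V)) :=
    (Subalgebra.topEquiv (R := ℂ) (A := Module.End ℂ V)).symm.toRingEquiv.isSemisimpleRing
  obtain ⟨a, -, ha⟩ := isRegularAlg_of_isSemisimpleRing
    (A := (⊤ : Subalgebra ℂ (Module.End ℂ V))) h trivial
  refine ⟨π * a * π + (1 - π) * a * (1 - π), ?_, ?_⟩
  · rw [Subalgebra.mem_centralizer_iff]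
    intro g hg
    rw [Set.mem_singleton_iff.mp hg]
    have h1 : π * (1 - π) = 0 := by rw [mul_sub, mul_one, hπ, sub_self]
    have h2 : (1 - π) * π = 0 := by rw [sub_mul, one_mul, hπ, sub_self]
    rw [mul_add, add_mul, ← mul_assoc, ← mul_assoc, hπ, ← mul_assoc, ← mul_assoc, h1,
      mul_assoc (π * a), hπ, mul_assoc _ (1 - π) π, h2]
    simp
  · have h1 : (1 - π) * h = h * (1 - π) := by rw [sub_mul, mul_sub, hc, one_mul, mul_one]
    have h2 : (1 - π) * (1 - π) = 1 - π := by
      rw [mul_sub, mul_one, sub_mul, one_mul, hπ, sub_self, sub_zero]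
    calc h * (π * a * π + (1 - π) * a * (1 - π)) * h
        = (h * π) * a * (π * h) + (h * (1 - π)) * a * ((1 - π) * h) := by noncomm_ring
      _ = π * (h * a * h) * π + (1 - π) * (h * a * h) * (1 - π) := by
          have h3 : h * π * a * (π * h) = π * h * a * (h * π) := by rw [hc]
          have h4 : h * (1 - π) * a * ((1 - π) * h) = (1 - π) * h * a * (h * (1 - π)) := by rw [h1]
          rw [h3, h4]; simp only [mul_assoc]
      _ = (π * π) * h + ((1 - π) * (1 - π)) * h := by
          rw [ha, mul_assoc, ← hc, mul_assoc _ h, ← h1, mul_assoc, mul_assoc]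
      _ = h := by rw [hπ, h2]; noncomm_ring

include hBf hε in
/-- The isometries commuting with an idempotent `π` which is self-adjoint or has adjoint `1 - π`
generate the algebra of all endomorphisms commuting with `π`. -/
theorem mem_of_isometry_mem {π : Module.End ℂ V} (hπ : π * π = π)
    (hadj : adj Bf hBf π = π ∨ adj Bf hBf π = 1 - π) {D : Subalgebra ℂ (Module.End ℂ V)}
    (hD : ∀ g : isometryGroup Bf, Commute (toEnd g) π → toEnd g ∈ D) {a : Module.End ℂ V}
    (ha : Commute a π) : a ∈ D := by
  have hσ := isTraceInvolution_adj hBf hε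
  refine le_of_unitary_mem hσ (A := Subalgebra.centralizer ℂ {π}) ?_
    (isRegularAlg_centralizer_idempotent hπ) ?_ ?_
  · intro c hc
    rw [Subalgebra.mem_centralizer_iff] at hc ⊢
    rintro _ rfl
    have h1 := congrArg (adj Bf hBf) (hc _ rfl)
    rw [hσ.map_mul, hσ.map_mul] at h1
    rcases hadj with h | h
    · rw [h] at h1; exact h1.symm
    · rw [h, mul_sub, sub_mul, mul_one, one_mul, sub_right_inj] at h1; exact h1.symm
  · intro u hu hu1
    rw [Subalgebra.mem_centralizer_iff] at hu
    obtain ⟨g, rfl⟩ := exists_toEnd_eq hBf ((adj_mul_self_eq_one_iff hBf hε).mp hu1)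
    exact hD g (hu _ rfl).symm
  · rw [Subalgebra.mem_centralizer_iff]
    rintro _ rfl
    exact ha.eq.symm

/-- The center of `End V` consists of the scalars. -/
theorem exists_smul_one_of_forall_commute {T : Module.End ℂ V} (h : ∀ a, Commute T a) :
    ∃ c : ℂ, T = c • 1 := by
  have h1 : T ∈ Subalgebra.center ℂ (Module.End ℂ V) :=
    Subalgebra.mem_center_iff.mpr fun a => (h a).eq.symm
  rw [Algebra.IsCentral.center_eq_bot] at h1
  obtain ⟨c, hc⟩ := Algebra.mem_bot.mp h1
  exact ⟨c, by rw [← hc, Algebra.algebraMap_eq_smul_one]⟩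

include hBf hε in
/-- Schur's lemma for forms: an invariant form is a multiple of the given one. -/
theorem exists_eq_mul_of_invariant {F : LinearMap.BilinForm ℂ V}
    (hF : ∀ g : isometryGroup Bf, ∀ x y, F (toEnd g x) (toEnd g y) = F x y) :
    ∃ c : ℂ, ∀ x y, F x y = c * Bf x y := by
  let T : Module.End ℂ V := ((Bf.toDual hBf).symm : Module.Dual ℂ V →ₗ[ℂ] V) ∘ₗ F
  have hT : ∀ x y, Bf (T x) y = F x y := fun x y => by
    simp only [T, LinearMap.comp_apply]
    exact LinearMap.BilinForm.apply_toDual_symm_apply _ _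
  obtain ⟨c, hc⟩ := exists_smul_one_of_forall_commute (T := T) fun a => by
    have h1 : a ∈ Subalgebra.centralizer ℂ {T} := by
      refine mem_of_isometry_mem hBf hε (π := 1) (mul_one 1)
        (Or.inl (isTraceInvolution_adj hBf hε).map_one) ?_ (Commute.one_right a)
      intro g _
      rw [Subalgebra.mem_centralizer_iff]
      rintro _ rfl
      ext x
      refine eq_of_forall_form hBf fun z => ?_
      have hz : toEnd g (toEnd g⁻¹ z) = z := by
        rw [← Module.End.mul_apply, toEnd_inv_eq, Module.End.one_apply]
      rw [Module.End.mul_apply, Module.End.mul_apply, hT, ← hz, hF, ← hT]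
      exact (g.2 _ _).symm
    exact (Subalgebra.mem_centralizer_iff ℂ).mp h1 T rfl
  refine ⟨c, fun x y => ?_⟩
  rw [← hT, hc]
  simp

variable {W : Type u} [AddCommGroup W] [Module ℂ W] {ω : LinearMap.BilinForm ℂ W}
  {ι κ : Type*} [Fintype ι] (e₀ : W ≃ₗ[ℂ] (κ → V)) (b : Module.Basis ι ℂ V)

/-- A sum of copies of `V`, indexed by `κ`, becomes after the choice of a basis of `V`, indexed by
`ι`, a sum of copies of the multiplicity space `κ → ℂ`, indexed by `ι`. -/
noncomputable def flipB : W ≃ₗ[ℂ] (ι → κ → ℂ) where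
  toFun w s k := b.repr (e₀ w k) s
  invFun f := e₀.symm fun k => b.equivFun.symm fun s => f s k
  map_add' w w' := by ext s k; simp
  map_smul' c w := by ext s k; simp
  left_inv w := by
    apply e₀.injective
    ext k
    simp only [LinearEquiv.apply_symm_apply]
    exact b.equivFun.symm_apply_apply (e₀ w k)
  right_inv f := by
    ext s k
    simp only [LinearEquiv.apply_symm_apply]
    exact congrFun (b.equivFun.apply_symm_apply fun s => f s k) s

omit [FiniteDimensional ℂ V] in
theorem flipB_apply (w : W) (s : ι) (k : κ) : flipB e₀ b w s k = b.repr (e₀ w k) s := rfl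

/-- An endomorphism of `V` acting on each of the summands of `W ≃ (κ → V)`. -/
def amp : Module.End ℂ V →ₐ[ℂ] Module.End ℂ W where
  toFun a := (e₀.symm : (κ → V) →ₗ[ℂ] W) ∘ₗ LinearMap.compLeft a κ ∘ₗ (e₀ : W →ₗ[ℂ] (κ → V))
  map_one' := by
    ext w
    apply e₀.injective
    ext k
    simp
  map_mul' a a' := by
    ext w
    apply e₀.injective
    ext k
    simp
  map_zero' := by
    ext w
    apply e₀.injective
    ext k
    simp
  map_add' a a' := by
    ext w
    apply e₀.injective
    ext k
    simp
  commutes' c := by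
    ext w
    apply e₀.injective
    ext k
    simp [Algebra.algebraMap_eq_smul_one]

omit [FiniteDimensional ℂ V] in
@[simp]
theorem amp_apply (a : Module.End ℂ V) (w : W) (k : κ) : e₀ (amp e₀ a w) k = a (e₀ w k) := by
  simp [amp]

omit [FiniteDimensional ℂ V] in
theorem amp_matrix (a : Module.End ℂ V) (w : W) (s : ι) :
    flipB e₀ b (amp e₀ a w) s = ∑ t, b.repr (a (b t)) s • flipB e₀ b w t := by
  ext k
  rw [flipB_apply, amp_apply, Finset.sum_apply]
  conv_lhs => rw [← b.sum_repr (e₀ w k)]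
  rw [map_sum, map_sum, Finset.sum_apply']
  refine Finset.sum_congr rfl fun t _ => ?_
  simp [flipB_apply, mul_comm]

variable [DecidableEq ι]

/-- The matrix units of a basis of `V`. -/
noncomputable def unit (s t : ι) : Module.End ℂ V := (b.coord t).smulRight (b s)

omit [FiniteDimensional ℂ V] in
theorem amp_unit (s t : ι) : amp e₀ (unit b s t) = elem (flipB e₀ b) s t := by
  ext w
  apply (flipB e₀ b).injective
  ext s' k
  rw [elem_apply, flipB_apply, amp_apply]
  by_cases h : s' = s
  · subst h; simp [unit, flipB_apply]
  · simp [unit, h]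

variable {Φ : isometryGroup Bf → isometryGroup ω}
  (hΦ : ∀ g w k, e₀ (toEnd (Φ g) w) k = toEnd g (e₀ w k))

omit [FiniteDimensional ℂ V] in
include hΦ in
theorem toEnd_eq_amp (g : isometryGroup Bf) : toEnd (Φ g) = amp e₀ (toEnd g) := by
  ext w
  apply e₀.injective
  ext k
  rw [hΦ, amp_apply]

include hBf hε hΦ in
/-- An endomorphism of `W` commuting with the isometries that respect `π` commutes with the
elementary endomorphisms given by the matrix units that commute with `π`. -/
theorem commute_elem_of_commute_isometries {π : Module.End ℂ V} (hπ : π * π = π)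
    (hadj : adj Bf hBf π = π ∨ adj Bf hBf π = 1 - π) {x : Module.End ℂ W}
    (hx : ∀ g, Commute (toEnd g) π → Commute x (toEnd (Φ g))) {s t : ι}
    (hst : Commute (unit b s t) π) : Commute x (elem (flipB e₀ b) s t) := by
  have h : unit b s t ∈ (Subalgebra.centralizer ℂ {x}).comap (amp e₀) := by
    refine mem_of_isometry_mem hBf hε hπ hadj (fun g hg => ?_) hst
    rw [Subalgebra.mem_comap, Subalgebra.mem_centralizer_iff]
    rintro _ rfl
    rw [← toEnd_eq_amp e₀ hΦ]
    exact hx g hg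
  rw [Subalgebra.mem_comap, Subalgebra.mem_centralizer_iff] at h
  rw [← amp_unit]
  exact h x rfl

omit [DecidableEq ι] in
include hBf hε hΦ in
/-- An invariant form on a sum of copies of `V` is the product of the form on `V` and a form on
the multiplicity space. -/
theorem exists_form_eq [Fintype κ] [DecidableEq κ] : ∃ β : LinearMap.BilinForm ℂ (κ → ℂ),
    ∀ w w', ω w w' = ∑ s, ∑ t, Bf (b s) (b t) * β (flipB e₀ b w s) (flipB e₀ b w' t) := by
  have h1 : ∀ k k' : κ, ∃ c : ℂ, ∀ x y,
      ω (e₀.symm (Pi.single k x)) (e₀.symm (Pi.single k' y)) = c * Bf x y := by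
    intro k k'
    let F : LinearMap.BilinForm ℂ V := ω.compl₁₂
      ((e₀.symm : (κ → V) →ₗ[ℂ] W) ∘ₗ LinearMap.single ℂ (fun _ => V) k)
      ((e₀.symm : (κ → V) →ₗ[ℂ] W) ∘ₗ LinearMap.single ℂ (fun _ => V) k')
    refine exists_eq_mul_of_invariant hBf hε (F := F) fun g x y => ?_
    have h2 : ∀ k x, e₀.symm (Pi.single k (toEnd g x)) = toEnd (Φ g) (e₀.symm (Pi.single k x)) := by
      intro k x
      apply e₀.injective
      ext k'
      rw [hΦ, LinearEquiv.apply_symm_apply, LinearEquiv.apply_symm_apply]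
      by_cases hk : k' = k
      · subst hk; simp
      · simp [hk]
    change ω (e₀.symm (Pi.single k (toEnd g x))) (e₀.symm (Pi.single k' (toEnd g y))) =
      ω (e₀.symm (Pi.single k x)) (e₀.symm (Pi.single k' y))
    rw [h2, h2]
    exact (Φ g).2 _ _
  choose c hc using h1
  refine ⟨Matrix.toBilin' (Matrix.of c), fun w w' => ?_⟩
  have h3 : ∀ w, w = ∑ k, e₀.symm (Pi.single k (e₀ w k)) := by
    intro w
    apply e₀.injective
    simp only [map_sum, LinearEquiv.apply_symm_apply]
    exact (Finset.univ_sum_single (e₀ w)).symm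
  have h4 : ∀ x y, Bf x y = ∑ s, ∑ t, Bf (b s) (b t) * (b.repr x s * b.repr y t) := by
    intro x y
    conv_lhs => rw [← b.sum_repr x, ← b.sum_repr y]
    simp only [map_sum, map_smul, LinearMap.sum_apply, LinearMap.smul_apply, smul_eq_mul]
    rw [Finset.sum_comm]
    refine Finset.sum_congr rfl fun t _ => ?_
    rw [Finset.mul_sum]
    exact Finset.sum_congr rfl fun s _ => by ring
  calc ω w w' = ∑ k, ∑ k', c k k' * Bf (e₀ w k) (e₀ w' k') := by
        conv_lhs => rw [h3 w, h3 w']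
        simp only [map_sum, LinearMap.sum_apply, hc]
        rw [Finset.sum_comm]
    _ = ∑ k, ∑ k', ∑ s, ∑ t, Bf (b s) (b t) *
          (b.repr (e₀ w k) s * c k k' * b.repr (e₀ w' k') t) := by
        refine Finset.sum_congr rfl fun k _ => Finset.sum_congr rfl fun k' _ => ?_
        rw [h4, Finset.mul_sum]
        refine Finset.sum_congr rfl fun s _ => ?_
        rw [Finset.mul_sum]
        exact Finset.sum_congr rfl fun t _ => by ring
    _ = ∑ s, ∑ t, ∑ k, ∑ k', Bf (b s) (b t) *
          (b.repr (e₀ w k) s * c k k' * b.repr (e₀ w' k') t) := by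
        rw [Finset.sum_congr rfl fun k _ => Finset.sum_comm, Finset.sum_comm]
        refine Finset.sum_congr rfl fun s _ => ?_
        rw [Finset.sum_congr rfl fun k _ => Finset.sum_comm, Finset.sum_comm]
    _ = _ := by
        refine Finset.sum_congr rfl fun s _ => Finset.sum_congr rfl fun t _ => ?_
        rw [Matrix.toBilin'_apply, Finset.mul_sum]
        refine Finset.sum_congr rfl fun k _ => ?_
        rw [Finset.mul_sum]
        rfl

end FormType

/-! ### Sums of copies of a space and its dual -/

section LinearType

variable {V : Type v} [AddCommGroup V] [Module ℂ V] [FiniteDimensional ℂ V]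

/-- The automorphisms of `V` span `End V`: every endomorphism becomes invertible after subtracting
it from a suitable scalar. -/
theorem commute_of_forall_automorphism {T : Module.End ℂ V}
    (h : ∀ g : V ≃ₗ[ℂ] V, Commute T (g : V →ₗ[ℂ] V)) (a : Module.End ℂ V) : Commute T a := by
  obtain ⟨μ, hμ⟩ := (Module.End.finite_spectrum a).exists_notMem
  rw [spectrum.notMem_iff] at hμ
  obtain ⟨y, hy⟩ := hμ
  have h1 : Commute T (y : Module.End ℂ V) :=
    h (LinearMap.GeneralLinearGroup.generalLinearEquiv ℂ V y)
  have h2 : a = algebraMap ℂ (Module.End ℂ V) μ - y := by rw [hy]; abel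
  rw [h2]
  have h3 : Commute T (algebraMap ℂ (Module.End ℂ V) μ) := (Algebra.commutes μ T).symm
  exact h3.sub_right h1

/-- An invariant pairing of `V` and its dual is a multiple of the canonical one. -/
theorem exists_eq_mul_of_invariant_pairing {F : V →ₗ[ℂ] Module.Dual ℂ V →ₗ[ℂ] ℂ}
    (hF : ∀ (g : V ≃ₗ[ℂ] V) x f, F (g x) (f ∘ₗ (g⁻¹ : V ≃ₗ[ℂ] V)) = F x f) :
    ∃ c : ℂ, ∀ x f, F x f = c * f x := by
  let T : Module.End ℂ V := ((Module.evalEquiv ℂ V).symm :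
    Module.Dual ℂ (Module.Dual ℂ V) →ₗ[ℂ] V) ∘ₗ F
  have hT : ∀ x f, f (T x) = F x f := fun x f => by
    have : Module.evalEquiv ℂ V (T x) = F x := by simp [T]
    rw [← this]
    rfl
  obtain ⟨c, hc⟩ := exists_smul_one_of_forall_commute (T := T) <|
    commute_of_forall_automorphism fun g => by
      refine LinearMap.ext fun x => ?_
      apply (Module.evalEquiv ℂ V).injective
      refine LinearMap.ext fun f => ?_
      change f ((T * (g : V →ₗ[ℂ] V)) x) = f (((g : V →ₗ[ℂ] V) * T) x)
      have h1 : f = (f ∘ₗ (g : V →ₗ[ℂ] V)) ∘ₗ (g⁻¹ : V ≃ₗ[ℂ] V) := by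
        ext x
        simp
      rw [Module.End.mul_apply, Module.End.mul_apply, hT]
      conv_lhs => rw [h1]
      have := hF g x (f ∘ₗ (g : V →ₗ[ℂ] V))
      rw [← hT x] at this
      exact this
  refine ⟨c, fun x f => ?_⟩
  rw [← hT, hc]
  simp

variable {W : Type u} [AddCommGroup W] [Module ℂ W] {ω : LinearMap.BilinForm ℂ W}
  {ι κ : Type*} [Fintype κ] [DecidableEq κ]
  (e₀ : W ≃ₗ[ℂ] (κ → V) × (κ → Module.Dual ℂ V))
  {Φ : (V ≃ₗ[ℂ] V) → isometryGroup ω}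
  (hΦ : ∀ g w, (∀ k, (e₀ (toEnd (Φ g) w)).1 k = g ((e₀ w).1 k)) ∧
    ∀ k v, (e₀ (toEnd (Φ g) w)).2 k v = (e₀ w).2 k ((g⁻¹ : V ≃ₗ[ℂ] V) v))

include hΦ in
/-- An invariant alternating form on a sum of copies of `V` and its dual is the product of the
canonical pairing and a pairing of the multiplicity spaces. -/
theorem exists_pairing_eq (hω : ω.IsAlt) : ∃ γ : κ → κ → ℂ, ∀ w w', ω w w' =
    ∑ k, ∑ j, γ k j * ((e₀ w').2 j ((e₀ w).1 k) - (e₀ w).2 j ((e₀ w').1 k)) := by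
  let i₁ : (κ → V) →ₗ[ℂ] W :=
    (e₀.symm : ((κ → V) × (κ → Module.Dual ℂ V)) →ₗ[ℂ] W) ∘ₗ
      LinearMap.inl ℂ (κ → V) (κ → Module.Dual ℂ V)
  let i₂ : (κ → Module.Dual ℂ V) →ₗ[ℂ] W :=
    (e₀.symm : ((κ → V) × (κ → Module.Dual ℂ V)) →ₗ[ℂ] W) ∘ₗ
      LinearMap.inr ℂ (κ → V) (κ → Module.Dual ℂ V)
  have he₁ : ∀ x, e₀ (i₁ x) = (x, 0) := fun x => by simp [i₁]
  have he₂ : ∀ f, e₀ (i₂ f) = (0, f) := fun f => by simp [i₂]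
  have hg₁ : ∀ g x, toEnd (Φ g) (i₁ x) = i₁ fun k => g (x k) := by
    intro g x
    apply e₀.injective
    rw [he₁]
    refine Prod.ext (funext fun k => ?_) (funext fun k => LinearMap.ext fun v => ?_)
    · rw [(hΦ g _).1, he₁]
    · rw [(hΦ g _).2, he₁]; rfl
  have hg₂ : ∀ g f, toEnd (Φ g) (i₂ f) = i₂ fun k => f k ∘ₗ (g⁻¹ : V ≃ₗ[ℂ] V) := by
    intro g f
    apply e₀.injective
    rw [he₂]
    refine Prod.ext (funext fun k => ?_) (funext fun k => LinearMap.ext fun v => ?_)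
    · rw [(hΦ g _).1, he₂]; simp
    · rw [(hΦ g _).2, he₂]; rfl
  -- the two summands are isotropic, by invariance under scalars
  let u : V ≃ₗ[ℂ] V := LinearEquiv.smulOfNeZero ℂ V 2 two_ne_zero
  have hu : ∀ v, u v = (2 : ℂ) • v := fun v => rfl
  have hu' : ∀ v, (u⁻¹ : V ≃ₗ[ℂ] V) v = (2 : ℂ)⁻¹ • v := by
    intro v
    apply u.injective
    rw [← LinearEquiv.mul_apply, mul_inv_cancel, hu, smul_smul, mul_inv_cancel₀ two_ne_zero,
      one_smul]
    rfl
  have h11 : ∀ x y, ω (i₁ x) (i₁ y) = 0 := by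
    intro x y
    have h1 := (Φ u).2 (i₁ x) (i₁ y)
    rw [← toEnd_apply, ← toEnd_apply, hg₁, hg₁] at h1
    have h2 : ∀ x, (i₁ fun k => u (x k)) = (2 : ℂ) • i₁ x := fun x => by
      rw [← map_smul]; rfl
    rw [h2, h2] at h1
    simp only [map_smul, LinearMap.smul_apply, smul_eq_mul] at h1
    linear_combination h1 / 3
  have h22 : ∀ x y, ω (i₂ x) (i₂ y) = 0 := by
    intro x y
    have h1 := (Φ u).2 (i₂ x) (i₂ y)
    rw [← toEnd_apply, ← toEnd_apply, hg₂, hg₂] at h1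
    have h2 : ∀ f, (i₂ fun k => f k ∘ₗ (u⁻¹ : V ≃ₗ[ℂ] V)) = (2 : ℂ)⁻¹ • i₂ f := fun f => by
      rw [← map_smul]
      congr 1
      ext k v
      change f k ((u⁻¹ : V ≃ₗ[ℂ] V) v) = (2 : ℂ)⁻¹ * f k v
      rw [hu', map_smul, smul_eq_mul]
    rw [h2, h2] at h1
    simp only [map_smul, LinearMap.smul_apply, smul_eq_mul] at h1
    linear_combination -h1 * 4 / 3
  have h12 : ∀ k j, ∃ c : ℂ, ∀ (x : V) (f : Module.Dual ℂ V),
      ω (i₁ (Pi.single k x)) (i₂ (Pi.single j f)) = c * f x := by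
    intro k j
    refine exists_eq_mul_of_invariant_pairing (F := ω.compl₁₂
      (i₁ ∘ₗ LinearMap.single ℂ (fun _ => V) k)
      (i₂ ∘ₗ LinearMap.single ℂ (fun _ => Module.Dual ℂ V) j)) fun g x f => ?_
    have h1 := (Φ g).2 (i₁ (Pi.single k x)) (i₂ (Pi.single j f))
    rw [← toEnd_apply, ← toEnd_apply, hg₁, hg₂] at h1
    change ω (i₁ (Pi.single k (g x))) (i₂ (Pi.single j (f ∘ₗ (g⁻¹ : V ≃ₗ[ℂ] V)))) =
      ω (i₁ (Pi.single k x)) (i₂ (Pi.single j f))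
    rw [← h1]
    congr 2
    · congr 1
      ext k'
      by_cases hk : k' = k
      · subst hk; simp
      · simp [hk]
    · ext k'
      by_cases hk : k' = j
      · subst hk; simp
      · simp [hk]
  choose γ hγ using h12
  have hw : ∀ w, w = i₁ (e₀ w).1 + i₂ (e₀ w).2 := fun w => by
    apply e₀.injective
    rw [map_add, he₁, he₂]
    simp
  have h12' : ∀ x f, ω (i₁ x) (i₂ f) = ∑ k, ∑ j, γ k j * f j (x k) := by
    intro x f
    conv_lhs => rw [← Finset.univ_sum_single x, ← Finset.univ_sum_single f]
    simp only [map_sum, LinearMap.sum_apply, hγ]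
    rw [Finset.sum_comm]
  refine ⟨γ, fun w w' => ?_⟩
  conv_lhs => rw [hw w, hw w']
  simp only [map_add, LinearMap.add_apply]
  rw [h11, h22, ← hω.neg_eq (i₁ (e₀ w').1), h12', h12', zero_add, add_zero, ← sub_eq_neg_add,
    ← Finset.sum_sub_distrib]
  refine Finset.sum_congr rfl fun k _ => ?_
  rw [← Finset.sum_sub_distrib]
  exact Finset.sum_congr rfl fun j _ => by ring

/-- The matrix of the standard alternating form on the sum of a space and its dual, in a basis
of the space and the dual basis. -/
def hyp [DecidableEq ι] : ι ⊕ ι → ι ⊕ ι → ℂ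
  | .inl s, .inr t => if s = t then 1 else 0
  | .inr s, .inl t => if s = t then -1 else 0
  | _, _ => 0

variable [Fintype ι] [DecidableEq ι] (b : Module.Basis ι ℂ V)

/-- Coordinates on a sum of copies of `V` and its dual in which the invariant form is the product
of the standard alternating form with the standard symmetric form on the multiplicity space. -/
theorem exists_hyperbolic_coordinates (hω' : ω.Nondegenerate) {γ : κ → κ → ℂ}
    (hγ : ∀ w w', ω w w' =
      ∑ k, ∑ j, γ k j * ((e₀ w').2 j ((e₀ w).1 k) - (e₀ w).2 j ((e₀ w').1 k))) :
    ∃ e : W ≃ₗ[ℂ] (ι ⊕ ι → κ → ℂ),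
      (∀ w s k, e w (.inl s) k = b.repr ((e₀ w).1 k) s) ∧
      (∀ w s k, e w (.inr s) k = ∑ j, γ k j * (e₀ w).2 j (b s)) ∧
      ∀ w w', ω w w' = ∑ s, ∑ t, hyp s t * Matrix.toBilin' (1 : Matrix κ κ ℂ) (e w s) (e w' t) := by
  let E : W →ₗ[ℂ] (ι ⊕ ι → κ → ℂ) :=
    { toFun := fun w => Sum.elim (fun s k => b.repr ((e₀ w).1 k) s)
        (fun s k => ∑ j, γ k j * (e₀ w).2 j (b s))
      map_add' := fun w w' => by
        ext (s | s) k
        · simp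
        · simp [mul_add, Finset.sum_add_distrib]
      map_smul' := fun c w => by
        ext (s | s) k
        · simp
        · simp only [map_smul, Prod.smul_snd, Pi.smul_apply, LinearMap.smul_apply, smul_eq_mul,
            Sum.elim_inr, RingHom.id_apply, Finset.mul_sum]
          exact Finset.sum_congr rfl fun j _ => by ring }
  have hE : ∀ w w', ω w w' =
      ∑ s, ∑ t, hyp s t * Matrix.toBilin' (1 : Matrix κ κ ℂ) (E w s) (E w' t) := by
    intro w w'
    have hβ : ∀ x y : κ → ℂ, Matrix.toBilin' (1 : Matrix κ κ ℂ) x y = ∑ k, x k * y k := by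
      intro x y
      simp [Matrix.toBilin'_apply, Matrix.one_apply]
    have hdual : ∀ (f : Module.Dual ℂ V) x, f x = ∑ s, b.repr x s * f (b s) := by
      intro f x
      conv_lhs => rw [← b.sum_repr x]
      rw [map_sum]
      simp only [map_smul, smul_eq_mul]
    have hpair : ∀ w w', ∑ k, ∑ j, γ k j * (e₀ w').2 j ((e₀ w).1 k) =
        ∑ s, ∑ k, E w (.inl s) k * E w' (.inr s) k := by
      intro w w'
      rw [Finset.sum_comm (s := (Finset.univ : Finset ι))]
      refine Finset.sum_congr rfl fun k _ => ?_
      have h1 : ∀ s, E w (.inl s) k * E w' (.inr s) k =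
          ∑ j, γ k j * (b.repr ((e₀ w).1 k) s * (e₀ w').2 j (b s)) := by
        intro s
        change b.repr ((e₀ w).1 k) s * ∑ j, γ k j * (e₀ w').2 j (b s) = _
        rw [Finset.mul_sum]
        exact Finset.sum_congr rfl fun j _ => by ring
      simp_rw [h1]
      rw [Finset.sum_comm]
      refine Finset.sum_congr rfl fun j _ => ?_
      rw [hdual, Finset.mul_sum]
    rw [hγ]
    simp only [mul_sub, Finset.sum_sub_distrib, hpair w w', hpair w' w, Fintype.sum_sum_type, hyp,
      hβ, zero_mul, Finset.sum_const_zero, zero_add, add_zero, ite_mul, one_mul, neg_mul,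
      Finset.sum_ite_eq, Finset.mem_univ, if_true, Finset.sum_neg_distrib, ← sub_eq_add_neg]
    congr 1
    exact Finset.sum_congr rfl fun s _ => Finset.sum_congr rfl fun k _ => mul_comm _ _
  have hinj : Function.Injective E := by
    rw [← LinearMap.ker_eq_bot, LinearMap.ker_eq_bot']
    intro w hw
    refine hω'.1 w fun w' => ?_
    rw [hE, hw]
    simp
  have hdim : Module.finrank ℂ W = Module.finrank ℂ (ι ⊕ ι → κ → ℂ) := by
    rw [e₀.finrank_eq, Module.finrank_prod, Module.finrank_pi_fintype, Module.finrank_pi_fintype,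
      Module.finrank_pi_fintype]
    simp [Subspace.dual_finrank_eq, Module.finrank_eq_card_basis b]
    ring
  have : FiniteDimensional ℂ W := FiniteDimensional.of_injective E hinj
  exact ⟨LinearEquiv.ofInjectiveOfFinrankEq E hinj hdim, fun _ _ _ => rfl, fun _ _ _ => rfl, hE⟩

section Action

variable {e : W ≃ₗ[ℂ] (ι ⊕ ι → κ → ℂ)} {γ : κ → κ → ℂ}
  (he₁ : ∀ w s k, e w (.inl s) k = b.repr ((e₀ w).1 k) s)
  (he₂ : ∀ w s k, e w (.inr s) k = ∑ j, γ k j * (e₀ w).2 j (b s))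

omit [FiniteDimensional ℂ V] [Fintype κ] [DecidableEq κ] [DecidableEq ι] in
include hΦ he₁ in
theorem toEnd_inl (g : V ≃ₗ[ℂ] V) (w : W) (s : ι) :
    e (toEnd (Φ g) w) (.inl s) = ∑ t, b.repr (g (b t)) s • e w (.inl t) := by
  ext k
  rw [he₁, (hΦ g w).1, Finset.sum_apply]
  conv_lhs => rw [← b.sum_repr ((e₀ w).1 k)]
  rw [map_sum, map_sum, Finset.sum_apply']
  refine Finset.sum_congr rfl fun t _ => ?_
  simp [he₁, mul_comm]

omit [FiniteDimensional ℂ V] [DecidableEq κ] [DecidableEq ι] in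
include hΦ he₂ in
theorem toEnd_inr (g : V ≃ₗ[ℂ] V) (w : W) (s : ι) :
    e (toEnd (Φ g) w) (.inr s) =
      ∑ t, b.repr ((g⁻¹ : V ≃ₗ[ℂ] V) (b s)) t • e w (.inr t) := by
  ext k
  rw [he₂, Finset.sum_apply]
  simp only [Pi.smul_apply, smul_eq_mul, he₂, Finset.mul_sum]
  rw [Finset.sum_comm]
  refine Finset.sum_congr rfl fun j _ => ?_
  rw [(hΦ g w).2]
  conv_lhs => rw [← b.sum_repr ((g⁻¹ : V ≃ₗ[ℂ] V) (b s))]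
  rw [map_sum, Finset.mul_sum]
  refine Finset.sum_congr rfl fun t _ => ?_
  simp only [map_smul, smul_eq_mul]
  ring

omit [Fintype ι] in
/-- The map `1 + E s t` is invertible for all `s`, `t`, the diagonal case `s = t` included, as the
factor `2` is invertible. -/
theorem exists_transvection (s t : ι) : ∃ u : V ≃ₗ[ℂ] V, ∀ v, u v = v + b.repr v t • b s := by
  let f : Module.End ℂ V := 1 + (b.coord t).smulRight (b s)
  have hf : ∀ v, f v = v + b.repr v t • b s := fun v => by simp [f]
  have hinj : Function.Injective f := by
    rw [← LinearMap.ker_eq_bot, LinearMap.ker_eq_bot']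
    intro v hv
    rw [hf] at hv
    have h1 := congrArg (fun v => b.repr v t) hv
    simp only [map_add, map_smul, Finsupp.add_apply, Finsupp.smul_apply, smul_eq_mul, map_zero,
      Finsupp.zero_apply, Module.Basis.repr_self, Finsupp.single_apply] at h1
    have h2 : b.repr v t = 0 := by
      split_ifs at h1
      · linear_combination h1 / 2
      · linear_combination h1
    simpa [h2] using hv
  exact ⟨LinearEquiv.ofInjectiveEndo f hinj, hf⟩

omit [DecidableEq κ] in
include hΦ he₁ he₂ in
/-- Scalars and the transvections `1 + E s t` generate the elementary endomorphisms of `W`. The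
scalars separate the copies of `V`, of weight `1`, from those of the dual, of weight `-1`, so that
the matrix units on both summands are obtained separately. -/
theorem commute_elem_of_commute_automorphisms {x : Module.End ℂ W}
    (hsc : ∀ u : V ≃ₗ[ℂ] V, (∀ v, u v = (2 : ℂ) • v) → Commute x (toEnd (Φ u))) {s t : ι}
    (hst : ∀ u : V ≃ₗ[ℂ] V, (∀ v, u v = v + b.repr v t • b s) →
      Commute x (toEnd (Φ u)) ∧ Commute x (toEnd (Φ u⁻¹))) :
    Commute x (elem e (.inl s) (.inl t)) ∧ Commute x (elem e (.inr t) (.inr s)) := by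
  let z : V ≃ₗ[ℂ] V := LinearEquiv.smulOfNeZero ℂ V 2 two_ne_zero
  have hz : ∀ v, z v = (2 : ℂ) • v := fun v => rfl
  have hz' : ∀ v, (z⁻¹ : V ≃ₗ[ℂ] V) v = (2 : ℂ)⁻¹ • v := by
    intro v
    apply z.injective
    rw [← LinearEquiv.mul_apply, mul_inv_cancel, hz, smul_smul, mul_inv_cancel₀ two_ne_zero,
      one_smul]
    rfl
  have hz1 : ∀ w s, e (toEnd (Φ z) w) (.inl s) = (2 : ℂ) • e w (.inl s) := by
    intro w s
    rw [toEnd_inl e₀ hΦ b he₁]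
    simp [hz, Finsupp.single_apply]
  have hz2 : ∀ w s, e (toEnd (Φ z) w) (.inr s) = (2 : ℂ)⁻¹ • e w (.inr s) := by
    intro w s
    rw [toEnd_inr e₀ hΦ b he₂]
    simp [hz', Finsupp.single_apply]
  obtain ⟨u, hu⟩ := exists_transvection b s t
  obtain ⟨h1, h2⟩ := hst u hu
  -- the projection to the copies of `V`
  set P : Module.End ℂ W := (2 / 3 : ℂ) • (toEnd (Φ z) - (2 : ℂ)⁻¹ • 1) with hP
  have hP1 : ∀ w s, e (P w) (.inl s) = e w (.inl s) := by
    intro w s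
    simp only [hP, LinearMap.smul_apply, LinearMap.sub_apply, Module.End.one_apply, map_smul,
      map_sub, Pi.smul_apply, Pi.sub_apply, hz1]
    module
  have hP2 : ∀ w s, e (P w) (.inr s) = 0 := by
    intro w s
    simp only [hP, LinearMap.smul_apply, LinearMap.sub_apply, Module.End.one_apply, map_smul,
      map_sub, Pi.smul_apply, Pi.sub_apply, hz2]
    module
  have hxP : Commute x P :=
    ((hsc z hz).sub_right ((Commute.one_right x).smul_right _)).smul_right _
  have e1 : elem e (.inl s) (.inl t) = (toEnd (Φ u) - 1) * P := by
    ext w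
    apply e.injective
    ext (s' | s') : 1
    · rw [elem_apply, Module.End.mul_apply, LinearMap.sub_apply, map_sub, Pi.sub_apply,
        toEnd_inl e₀ hΦ b he₁]
      simp only [hP1, hu, map_add, map_smul, Finsupp.add_apply, Finsupp.smul_apply,
        Module.Basis.repr_self, add_smul, Finset.sum_add_distrib, Module.End.one_apply]
      by_cases h : s' = s
      · subst h; simp [Finsupp.single_apply]
      · simp [Finsupp.single_apply, h]
    · rw [elem_apply, Module.End.mul_apply, LinearMap.sub_apply, map_sub, Pi.sub_apply,
        toEnd_inr e₀ hΦ b he₂]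
      simp [hP2]
  have e2 : elem e (.inr t) (.inr s) = (toEnd (Φ u⁻¹) - 1) * (1 - P) := by
    ext w
    apply e.injective
    ext (s' | s') : 1
    · rw [elem_apply, Module.End.mul_apply, LinearMap.sub_apply, map_sub, Pi.sub_apply,
        toEnd_inl e₀ hΦ b he₁]
      simp [hP1]
    · rw [elem_apply, Module.End.mul_apply, LinearMap.sub_apply, map_sub, Pi.sub_apply,
        toEnd_inr e₀ hΦ b he₂, inv_inv]
      simp only [hP2, hu, map_add, map_smul, Finsupp.add_apply, Finsupp.smul_apply, map_sub,
        Pi.sub_apply, sub_zero, LinearMap.sub_apply,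
        Module.Basis.repr_self, add_smul, Finset.sum_add_distrib, Module.End.one_apply]
      by_cases h : s' = t
      · subst h; simp [Finsupp.single_apply]
      · simp [Finsupp.single_apply, h]
  rw [e1, e2]
  exact ⟨(h1.sub_right (Commute.one_right x)).mul_right hxP,
    (h2.sub_right (Commute.one_right x)).mul_right ((Commute.one_right x).sub_right hxP)⟩

end Action

end LinearType

/-! ### Classical pairs in coordinates -/

section Exits

variable {W : Type u} [AddCommGroup W] [Module ℂ W] {ω : LinearMap.BilinForm ℂ W}
  {U : Type v} [AddCommGroup U] [Module ℂ U] {ι : Type*}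

theorem mem_map_subtype_iff {K : Subgroup (isometryGroup ω)} {g : isometryGroup ω} :
    (g : W ≃ₗ[ℂ] W) ∈ K.map (isometryGroup ω).subtype ↔ g ∈ K :=
  Subgroup.mem_map_iff_mem (isometryGroup ω).subtype_injective

/-- The commutant of a block diagonal group generating all block diagonal matrices, for an
invariant form which is a product of a form on the index space and a form `β` on `U`. -/
theorem mem_map_commutant_iff [Fintype ι] [DecidableEq ι] (e : W ≃ₗ[ℂ] (ι → U))
    {B : ι → ι → ℂ} {β : LinearMap.BilinForm ℂ U}
    (hform : ∀ w w', ω w w' = ∑ s, ∑ t, B s t * β (e w s) (e w' t))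
    {T : Type*} {c : ι → T} (hc : Function.Surjective c) {H : Subgroup (isometryGroup ω)}
    (hel : ∀ x : Module.End ℂ W, (∀ h ∈ H, Commute x (toEnd h)) →
      ∀ s t, c s = c t → Commute x (elem e s t))
    (hmat : ∀ h ∈ H, ∃ a : ι → ι → ℂ, (∀ s t, c s ≠ c t → a s t = 0) ∧
      ∀ w s, e (toEnd h w) s = ∑ t, a s t • e w t) (f : W ≃ₗ[ℂ] W) :
    f ∈ (commutant H).map (isometryGroup ω).subtype ↔ ∃ y : T → (U ≃ₗ[ℂ] U),
      (∀ s t, B s t ≠ 0 → ∀ m m', β (y (c s) m) (y (c t) m') = β m m') ∧ f = fam e (y ∘ c) := by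
  constructor
  · rintro ⟨g, hg, rfl⟩
    obtain ⟨y, hy⟩ := (mem_commutant_iff_fam e hc hel hmat g).mp hg
    refine ⟨y, ?_, hy⟩
    have := g.2
    rw [hy, fam_mem_isometryGroup_iff e hform] at this
    exact this
  · rintro ⟨y, hy, rfl⟩
    have h1 := (fam_mem_isometryGroup_iff e hform (y ∘ c)).mpr hy
    exact ⟨⟨_, h1⟩, (mem_commutant_iff_fam e hc hel hmat ⟨_, h1⟩).mpr ⟨y, rfl⟩, rfl⟩

/-- Reindexing the coordinates reindexes the family of automorphisms. -/
theorem fam_reindex {ι' : Type*} (e : W ≃ₗ[ℂ] (ι → U)) (s : ι ≃ ι') (z : ι' → (U ≃ₗ[ℂ] U)) :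
    fam (e.trans (LinearEquiv.funCongrLeft ℂ U s.symm)) z = fam e (z ∘ s) := by
  rw [eq_fam_iff]
  intro w i
  have := fam_apply (e.trans (LinearEquiv.funCongrLeft ℂ U s.symm)) z w (s i)
  simp only [LinearEquiv.trans_apply, LinearEquiv.funCongrLeft_apply, LinearMap.funLeft_apply,
    Equiv.symm_apply_apply] at this
  exact this

variable [FiniteDimensional ℂ U] {β : LinearMap.BilinForm ℂ U} (hβ : β.Nondegenerate)

/-- An automorphism acting on the first summands, its contragredient on the remaining ones. -/
noncomputable def twist (α α' : Type*) : (U ≃ₗ[ℂ] U) →* (α ⊕ α' → (U ≃ₗ[ℂ] U)) where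
  toFun y := Sum.elim (fun _ => y) (fun _ => contra hβ y)
  map_one' := by ext (i | i) : 1 <;> simp
  map_mul' y z := by ext (i | i) : 1 <;> simp

@[simp]
theorem twist_inl {α α' : Type*} (y : U ≃ₗ[ℂ] U) (i : α) : twist hβ α α' y (.inl i) = y := rfl

@[simp]
theorem twist_inr {α α' : Type*} (y : U ≃ₗ[ℂ] U) (i : α') :
    twist hβ α α' y (.inr i) = contra hβ y := rfl

theorem contra_eq_self {y : U ≃ₗ[ℂ] U} (hy : y ∈ isometryGroup β) : contra hβ y = y :=
  (eq_contra_of_forall hβ hy).symm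

/-- An isometry of `β` is its own contragredient. -/
theorem twist_eq_const {α α' : Type*} {y : U ≃ₗ[ℂ] U} (hy : y ∈ isometryGroup β) :
    twist hβ α α' y = fun _ => y := by
  ext (i | i) : 1
  · rfl
  · exact contra_eq_self hβ hy

end Exits

/-- The decomposition into two eigenspaces is stabilized exactly by the automorphisms commuting
with the operator defining it. -/
theorem mem_blockGroup_iff_commute {V : Type v} [AddCommGroup V] [Module ℂ V]
    {X Y : Submodule ℂ V} (hXY : IsCompl X Y) {d : Module.End ℂ V} {c₁ c₂ : ℂ} (hc : c₁ ≠ c₂)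
    (hX : ∀ x ∈ X, d x = c₁ • x) (hY : ∀ x ∈ Y, d x = c₂ • x) (y : V ≃ₗ[ℂ] V) :
    y ∈ blockGroup X Y ↔ ∀ u, y (d u) = d (y u) := by
  have hdec : ∀ v, ∃ x ∈ X, ∃ x' ∈ Y, x + x' = v := fun v =>
    Submodule.mem_sup.mp (hXY.sup_eq_top ▸ Submodule.mem_top)
  have hX' : ∀ u, d u = c₁ • u → u ∈ X := by
    intro u hu
    obtain ⟨x, hx, x', hx', rfl⟩ := hdec u
    rw [map_add, hX x hx, hY x' hx', smul_add, add_right_inj, ← sub_eq_zero, ← sub_smul,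
      smul_eq_zero, sub_eq_zero, or_iff_right hc.symm] at hu
    simpa [hu] using hx
  have hY' : ∀ u, d u = c₂ • u → u ∈ Y := by
    intro u hu
    obtain ⟨x, hx, x', hx', rfl⟩ := hdec u
    rw [map_add, hX x hx, hY x' hx', smul_add, add_left_inj, ← sub_eq_zero, ← sub_smul,
      smul_eq_zero, sub_eq_zero, or_iff_right hc] at hu
    simpa [hu] using hx'
  constructor
  · rintro ⟨h1, h2⟩ u
    obtain ⟨x, hx, x', hx', rfl⟩ := hdec u
    simp only [map_add]
    rw [hX _ hx, hY _ hx', hX _ ((h1 _).mpr hx), hY _ ((h2 _).mpr hx'), map_smul, map_smul]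
  · intro h
    refine ⟨fun u => ⟨fun hu => hX' u ?_, fun hu => hX' _ ?_⟩,
      fun u => ⟨fun hu => hY' u ?_, fun hu => hY' _ ?_⟩⟩
    · apply y.injective
      rw [h, hX _ hu, map_smul]
    · rw [← h, hX _ hu, map_smul]
    · apply y.injective
      rw [h, hY _ hu, map_smul]
    · rw [← h, hY _ hu, map_smul]

/-- The operator with prescribed eigenvalues on two complementary subspaces. -/
theorem exists_scaling {V : Type v} [AddCommGroup V] [Module ℂ V] {X Y : Submodule ℂ V}
    (hXY : IsCompl X Y) (c₁ c₂ : ℂ) :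
    ∃ d : Module.End ℂ V, (∀ x ∈ X, d x = c₁ • x) ∧ ∀ x ∈ Y, d x = c₂ • x := by
  refine ⟨c₁ • X.projection Y hXY + c₂ • Y.projection X hXY.symm, fun x hx => ?_, fun x hx => ?_⟩
  · have h1 : X.projection Y hXY x = x := Submodule.projection_apply_of_mem_left hXY hx
    have h2 : Y.projection X hXY.symm x = 0 := Submodule.projection_apply_of_mem_right hXY.symm hx
    simp [h1, h2]
  · have h1 : Y.projection X hXY.symm x = x := Submodule.projection_apply_of_mem_left hXY.symm hx
    have h2 : X.projection Y hXY x = 0 := Submodule.projection_apply_of_mem_right hXY hx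
    simp [h1, h2]

theorem exists_scaling_equiv {V : Type v} [AddCommGroup V] [Module ℂ V] [FiniteDimensional ℂ V]
    {X Y : Submodule ℂ V} (hXY : IsCompl X Y) {c₁ c₂ : ℂ} (h₁ : c₁ ≠ 0) (h₂ : c₂ ≠ 0) :
    ∃ d : V ≃ₗ[ℂ] V, (∀ x ∈ X, d x = c₁ • x) ∧ ∀ x ∈ Y, d x = c₂ • x := by
  obtain ⟨d, hX, hY⟩ := exists_scaling hXY c₁ c₂
  obtain ⟨d', hX', hY'⟩ := exists_scaling hXY c₁⁻¹ c₂⁻¹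
  have h : d' * d = 1 := by
    ext v
    obtain ⟨x, hx, x', hx', rfl⟩ : ∃ x ∈ X, ∃ x' ∈ Y, x + x' = v :=
      Submodule.mem_sup.mp (hXY.sup_eq_top ▸ Submodule.mem_top)
    simp [hX x hx, hY x' hx', hX' x hx, hY' x' hx', smul_smul, h₁, h₂]
  exact ⟨LinearEquiv.ofInjectiveEndo d (Function.LeftInverse.injective
    (g := d') fun v => LinearMap.congr_fun h v), hX, hY⟩

/-- A basis adapted to a direct sum decomposition. -/
theorem exists_adapted_basis {V : Type v} [AddCommGroup V] [Module ℂ V] [FiniteDimensional ℂ V]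
    {X Y : Submodule ℂ V} (hXY : IsCompl X Y) {p q : ℕ} (hp : Module.finrank ℂ X = p)
    (hq : Module.finrank ℂ Y = q) : ∃ b : Module.Basis (Fin p ⊕ Fin q) ℂ V,
      (∀ s, b (.inl s) ∈ X) ∧ ∀ s, b (.inr s) ∈ Y :=
  ⟨((Module.finBasisOfFinrankEq ℂ X hp).prod (Module.finBasisOfFinrankEq ℂ Y hq)).map
    (X.prodEquivOfIsCompl Y hXY), fun s => by simp, fun s => by simp⟩

theorem repr_inr_eq_zero {V : Type v} [AddCommGroup V] [Module ℂ V] {ι₁ ι₂ : Type*}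
    {X Y : Submodule ℂ V} (hXY : IsCompl X Y) (b : Module.Basis (ι₁ ⊕ ι₂) ℂ V)
    (hbX : ∀ s, b (.inl s) ∈ X) (hbY : ∀ s, b (.inr s) ∈ Y) {x : V} (hx : x ∈ X) (s : ι₂) :
    b.repr x (.inr s) = 0 := by
  obtain ⟨π, hπX, hπY⟩ := exists_scaling hXY 1 0
  have h1 : b.coord (.inr s) ∘ₗ π = 0 := b.ext fun r => by
    rcases r with r | r
    · simp [hπX _ (hbX r)]
    · simp [hπY _ (hbY r)]
  have h2 := LinearMap.congr_fun h1 x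
  rwa [LinearMap.comp_apply, hπX x hx, one_smul] at h2

theorem repr_inl_eq_zero {V : Type v} [AddCommGroup V] [Module ℂ V] {ι₁ ι₂ : Type*}
    {X Y : Submodule ℂ V} (hXY : IsCompl X Y) (b : Module.Basis (ι₁ ⊕ ι₂) ℂ V)
    (hbX : ∀ s, b (.inl s) ∈ X) (hbY : ∀ s, b (.inr s) ∈ Y) {y : V} (hy : y ∈ Y) (s : ι₁) :
    b.repr y (.inl s) = 0 := by
  obtain ⟨π, hπX, hπY⟩ := exists_scaling hXY 0 1
  have h1 : b.coord (.inl s) ∘ₗ π = 0 := b.ext fun r => by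
    rcases r with r | r
    · simp [hπX _ (hbX r)]
    · simp [hπY _ (hbY r)]
  have h2 := LinearMap.congr_fun h1 y
  rwa [LinearMap.comp_apply, hπY y hy, one_smul] at h2

section Std

variable {W : Type u} [AddCommGroup W] [Module ℂ W] {ω : LinearMap.BilinForm ℂ W}
  {N : ℕ} {β : LinearMap.BilinForm ℂ (Std N)} (hβ : β.Nondegenerate)
  {K G' : Subgroup (isometryGroup ω)} {C D : Subgroup (Std N ≃ₗ[ℂ] Std N)}

/-- Recognition of a pair embedded through one standard module, from the description of both groups
in coordinates. The contragredient with respect to `β` stands for the dual module. -/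
theorem isSinglePair_of_coordinates {a b : ℕ} (ha : 0 < a)
    (e : W ≃ₗ[ℂ] (Fin a ⊕ Fin b → Std N))
    (hK : ∀ f, f ∈ K.map (isometryGroup ω).subtype ↔ ∃ y ∈ C, f = fam e (twist hβ _ _ y))
    (hG' : ∀ f, f ∈ G'.map (isometryGroup ω).subtype ↔
      ∃ y ∈ C, y ∈ D ∧ f = fam e (twist hβ _ _ y)) :
    IsSinglePair C D a b K G' := by
  let F : (Std N ≃ₗ[ℂ] Std N) →* (W ≃ₗ[ℂ] W) := (fam e).comp (twist hβ _ _)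
  have hmem : ∀ y : C, F y ∈ isometryGroup ω := fun y => by
    obtain ⟨g, -, hg⟩ := (hK (F y)).mpr ⟨y, y.2, rfl⟩
    rw [← hg]
    exact g.2
  let φ : C →* isometryGroup ω := (F.comp C.subtype).codRestrict _ hmem
  have hφ : ∀ y, (φ y : W ≃ₗ[ℂ] W) = fam e (twist hβ _ _ y) := fun y => rfl
  refine ⟨φ, ⟨?_, ?_⟩, ?_, ?_⟩
  · intro y z h
    have h1 := fam_injective e (congrArg Subtype.val h)
    exact Subtype.ext (congrFun h1 (.inl ⟨0, ha⟩))
  · refine ⟨(e.trans (LinearEquiv.sumArrowLequivProdArrow _ _ ℂ _)).trans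
      (LinearEquiv.prodCongr (.refl ℂ _) (LinearEquiv.piCongrRight fun _ => β.toDual hβ)),
      fun g w => ⟨fun i => ?_, fun j v => ?_⟩⟩
    · simp [hφ]
    · rw [hφ]
      change β.toDual hβ (e (fam e _ w) (.inr j)) v = β.toDual hβ (e w (.inr j)) _
      rw [fam_apply, LinearMap.BilinForm.toDual_def, LinearMap.BilinForm.toDual_def, twist_inr,
        form_contra]
  · ext g
    rw [← mem_map_subtype_iff, hK]
    constructor
    · rintro ⟨y, hy, h⟩
      exact ⟨⟨y, hy⟩, Subtype.ext h.symm⟩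
    · rintro ⟨y, rfl⟩
      exact ⟨y, y.2, rfl⟩
  · ext g
    rw [← mem_map_subtype_iff, hG']
    constructor
    · rintro ⟨y, hy, hy', h⟩
      exact ⟨⟨y, hy⟩, hy', Subtype.ext h.symm⟩
    · rintro ⟨y, hy, rfl⟩
      exact ⟨y, y.2, hy, rfl⟩

/-- Recognition of a product of two copies of a group together with its diagonal, from the
description of both groups in coordinates. -/
theorem isDiagonalPair_of_coordinates {a b c d : ℕ} (ha : 0 < a) (hc : 0 < c)
    (e : W ≃ₗ[ℂ] ((Fin a ⊕ Fin b) ⊕ (Fin c ⊕ Fin d) → Std N))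
    (hK : ∀ f, f ∈ K.map (isometryGroup ω).subtype ↔ ∃ y ∈ C, ∃ z ∈ C,
      f = fam e (Sum.elim (twist hβ _ _ y) (twist hβ _ _ z)))
    (hG' : ∀ f, f ∈ G'.map (isometryGroup ω).subtype ↔ ∃ y ∈ C,
      f = fam e (Sum.elim (twist hβ _ _ y) (twist hβ _ _ y))) :
    IsDiagonalPair C a b c d K G' := by
  let F : (Std N ≃ₗ[ℂ] Std N) × (Std N ≃ₗ[ℂ] Std N) →* (W ≃ₗ[ℂ] W) :=
    (fam e).comp
    { toFun := fun y => Sum.elim (twist hβ _ _ y.1) (twist hβ _ _ y.2)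
      map_one' := by ext (i | i) : 1 <;> simp
      map_mul' := fun y z => by ext (i | i) : 1 <;> simp }
  have hmem : ∀ y : C × C, F (y.1, y.2) ∈ isometryGroup ω := fun y => by
    obtain ⟨g, -, hg⟩ := (hK (F (y.1, y.2))).mpr ⟨y.1, y.1.2, y.2, y.2.2, rfl⟩
    rw [← hg]
    exact g.2
  let φ : C × C →* isometryGroup ω := (F.comp (C.subtype.prodMap C.subtype)).codRestrict _ hmem
  have hφ : ∀ y z, (φ (y, z) : W ≃ₗ[ℂ] W) =
    fam e (Sum.elim (twist hβ _ _ y) (twist hβ _ _ z)) := fun y z => rfl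
  refine ⟨φ, ⟨?_, ?_⟩, ?_, ?_⟩
  · rintro ⟨y, y'⟩ ⟨z, z'⟩ h
    have h1 := fam_injective e (congrArg Subtype.val h)
    exact Prod.ext (Subtype.ext (congrFun h1 (.inl (.inl ⟨0, ha⟩))))
      (Subtype.ext (congrFun h1 (.inr (.inl ⟨0, hc⟩))))
  · let E (p q : ℕ) : (Fin p ⊕ Fin q → Std N) ≃ₗ[ℂ]
        (Fin p → Std N) × (Fin q → Module.Dual ℂ (Std N)) :=
      (LinearEquiv.sumArrowLequivProdArrow _ _ ℂ _).trans
        (LinearEquiv.prodCongr (.refl ℂ _) (LinearEquiv.piCongrRight fun _ => β.toDual hβ))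
    refine ⟨(e.trans (LinearEquiv.sumArrowLequivProdArrow _ _ ℂ _)).trans
      (LinearEquiv.prodCongr (E a b) (E c d)),
      fun g h w => ⟨fun i => ?_, fun j v => ?_, fun i => ?_, fun j v => ?_⟩⟩
    · simp [hφ, E]
    · rw [hφ]
      change β.toDual hβ (e (fam e _ w) (.inl (.inr j))) v =
        β.toDual hβ (e w (.inl (.inr j))) _
      rw [fam_apply, LinearMap.BilinForm.toDual_def, LinearMap.BilinForm.toDual_def, Sum.elim_inl,
        twist_inr, form_contra]
    · simp [hφ, E]
    · rw [hφ]
      change β.toDual hβ (e (fam e _ w) (.inr (.inr j))) v =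
        β.toDual hβ (e w (.inr (.inr j))) _
      rw [fam_apply, LinearMap.BilinForm.toDual_def, LinearMap.BilinForm.toDual_def, Sum.elim_inr,
        twist_inr, form_contra]
  · ext g
    rw [← mem_map_subtype_iff, hK]
    constructor
    · rintro ⟨y, hy, z, hz, h⟩
      exact ⟨(⟨y, hy⟩, ⟨z, hz⟩), Subtype.ext h.symm⟩
    · rintro ⟨⟨y, z⟩, rfl⟩
      exact ⟨y, y.2, z, z.2, rfl⟩
  · ext g
    rw [← mem_map_subtype_iff, hG']
    constructor
    · rintro ⟨y, hy, h⟩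
      exact ⟨⟨y, hy⟩, Subtype.ext h.symm⟩
    · rintro ⟨y, rfl⟩
      exact ⟨y, y.2, rfl⟩

/-- The coordinate subspace on the indices selected by `S`. -/
def coordSubspace (S : Fin N → Bool) : Submodule ℂ (Std N) where
  carrier := {u | ∀ k, S k = false → u k = 0}
  zero_mem' := fun _ _ => rfl
  add_mem' := fun hu hv k hk => by simp [hu k hk, hv k hk]
  smul_mem' := fun c u hu k hk => by simp [hu k hk]

theorem isCompl_coordSubspace (S : Fin N → Bool) :
    IsCompl (coordSubspace S) (coordSubspace fun k => !S k) := by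
  constructor
  · rw [Submodule.disjoint_def]
    intro u hu hu'
    ext k
    cases hk : S k
    · exact hu k hk
    · exact hu' k (by simp [hk])
  · rw [codisjoint_iff, Submodule.eq_top_iff']
    intro u
    refine Submodule.mem_sup.mpr ⟨fun k => if S k then u k else 0, fun k hk => by simp [hk],
      fun k => if S k then 0 else u k, fun k hk => ?_, ?_⟩
    · have : S k = true := by simpa using hk
      simp [this]
    · ext k
      cases hk : S k <;> simp [hk]

theorem finrank_coordSubspace (S : Fin N → Bool) :
    Module.finrank ℂ (coordSubspace S) = Fintype.card {k // S k = true} := by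
  let E : coordSubspace S ≃ₗ[ℂ] ({k // S k = true} → ℂ) :=
    { toFun := fun u k => u.1 k
      invFun := fun v => ⟨fun k => if h : S k = true then v ⟨k, h⟩ else 0,
        fun k hk => by simp [hk]⟩
      map_add' := fun _ _ => rfl
      map_smul' := fun _ _ => rfl
      left_inv := fun u => by
        ext k
        cases hk : S k
        · simp [hk, u.2 k hk]
        · simp [hk]
      right_inv := fun v => by
        ext k
        simp [k.2] }
  rw [E.finrank_eq, Module.finrank_fintype_fun_eq_card]

end Std

/-! ### Symmetric subgroups -/

section Involutions

variable {W : Type u} [AddCommGroup W] [Module ℂ W] {ω : LinearMap.BilinForm ℂ W}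

/-- A map defined on a subset of a vector space extends to a linear map as soon as it preserves
linear relations. -/
theorem exists_linearMap_of_relations {Γ : Type*} {M : Type*} [AddCommGroup M] [Module ℂ M]
    (p q : Γ → M)
    (h : ∀ l : Γ →₀ ℂ, Finsupp.linearCombination ℂ p l = 0 → Finsupp.linearCombination ℂ q l = 0) :
    ∃ T : M →ₗ[ℂ] M, ∀ γ, T (p γ) = q γ := by
  let A := Finsupp.linearCombination ℂ p
  let f : LinearMap.range A →ₗ[ℂ] M :=
    ((LinearMap.ker A).liftQ (Finsupp.linearCombination ℂ q) fun l hl => h l hl) ∘ₗ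
      (A.quotKerEquivRange.symm : LinearMap.range A →ₗ[ℂ] _)
  obtain ⟨T, hT⟩ := f.exists_extend
  refine ⟨T, fun γ => ?_⟩
  have h1 : p γ = A (Finsupp.single γ 1) := by simp [A]
  have h2 : T (A (Finsupp.single γ 1)) = f ⟨_, LinearMap.mem_range_self A (Finsupp.single γ 1)⟩ :=
    LinearMap.congr_fun hT ⟨_, LinearMap.mem_range_self A (Finsupp.single γ 1)⟩
  rw [h1, h2]
  simp only [f, LinearMap.comp_apply, LinearEquiv.coe_coe]
  rw [LinearMap.quotKerEquivRange_symm_apply_image A (Finsupp.single γ 1)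
    (LinearMap.mem_range_self A _)]
  change Finsupp.linearCombination ℂ q (Finsupp.single γ 1) = q γ
  simp

/-- To exhibit a symmetric subgroup, it suffices to give the involution on an abstract group which
parametrizes `G`. -/
theorem isSymmetricSubgroup_of_involution {Γ : Type*} [Group Γ] {φ : Γ →* isometryGroup ω}
    (hφ : Function.Injective φ) (θ : Γ →* Γ) (hθ : ∀ γ, θ (θ γ) = γ)
    {T : Module.End ℂ W →ₗ[ℂ] Module.End ℂ W} (hT : ∀ γ, T (toEnd (φ γ)) = toEnd (φ (θ γ)))
    {G H : Subgroup (isometryGroup ω)} (hG : G = φ.range)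
    (hH : ∀ h, h ∈ H ↔ ∃ γ, θ γ = γ ∧ φ γ = h) : IsSymmetricSubgroup H G := by
  subst hG
  let E : Γ ≃* φ.range := MonoidHom.ofInjective hφ
  have hE : ∀ γ, (E γ : isometryGroup ω) = φ γ := fun γ => rfl
  let θ' : Γ ≃* Γ := MonoidHom.toMulEquiv θ θ (MonoidHom.ext hθ) (MonoidHom.ext hθ)
  refine ⟨(E.symm.trans θ').trans E, ?_, ⟨T, ?_⟩, ?_⟩
  · intro g
    simp [θ', hθ]
  · intro g
    obtain ⟨γ, rfl⟩ := E.surjective g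
    change T (toEnd (φ γ)) = toEnd (E (θ' (E.symm (E γ))) : isometryGroup ω)
    rw [E.symm_apply_apply]
    exact hT γ
  · ext h
    rw [hH, Subgroup.mem_map]
    constructor
    · rintro ⟨γ, h1, rfl⟩
      exact ⟨E γ, by simp [θ', MonoidHom.eqLocus, h1], rfl⟩
    · rintro ⟨g, hg, rfl⟩
      obtain ⟨γ, rfl⟩ := E.surjective g
      refine ⟨γ, ?_, rfl⟩
      have : E (θ γ) = E γ := by simpa [θ', MonoidHom.eqLocus] using hg
      exact E.injective this

variable {n : ℕ} {C D : Subgroup (Std n ≃ₗ[ℂ] Std n)} {G H : Subgroup (isometryGroup ω)}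

/-- The fixed points of an inner involution form a symmetric subgroup. -/
theorem IsSinglePair.isSymmetricSubgroup_of_inner {a b : ℕ} (h : IsSinglePair C D a b G H)
    {s : Std n ≃ₗ[ℂ] Std n} (hs : s ∈ C) (hs2 : ∀ g : Std n ≃ₗ[ℂ] Std n, Commute (s * s) g)
    (hD : ∀ g ∈ C, g ∈ D ↔ Commute g s) : IsSymmetricSubgroup H G := by
  obtain ⟨φ, ⟨hφ, -⟩, hG, rfl⟩ := h
  let S : C := ⟨s, hs⟩
  refine isSymmetricSubgroup_of_involution hφ (MulAut.conj S).toMonoidHom (fun γ => ?_)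
    (T := LinearMap.mulLeft ℂ (toEnd (φ S)) ∘ₗ LinearMap.mulRight ℂ (toEnd (φ S⁻¹)))
    (fun γ => ?_) hG fun h => ?_
  · have h1 : S * S * γ = γ * (S * S) := Subtype.ext (hs2 γ).eq
    simp only [MulEquiv.toMonoidHom_eq_coe, MonoidHom.coe_coe, MulAut.conj_apply]
    calc S * (S * γ * S⁻¹) * S⁻¹ = (S * S * γ) * (S⁻¹ * S⁻¹) := by group
      _ = γ := by rw [h1]; group
  · simp [mul_assoc]
  · rw [Subgroup.mem_map]
    have h2 : ∀ γ : C, γ ∈ D.subgroupOf C ↔ (MulAut.conj S).toMonoidHom γ = γ := by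
      intro γ
      rw [Subgroup.mem_subgroupOf, hD _ γ.2]
      simp only [MulEquiv.toMonoidHom_eq_coe, MonoidHom.coe_coe, MulAut.conj_apply,
        mul_inv_eq_iff_eq_mul]
      exact ⟨fun h => Subtype.ext h.eq.symm, fun h => (congrArg Subtype.val h).symm⟩
    simp only [h2]

/-- For a symmetric or alternating form the contragredient is an involution. -/
theorem contra_contra {U : Type v} [AddCommGroup U] [Module ℂ U] [FiniteDimensional ℂ U]
    {β : LinearMap.BilinForm ℂ U} (hβ : β.Nondegenerate) {ε : ℂ}
    (hε : ∀ x y, β x y = ε * β y x) (y : U ≃ₗ[ℂ] U) : contra hβ (contra hβ y) = y := by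
  symm
  refine eq_contra_of_forall hβ fun m m' => ?_
  rw [hε, form_contra_apply, ← hε]

/-- A linear relation between endomorphisms can be checked on coordinates. -/
theorem linearCombination_eq_zero_iff {Γ κ κ' V : Type*} [AddCommGroup V] [Module ℂ V]
    (e : W ≃ₗ[ℂ] (κ → V) × (κ' → Module.Dual ℂ V)) (p : Γ → Module.End ℂ W) (l : Γ →₀ ℂ) :
    Finsupp.linearCombination ℂ p l = 0 ↔
      (∀ w i, Finsupp.linearCombination ℂ (fun γ => (e (p γ w)).1 i) l = 0) ∧
      ∀ w j v, Finsupp.linearCombination ℂ (fun γ => (e (p γ w)).2 j v) l = 0 := by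
  have h1 : ∀ w i, (e (Finsupp.linearCombination ℂ p l w)).1 i =
      Finsupp.linearCombination ℂ (fun γ => (e (p γ w)).1 i) l := fun w i =>
    Finsupp.apply_linearCombination ℂ (LinearMap.proj i ∘ₗ LinearMap.fst ℂ _ _ ∘ₗ
      (e : W →ₗ[ℂ] (κ → V) × (κ' → Module.Dual ℂ V)) ∘ₗ LinearMap.applyₗ w) p l
  have h2 : ∀ w j v, (e (Finsupp.linearCombination ℂ p l w)).2 j v =
      Finsupp.linearCombination ℂ (fun γ => (e (p γ w)).2 j v) l := fun w j v =>
    Finsupp.apply_linearCombination ℂ (LinearMap.applyₗ v ∘ₗ LinearMap.proj j ∘ₗ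
      LinearMap.snd ℂ _ _ ∘ₗ (e : W →ₗ[ℂ] (κ → V) × (κ' → Module.Dual ℂ V)) ∘ₗ
      LinearMap.applyₗ w) p l
  simp only [← h1, ← h2]
  constructor
  · intro h
    simp [h]
  · rintro ⟨h, h'⟩
    ext w
    apply e.injective
    rw [LinearMap.zero_apply, map_zero]
    exact Prod.ext (funext fun i => h w i) (funext fun j => LinearMap.ext fun v => h' w j v)

/-- The isometry group of a form on the standard module is a symmetric subgroup of the general
linear group, for the contragredient involution. -/
theorem IsSinglePair.isSymmetricSubgroup_of_contra {m : ℕ} {B : LinearMap.BilinForm ℂ (Std n)}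
    (hB : B.Nondegenerate) {ε : ℂ} (hε : ∀ x y, B x y = ε * B y x)
    (h : IsSinglePair ⊤ (isometryGroup B) m m G H) : IsSymmetricSubgroup H G := by
  obtain ⟨φ, ⟨hφ, e, he⟩, hG, rfl⟩ := h
  let θ : (⊤ : Subgroup (Std n ≃ₗ[ℂ] Std n)) →* (⊤ : Subgroup (Std n ≃ₗ[ℂ] Std n)) :=
    ((contra hB).comp (Subgroup.subtype _)).codRestrict _ fun _ => Subgroup.mem_top _
  have hθ : ∀ γ, (θ γ : Std n ≃ₗ[ℂ] Std n) = contra hB γ := fun γ => rfl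
  have hθ' : ∀ γ, ((θ γ)⁻¹ : Std n ≃ₗ[ℂ] Std n) = contra hB (γ⁻¹ : Std n ≃ₗ[ℂ] Std n) := fun γ => by
    rw [hθ, map_inv]
  obtain ⟨T, hT⟩ := exists_linearMap_of_relations (fun γ => toEnd (φ γ))
      (fun γ => toEnd (φ (θ γ))) fun l hl => by
    rw [linearCombination_eq_zero_iff e] at hl ⊢
    -- the contragredient exchanges the relations on the standard module and on its dual
    refine ⟨fun w i => ?_, fun w j v => ?_⟩
    · refine eq_of_forall_form hB fun z => ?_
      have h1 := hl.2 (e.symm (0, fun _ => B ((e w).1 i))) i z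
      simp only [toEnd_apply, he _ _ |>.2, he _ _ |>.1, LinearEquiv.apply_symm_apply] at h1 ⊢
      simp only [hθ, Finsupp.linearCombination_apply, Finsupp.sum, map_sum, map_smul,
        LinearMap.sum_apply, LinearMap.smul_apply, form_contra, map_zero,
        LinearMap.zero_apply] at h1 ⊢
      exact h1
    · obtain ⟨u, hu⟩ := (B.toDual hB).surjective ((e w).2 j)
      have h1 := congrArg (B.flip v) (hl.1 (e.symm (fun _ => u, 0)) j)
      simp only [toEnd_apply, he _ _ |>.2, he _ _ |>.1, LinearEquiv.apply_symm_apply] at h1 ⊢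
      rw [← hu]
      simp only [hθ', Finsupp.linearCombination_apply, Finsupp.sum, map_sum, map_smul,
        LinearMap.BilinForm.toDual_def, map_zero] at h1 ⊢
      rw [← h1]
      refine Finset.sum_congr rfl fun γ _ => ?_
      rw [hε, form_contra, inv_inv, ← hε]
      rfl
  refine isSymmetricSubgroup_of_involution hφ θ (fun γ => Subtype.ext (contra_contra hB hε γ))
    hT hG fun h => ?_
  rw [Subgroup.mem_map]
  refine exists_congr fun γ => and_congr_left fun _ => ?_
  rw [Subgroup.mem_subgroupOf]
  refine ⟨fun h => Subtype.ext (contra_eq_self hB h), fun h m m' => ?_⟩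
  have h1 : contra hB (γ : Std n ≃ₗ[ℂ] Std n) = γ := congrArg Subtype.val h
  have h2 := form_contra_apply hB (γ : Std n ≃ₗ[ℂ] Std n) m m'
  rwa [h1] at h2

/-- The coordinates of `IsStandardSq`, with the standard modules and their duals grouped
together. -/
theorem IsStandardSq.exists_regroup {φ : C × C →* isometryGroup ω} {a b c d : ℕ}
    (h : IsStandardSq φ a b c d) :
    ∃ e : W ≃ₗ[ℂ] (Fin a ⊕ Fin c → Std n) × (Fin b ⊕ Fin d → Module.Dual ℂ (Std n)),
      ∀ (γ : C × C) (w : W),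
        (∀ i, (e (toEnd (φ γ) w)).1 i =
          (Sum.elim (fun _ => γ.1.1) (fun _ => γ.2.1) i) ((e w).1 i)) ∧
        ∀ j v, (e (toEnd (φ γ) w)).2 j v =
          (e w).2 j ((Sum.elim (fun _ => γ.1.1⁻¹) (fun _ => γ.2.1⁻¹) j) v) := by
  obtain ⟨-, e, he⟩ := h
  refine ⟨(e.trans (LinearEquiv.prodProdProdComm ℂ _ _ _ _)).trans
    (LinearEquiv.prodCongr (LinearEquiv.sumArrowLequivProdArrow _ _ ℂ _).symm
      (LinearEquiv.sumArrowLequivProdArrow _ _ ℂ _).symm), fun γ w => ⟨?_, ?_⟩⟩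
  · rintro (i | i)
    · exact (he γ.1 γ.2 w).1 i
    · exact (he γ.1 γ.2 w).2.2.1 i
  · rintro (j | j) v
    · exact (he γ.1 γ.2 w).2.1 j v
    · exact (he γ.1 γ.2 w).2.2.2 j v

/-- The diagonal is a symmetric subgroup, for the exchange of the two factors. -/
theorem IsDiagonalPair.isSymmetricSubgroup {a b c d : ℕ} (h : IsDiagonalPair C a b c d G H)
    (ha : 0 < a) (hc : 0 < c) (hb : 0 < b ↔ 0 < d) : IsSymmetricSubgroup H G := by
  obtain ⟨φ, hφ, hG, rfl⟩ := h
  obtain ⟨e, he⟩ := hφ.exists_regroup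
  let θ : C × C →* C × C := (MonoidHom.snd C C).prod (MonoidHom.fst C C)
  obtain ⟨T, hT⟩ := exists_linearMap_of_relations (fun γ => toEnd (φ γ))
      (fun γ => toEnd (φ (θ γ))) fun l hl => by
    rw [linearCombination_eq_zero_iff e] at hl ⊢
    refine ⟨?_, ?_⟩
    · rintro w (i | i)
      · have h1 := hl.1 (e.symm (fun _ => (e w).1 (.inl i), 0)) (.inr ⟨0, hc⟩)
        simp only [he _ _ |>.1, LinearEquiv.apply_symm_apply] at h1 ⊢
        exact h1
      · have h1 := hl.1 (e.symm (fun _ => (e w).1 (.inr i), 0)) (.inl ⟨0, ha⟩)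
        simp only [he _ _ |>.1, LinearEquiv.apply_symm_apply] at h1 ⊢
        exact h1
    · rintro w (j | j) v
      · have h1 := hl.2 (e.symm (0, fun _ => (e w).2 (.inl j)))
          (.inr ⟨0, hb.mp (Nat.zero_lt_of_lt j.2)⟩) v
        simp only [he _ _ |>.2, LinearEquiv.apply_symm_apply] at h1 ⊢
        exact h1
      · have h1 := hl.2 (e.symm (0, fun _ => (e w).2 (.inr j)))
          (.inl ⟨0, hb.mpr (Nat.zero_lt_of_lt j.2)⟩) v
        simp only [he _ _ |>.2, LinearEquiv.apply_symm_apply] at h1 ⊢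
        exact h1
  refine isSymmetricSubgroup_of_involution hφ.1 θ (fun γ => rfl) hT hG fun h => ?_
  constructor
  · rintro ⟨γ, rfl⟩
    exact ⟨(γ, γ), rfl, rfl⟩
  · rintro ⟨⟨γ, γ'⟩, h1, rfl⟩
    obtain rfl : γ' = γ := congrArg Prod.fst h1
    exact ⟨γ', rfl⟩

end Involutions

/-! ### Commutants of isometry groups and of stabilizers of decompositions -/

section FormCommutants

variable {V : Type v} [AddCommGroup V] [Module ℂ V] [FiniteDimensional ℂ V]
  {Bf : LinearMap.BilinForm ℂ V} (hBf : Bf.Nondegenerate)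
  {ε : ℂ} (hε : ∀ x y, Bf x y = ε * Bf y x)
  {W : Type u} [AddCommGroup W] [Module ℂ W] {ω : LinearMap.BilinForm ℂ W}
  {ι κ : Type*} [Fintype ι] [DecidableEq ι] (e₀ : W ≃ₗ[ℂ] (κ → V)) (b : Module.Basis ι ℂ V)
  {Φ : isometryGroup Bf → isometryGroup ω}
  (hΦ : ∀ g w k, e₀ (toEnd (Φ g) w) k = toEnd g (e₀ w k))

omit [FiniteDimensional ℂ V] [Fintype ι] [DecidableEq ι] in
include hBf in
/-- No basis vector is orthogonal to all basis vectors. -/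
theorem exists_form_basis_ne_zero (s : ι) : ∃ t, Bf (b s) (b t) ≠ 0 := by
  by_contra! h
  refine b.ne_zero s (hBf.1 _ fun z => ?_)
  have : Bf (b s) = 0 := b.ext fun t => by simp [h t]
  rw [this, LinearMap.zero_apply]

include hBf hε hΦ in
/-- The form induced on the multiplicity space has the opposite symmetry. -/
theorem exists_multiplicity_form [Fintype κ] [DecidableEq κ] [Nonempty ι] (hω : ω.IsAlt)
    (hω' : ω.Nondegenerate) : ∃ β : LinearMap.BilinForm ℂ (κ → ℂ),
      (∀ m m', β m m' = -ε * β m' m) ∧ β.Nondegenerate ∧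
      ∀ w w', ω w w' = ∑ s, ∑ t, Bf (b s) (b t) * β (flipB e₀ b w s) (flipB e₀ b w' t) := by
  obtain ⟨β, hβ⟩ := exists_form_eq hBf hε e₀ b hΦ
  obtain ⟨t, ht⟩ := exists_form_basis_ne_zero hBf b (Classical.arbitrary ι)
  exact ⟨β, form_swap _ hβ hω (fun s t => hε _ _) ht, form_nondegenerate _ hβ hω', hβ⟩

variable {H : Subgroup (isometryGroup ω)} {β : LinearMap.BilinForm ℂ (κ → ℂ)}
  (hform : ∀ w w', ω w w' = ∑ s, ∑ t, Bf (b s) (b t) * β (flipB e₀ b w s) (flipB e₀ b w' t))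

include hBf hε hΦ hform in
/-- The commutant of the full isometry group. -/
theorem mem_commutant_isometries_iff [Nonempty ι] (hH : ∀ h, h ∈ H ↔ ∃ g, Φ g = h)
    (f : W ≃ₗ[ℂ] W) : f ∈ (commutant H).map (isometryGroup ω).subtype ↔
      ∃ y ∈ isometryGroup β, f = fam (flipB e₀ b) fun _ => y := by
  rw [mem_map_commutant_iff (flipB e₀ b) hform (c := fun _ => ())
    (fun _ => ⟨Classical.arbitrary ι, rfl⟩)]
  · constructor
    · rintro ⟨y, hy, rfl⟩
      obtain ⟨t, ht⟩ := exists_form_basis_ne_zero hBf b (Classical.arbitrary ι)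
      exact ⟨y (), hy _ _ ht, rfl⟩
    · rintro ⟨y, hy, rfl⟩
      exact ⟨fun _ => y, fun _ _ _ => hy, rfl⟩
  · intro x hx s t _
    refine commute_elem_of_commute_isometries hBf hε e₀ b hΦ (one_mul 1) (Or.inl ?_)
      (fun g _ => hx _ ((hH _).mpr ⟨g, rfl⟩)) (Commute.one_right _)
    exact (isTraceInvolution_adj hBf hε).map_one
  · intro h hh
    obtain ⟨g, rfl⟩ := (hH h).mp hh
    refine ⟨fun s t => b.repr (toEnd g (b t)) s, fun s t hst => absurd rfl hst, fun w s => ?_⟩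
    rw [toEnd_eq_amp e₀ hΦ, amp_matrix]

end FormCommutants

section FormBlocks

variable {V : Type v} [AddCommGroup V] [Module ℂ V] [FiniteDimensional ℂ V]
  {Bf : LinearMap.BilinForm ℂ V} (hBf : Bf.Nondegenerate)
  {ε : ℂ} (hε : ∀ x y, Bf x y = ε * Bf y x)
  {W : Type u} [AddCommGroup W] [Module ℂ W] {ω : LinearMap.BilinForm ℂ W}
  {ι₁ ι₂ κ : Type*} [Fintype ι₁] [DecidableEq ι₁] [Fintype ι₂] [DecidableEq ι₂]
  (e₀ : W ≃ₗ[ℂ] (κ → V)) (b : Module.Basis (ι₁ ⊕ ι₂) ℂ V)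
  {Φ : isometryGroup Bf → isometryGroup ω}
  (hΦ : ∀ g w k, e₀ (toEnd (Φ g) w) k = toEnd g (e₀ w k))
  {X Y : Submodule ℂ V} (hXY : IsCompl X Y) (hbX : ∀ s, b (.inl s) ∈ X)
  (hbY : ∀ s, b (.inr s) ∈ Y)
  {H : Subgroup (isometryGroup ω)} {β : LinearMap.BilinForm ℂ (κ → ℂ)}
  (hform : ∀ w w', ω w w' = ∑ s, ∑ t, Bf (b s) (b t) * β (flipB e₀ b w s) (flipB e₀ b w' t))

include hBf hε hΦ hform hXY hbX hbY in
/-- The commutant of the stabilizer of a decomposition, assuming that the projection onto the first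
summand is self-adjoint or that its adjoint is the complementary projection. -/
theorem mem_commutant_block_iff [Nonempty ι₁] [Nonempty ι₂]
    (hadj : (∀ x ∈ X, ∀ y ∈ Y, Bf x y = 0) ∨
      ((∀ x ∈ X, ∀ x' ∈ X, Bf x x' = 0) ∧ ∀ y ∈ Y, ∀ y' ∈ Y, Bf y y' = 0))
    (hH : ∀ h, h ∈ H ↔ ∃ g : isometryGroup Bf, (g : V ≃ₗ[ℂ] V) ∈ blockGroup X Y ∧ Φ g = h)
    (f : W ≃ₗ[ℂ] W) : f ∈ (commutant H).map (isometryGroup ω).subtype ↔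
      ∃ y z, (∀ s t, Bf (b s) (b t) ≠ 0 → ∀ m m',
          β ((Sum.elim (fun _ => y) (fun _ => z) s : (κ → ℂ) ≃ₗ[ℂ] (κ → ℂ)) m)
            ((Sum.elim (fun _ => y) (fun _ => z) t : (κ → ℂ) ≃ₗ[ℂ] (κ → ℂ)) m') = β m m') ∧
        f = fam (flipB e₀ b) (Sum.elim (fun _ => y) (fun _ => z)) := by
  obtain ⟨π, hπX, hπY⟩ := exists_scaling hXY 1 0
  simp only [one_smul, zero_smul] at hπX hπY
  have hdec : ∀ v, ∃ x ∈ X, ∃ x' ∈ Y, x + x' = v := fun v =>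
    Submodule.mem_sup.mp (hXY.sup_eq_top ▸ Submodule.mem_top)
  have hπ₁ : ∀ s, π (b (.inl s)) = b (.inl s) := fun s => hπX _ (hbX s)
  have hπ₂ : ∀ s, π (b (.inr s)) = 0 := fun s => hπY _ (hbY s)
  have hππ : π * π = π := by
    ext v
    obtain ⟨x, hx, x', hx', rfl⟩ := hdec v
    simp [hπX x hx, hπY x' hx']
  have hblock : ∀ g : isometryGroup Bf, (g : V ≃ₗ[ℂ] V) ∈ blockGroup X Y ↔
      Commute (toEnd g) π := by
    intro g
    rw [mem_blockGroup_iff_commute hXY one_ne_zero (by simpa using hπX) (by simpa using hπY)]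
    exact ⟨fun h => LinearMap.ext h, fun h => LinearMap.congr_fun h.eq⟩
  have hadj' : adj Bf hBf π = π ∨ adj Bf hBf π = 1 - π := by
    refine hadj.imp (fun h => ?_) fun h => ?_
    · refine adj_eq_of_forall hBf fun v' v => ?_
      obtain ⟨x, hx, y, hy, rfl⟩ := hdec v
      obtain ⟨x', hx', y', hy', rfl⟩ := hdec v'
      have h1 : Bf y x' = 0 := by rw [hε, h _ hx' _ hy, mul_zero]
      simp [hπX, hπY, hx, hx', hy, hy', h x hx y' hy', h1]
    · refine adj_eq_of_forall hBf fun v' v => ?_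
      obtain ⟨x, hx, y, hy, rfl⟩ := hdec v
      obtain ⟨x', hx', y', hy', rfl⟩ := hdec v'
      simp [hπX, hπY, hx, hx', hy, hy', h.1 x hx x' hx', h.2 y hy y' hy']
  rw [mem_map_commutant_iff (flipB e₀ b) hform (c := Sum.isLeft) (H := H)]
  · constructor
    · rintro ⟨y, hy, rfl⟩
      have h1 : (Sum.elim (fun _ => y true) (fun _ => y false) :
          ι₁ ⊕ ι₂ → ((κ → ℂ) ≃ₗ[ℂ] (κ → ℂ))) = y ∘ Sum.isLeft := by
        ext (s | s) : 1 <;> rfl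
      refine ⟨y true, y false, ?_, ?_⟩
      · rw [h1]; exact hy
      · rw [h1]
    · rintro ⟨y, z, hyz, rfl⟩
      have h1 : (Sum.elim (fun _ => y) (fun _ => z) :
          ι₁ ⊕ ι₂ → ((κ → ℂ) ≃ₗ[ℂ] (κ → ℂ))) =
          (fun t : Bool => if t then y else z) ∘ Sum.isLeft := by
        ext (s | s) : 1 <;> rfl
      refine ⟨fun t => if t then y else z, ?_, by rw [h1]⟩
      rw [h1] at hyz
      exact hyz
  · rintro (_ | _)
    · exact ⟨.inr (Classical.arbitrary _), rfl⟩
    · exact ⟨.inl (Classical.arbitrary _), rfl⟩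
  · intro x hx s t hst
    refine commute_elem_of_commute_isometries hBf hε e₀ b hΦ hππ hadj'
      (fun g hg => hx _ ((hH _).mpr ⟨g, (hblock g).mpr hg, rfl⟩)) ?_
    refine b.ext fun r => ?_
    rcases s with s | s <;> rcases t with t | t
    · rcases r with r | r <;> simp [unit, Finsupp.single_apply, hπ₁, hπ₂, apply_ite π]
    · simp at hst
    · simp at hst
    · rcases r with r | r <;> simp [unit, Finsupp.single_apply, hπ₁, hπ₂, apply_ite π]
  · intro h hh
    obtain ⟨g, hg, rfl⟩ := (hH h).mp hh
    refine ⟨fun s t => b.repr (toEnd g (b t)) s, fun s t hst => ?_, fun w s => ?_⟩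
    · rcases s with s | s <;> rcases t with t | t
      · simp at hst
      · exact repr_inl_eq_zero hXY b hbX hbY ((hg.2 _).mpr (hbY t)) s
      · exact repr_inr_eq_zero hXY b hbX hbY ((hg.1 _).mpr (hbX t)) s
      · simp at hst
    · rw [toEnd_eq_amp e₀ hΦ, amp_matrix]

include hBf hε hΦ hform hXY hbX hbY in
/-- The commutant of the stabilizer of an orthogonal decomposition consists of pairs of isometries
of the multiplicity space, one for each summand. -/
theorem mem_commutant_orthogonal_iff [Nonempty ι₁] [Nonempty ι₂]
    (horth : ∀ x ∈ X, ∀ y ∈ Y, Bf x y = 0)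
    (hH : ∀ h, h ∈ H ↔ ∃ g : isometryGroup Bf, (g : V ≃ₗ[ℂ] V) ∈ blockGroup X Y ∧ Φ g = h)
    (f : W ≃ₗ[ℂ] W) : f ∈ (commutant H).map (isometryGroup ω).subtype ↔
      ∃ y ∈ isometryGroup β, ∃ z ∈ isometryGroup β,
        f = fam (flipB e₀ b) (Sum.elim (fun _ => y) (fun _ => z)) := by
  rw [mem_commutant_block_iff hBf hε e₀ b hΦ hXY hbX hbY hform (.inl horth) hH]
  have horth' : ∀ x ∈ X, ∀ y ∈ Y, Bf y x = 0 := fun x hx y hy => by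
    rw [hε, horth x hx y hy, mul_zero]
  constructor
  · rintro ⟨y, z, hyz, rfl⟩
    refine ⟨y, ?_, z, ?_, rfl⟩
    · obtain ⟨t | t, ht⟩ := exists_form_basis_ne_zero hBf b (.inl (Classical.arbitrary ι₁))
      · exact hyz _ _ ht
      · exact absurd (horth _ (hbX _) _ (hbY _)) ht
    · obtain ⟨t | t, ht⟩ := exists_form_basis_ne_zero hBf b (.inr (Classical.arbitrary ι₂))
      · exact absurd (horth' _ (hbX _) _ (hbY _)) ht
      · exact hyz _ _ ht
  · rintro ⟨y, hy, z, hz, rfl⟩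
    refine ⟨y, z, ?_, rfl⟩
    rintro (s | s) (t | t) hst
    · exact hy
    · exact absurd (horth _ (hbX _) _ (hbY _)) hst
    · exact absurd (horth' _ (hbX _) _ (hbY _)) hst
    · exact hz

include hBf hε hΦ hform hXY hbX hbY in
/-- The commutant of the stabilizer of a polarization consists of all automorphisms of the
multiplicity space, acting contragrediently on the second summand: the form pairs the two summands
only with each other. -/
theorem mem_commutant_isotropic_iff [Fintype κ] [Nonempty ι₁] [Nonempty ι₂]
    (hX : ∀ x ∈ X, ∀ x' ∈ X, Bf x x' = 0) (hY : ∀ y ∈ Y, ∀ y' ∈ Y, Bf y y' = 0)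
    (hβ : β.Nondegenerate) {ε' : ℂ} (hε' : ∀ m m', β m m' = ε' * β m' m)
    (hH : ∀ h, h ∈ H ↔ ∃ g : isometryGroup Bf, (g : V ≃ₗ[ℂ] V) ∈ blockGroup X Y ∧ Φ g = h)
    (f : W ≃ₗ[ℂ] W) : f ∈ (commutant H).map (isometryGroup ω).subtype ↔
      ∃ y, f = fam (flipB e₀ b) (twist hβ _ _ y) := by
  rw [mem_commutant_block_iff hBf hε e₀ b hΦ hXY hbX hbY hform (.inr ⟨hX, hY⟩) hH]
  constructor
  · rintro ⟨y, z, hyz, rfl⟩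
    refine ⟨y, ?_⟩
    have hz : z = contra hβ y := by
      obtain ⟨t | t, ht⟩ := exists_form_basis_ne_zero hBf b (.inr (Classical.arbitrary ι₂))
      · exact eq_contra_of_forall hβ (hyz _ _ ht)
      · exact absurd (hY _ (hbY _) _ (hbY _)) ht
    rw [hz]
    rfl
  · rintro ⟨y, rfl⟩
    refine ⟨y, contra hβ y, ?_, rfl⟩
    rintro (s | s) (t | t) hst m m'
    · exact absurd (hX _ (hbX _) _ (hbX _)) hst
    · change β (y m) (contra hβ y m') = β m m'
      rw [hε', form_contra_apply, ← hε']
    · exact form_contra_apply hβ y m m'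
    · exact absurd (hY _ (hbY _) _ (hbY _)) hst

end FormBlocks

/-! ### Reciprocals of the diagonal and bilinear form pairs -/

section Generation

variable {W : Type u} [AddCommGroup W] [Module ℂ W] {ω : LinearMap.BilinForm ℂ W}

/-- If `G` is generated, up to linear combinations, by `H` and one more element `σ`, then the
commutant of `G` is cut out in that of `H` by commutation with `σ`. -/
theorem mem_commutant_iff_of_generation {M : Type*} [Group M] {F : M →* (W ≃ₗ[ℂ] W)}
    (hF : Function.Injective F) {C : Set M} {G H : Subgroup (isometryGroup ω)}
    (hK : ∀ f, f ∈ (commutant H).map (isometryGroup ω).subtype ↔ ∃ y ∈ C, f = F y)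
    (hHG : H ≤ G) {σ : isometryGroup ω} (hσ : σ ∈ G) {d : M} (hd : (σ : W ≃ₗ[ℂ] W) = F d)
    (hgen : ∀ x : Module.End ℂ W, (∀ h ∈ H, Commute x (toEnd h)) → Commute x (toEnd σ) →
      ∀ g ∈ G, Commute x (toEnd g)) (f : W ≃ₗ[ℂ] W) :
    f ∈ (commutant G).map (isometryGroup ω).subtype ↔ ∃ y ∈ C, Commute y d ∧ f = F y := by
  constructor
  · rintro ⟨g, hg, rfl⟩
    have hgH : g ∈ commutant H := Subgroup.centralizer_le hHG hg
    obtain ⟨y, hy, h⟩ := (hK g).mp ⟨g, hgH, rfl⟩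
    refine ⟨y, hy, hF ?_, h⟩
    rw [map_mul, map_mul, ← hd, ← h]
    exact (congrArg Subtype.val (Subgroup.mem_centralizer_iff.mp hg σ hσ)).symm
  · rintro ⟨y, hy, hyd, rfl⟩
    obtain ⟨g, hg, h⟩ := (hK (F y)).mpr ⟨y, hy, rfl⟩
    refine ⟨g, ?_, h⟩
    have hgσ : g * σ = σ * g := by
      apply Subtype.ext
      change (g : W ≃ₗ[ℂ] W) * σ = σ * g
      change (g : W ≃ₗ[ℂ] W) = F y at h
      rw [h, hd, ← map_mul, hyd.eq, map_mul]
    refine mem_commutant_iff.mpr fun k hk => (hgen (toEnd g) ?_ ?_ k hk).eq.symm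
    · intro k hk
      exact (mem_commutant_iff.mp hg k hk).symm
    · exact (map_mul toEnd g σ).symm.trans ((congrArg toEnd hgσ).trans (map_mul toEnd σ g))

/-- The full product is generated by the diagonal and the element `(1, -1)`. -/
theorem commute_of_commute_diagonal {n : ℕ} {C : Subgroup (Std n ≃ₗ[ℂ] Std n)}
    {φ : C × C →* isometryGroup ω} {a b c d : ℕ} (hφ : IsStandardSq φ a b c d) {z : C}
    (hz : ∀ v, (z : Std n ≃ₗ[ℂ] Std n) v = -v) {x : Module.End ℂ W}
    (hx : ∀ γ, Commute x (toEnd (φ (γ, γ)))) (hxz : Commute x (toEnd (φ (1, z)))) (γ : C × C) :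
    Commute x (toEnd (φ γ)) := by
  obtain ⟨e, he⟩ := hφ.exists_regroup
  have hz' : ∀ v, (z⁻¹ : Std n ≃ₗ[ℂ] Std n) v = -v := by
    intro v
    apply (z : Std n ≃ₗ[ℂ] Std n).injective
    rw [← LinearEquiv.mul_apply, mul_inv_cancel, hz, neg_neg]
    rfl
  -- the projection onto the isotypic part of the first factor
  set P : Module.End ℂ W := (2 : ℂ)⁻¹ • (1 + toEnd (φ (1, z))) with hP
  have hP1 : ∀ w i, (e (P w)).1 i = Sum.elim (fun i => (e w).1 (.inl i)) (fun _ => 0) i := by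
    intro w i
    simp only [hP, LinearMap.smul_apply, LinearMap.add_apply, map_smul, map_add, Prod.smul_fst,
      Prod.fst_add, Pi.smul_apply, Pi.add_apply, (he _ _).1, Module.End.one_apply]
    rcases i with i | i
    · simp only [Sum.elim_inl, OneMemClass.coe_one, LinearEquiv.coe_one, id]
      module
    · simp only [Sum.elim_inr, hz, add_neg_cancel, smul_zero]
  have hP2 : ∀ w j, (e (P w)).2 j = Sum.elim (fun i => (e w).2 (.inl i)) (fun _ => 0) j := by
    intro w j
    refine LinearMap.ext fun v => ?_
    simp only [hP, LinearMap.smul_apply, LinearMap.add_apply, map_smul, map_add, Prod.smul_snd,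
      Prod.snd_add, Pi.smul_apply, Pi.add_apply, (he _ _).2, Module.End.one_apply]
    rcases j with j | j
    · simp only [Sum.elim_inl, OneMemClass.coe_one, inv_one, LinearEquiv.coe_one, id]
      module
    · simp only [Sum.elim_inr, hz', map_neg, add_neg_cancel, smul_zero, LinearMap.zero_apply]
  have key : toEnd (φ γ) = toEnd (φ (γ.1, γ.1)) * P + toEnd (φ (γ.2, γ.2)) * (1 - P) := by
    ext w
    apply e.injective
    refine Prod.ext (funext fun i => ?_) (funext fun j => LinearMap.ext fun v => ?_)
    · simp only [LinearMap.add_apply, map_add, Prod.fst_add, Pi.add_apply, Module.End.mul_apply,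
        (he _ _).1, LinearMap.sub_apply, map_sub, Prod.fst_sub, Pi.sub_apply, hP1,
        Module.End.one_apply]
      rcases i with i | i <;> simp
    · simp only [LinearMap.add_apply, map_add, Prod.snd_add, Pi.add_apply, Module.End.mul_apply,
        (he _ _).2, LinearMap.sub_apply, map_sub, Prod.snd_sub, Pi.sub_apply, hP2,
        Module.End.one_apply]
      rcases j with j | j <;> simp
  have hxP : Commute x P := ((Commute.one_right x).add_right hxz).smul_right _
  rw [key]
  exact ((hx _).mul_right hxP).add_right ((hx _).mul_right ((Commute.one_right x).sub_right hxP))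

end Generation

section Coordinates

variable {N : ℕ}

/-- The diagonal automorphism scaling the coordinates selected by `S` by `c₁` and the others by
`c₂`. -/
theorem exists_coord_scaling (S : Fin N → Bool) {c₁ c₂ : ℂ} (h₁ : c₁ ≠ 0) (h₂ : c₂ ≠ 0) :
    ∃ d : Std N ≃ₗ[ℂ] Std N, ∀ u k, d u k = (if S k then c₁ else c₂) * u k :=
  ⟨LinearEquiv.piCongrRight fun k => LinearEquiv.smulOfNeZero ℂ ℂ (if S k then c₁ else c₂)
    (by split_ifs <;> assumption), fun u k => rfl⟩

theorem coord_scaling_left {S : Fin N → Bool} {c₁ c₂ : ℂ} {d : Std N ≃ₗ[ℂ] Std N}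
    (hd : ∀ u k, d u k = (if S k then c₁ else c₂) * u k) :
    ∀ u ∈ coordSubspace S, d u = c₁ • u := by
  intro u hu
  ext k
  rw [hd]
  cases hk : S k
  · simp [hu k hk]
  · simp

theorem coord_scaling_right {S : Fin N → Bool} {c₁ c₂ : ℂ} {d : Std N ≃ₗ[ℂ] Std N}
    (hd : ∀ u k, d u k = (if S k then c₁ else c₂) * u k) :
    ∀ u ∈ coordSubspace (fun k => !S k), d u = c₂ • u := by
  intro u hu
  ext k
  rw [hd]
  cases hk : S k
  · simp
  · simp [hu k (by simp [hk])]

theorem mem_blockGroup_coordSubspace_iff {S : Fin N → Bool} {c₁ c₂ : ℂ} (hc : c₁ ≠ c₂)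
    {d : Std N ≃ₗ[ℂ] Std N} (hd : ∀ u k, d u k = (if S k then c₁ else c₂) * u k)
    (y : Std N ≃ₗ[ℂ] Std N) :
    y ∈ blockGroup (coordSubspace S) (coordSubspace fun k => !S k) ↔ Commute y d := by
  rw [mem_blockGroup_iff_commute (isCompl_coordSubspace S) (d := d) hc (coord_scaling_left hd)
    (coord_scaling_right hd)]
  exact ⟨fun h => LinearEquiv.ext h, fun h => LinearEquiv.congr_fun h.eq⟩

end Coordinates

section Count

variable {α α' γ : Type*} [Fintype γ] (τ : α ⊕ α' ≃ γ)

theorem card_isLeft_symm [Fintype α] : Fintype.card {k // (τ.symm k).isLeft = true} =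
    Fintype.card α := by
  refine (Fintype.card_of_bijective (f := fun i : α =>
    (⟨τ (.inl i), by simp⟩ : {k // (τ.symm k).isLeft = true})) ⟨fun i j h => ?_, ?_⟩).symm
  · simpa using h
  · rintro ⟨k, hk⟩
    obtain ⟨i, hi⟩ := Sum.isLeft_iff.mp hk
    exact ⟨i, Subtype.ext (by simp [← hi])⟩

theorem card_not_isLeft_symm [Fintype α'] :
    Fintype.card {k // (!(τ.symm k).isLeft) = true} = Fintype.card α' := by
  refine (Fintype.card_of_bijective (f := fun i : α' =>
    (⟨τ (.inr i), by simp⟩ : {k // (!(τ.symm k).isLeft) = true})) ⟨fun i j h => ?_, ?_⟩).symm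
  · simpa using h
  · rintro ⟨k, hk⟩
    obtain ⟨i, hi⟩ := Sum.isRight_iff.mp (by simpa using hk : (τ.symm k).isRight = true)
    exact ⟨i, Subtype.ext (by simp [← hi])⟩

end Count

section FormReciprocity

variable {W : Type u} [AddCommGroup W] [Module ℂ W] {ω : LinearMap.BilinForm ℂ W}
  (hω : ω.IsAlt) (hω' : ω.Nondegenerate) {n N : ℕ} (hn : 0 < n)
  {Bf : LinearMap.BilinForm ℂ (Std n)} (hBf : Bf.Nondegenerate)
  {ε : ℂ} (hε : ∀ x y, Bf x y = ε * Bf y x) {G H : Subgroup (isometryGroup ω)}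

include hω hω' hn hBf hε in
/-- The reciprocal pair when `H` is an isometry group and `G` is generated by `H` together with an
element scaling the copies of the standard module of `H` by two different numbers. -/
theorem exists_isSinglePair_blockGroup (e₀ : W ≃ₗ[ℂ] (Fin N → Std n))
    {Φ : isometryGroup Bf → isometryGroup ω}
    (hΦ : ∀ g w k, e₀ (toEnd (Φ g) w) k = toEnd g (e₀ w k)) (hH : ∀ h, h ∈ H ↔ ∃ g, Φ g = h)
    (hHG : H ≤ G) {σ : isometryGroup ω} (hσ : σ ∈ G) (S : Fin N → Bool) {c₁ c₂ : ℂ}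
    (h₁ : c₁ ≠ 0) (h₂ : c₂ ≠ 0) (hc : c₁ ≠ c₂)
    (hσe : ∀ w k, e₀ (toEnd σ w) k = (if S k then c₁ else c₂) • e₀ w k)
    (hgen : ∀ x : Module.End ℂ W, (∀ h ∈ H, Commute x (toEnd h)) → Commute x (toEnd σ) →
      ∀ g ∈ G, Commute x (toEnd g)) :
    ∃ β : LinearMap.BilinForm ℂ (Std N), (∀ m m', β m m' = -ε * β m' m) ∧ β.Nondegenerate ∧
      (∀ x ∈ coordSubspace S, ∀ x' ∈ coordSubspace S, c₁ * c₁ * β x x' = β x x') ∧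
      (∀ x ∈ coordSubspace S, ∀ y ∈ coordSubspace (fun k => !S k), c₁ * c₂ * β x y = β x y) ∧
      (∀ y ∈ coordSubspace (fun k => !S k), ∀ y' ∈ coordSubspace (fun k => !S k),
        c₂ * c₂ * β y y' = β y y') ∧
      IsSinglePair (isometryGroup β)
        (blockGroup (coordSubspace S) (coordSubspace fun k => !S k)) n 0
        (commutant H) (commutant G) := by
  have : Nonempty (Fin n) := ⟨⟨0, hn⟩⟩
  let b := Pi.basisFun ℂ (Fin n)
  obtain ⟨β, hβε, hβ, hform⟩ := exists_multiplicity_form hBf hε e₀ b hΦ hω hω'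
  obtain ⟨d, hd⟩ := exists_coord_scaling S h₁ h₂
  have hK := mem_commutant_isometries_iff hBf hε e₀ b hΦ hform hH
  have hσd : (σ : W ≃ₗ[ℂ] W) = fam (flipB e₀ b) fun _ => d := by
    rw [eq_fam_iff]
    intro w s
    ext k
    change flipB e₀ b (toEnd σ w) s k = _
    rw [flipB_apply, hσe, hd, flipB_apply, map_smul, Finsupp.smul_apply, smul_eq_mul]
  have hdβ : d ∈ isometryGroup β := by
    obtain ⟨t, ht⟩ := exists_form_basis_ne_zero hBf b ⟨0, hn⟩
    have h1 := σ.2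
    rw [hσd, fam_mem_isometryGroup_iff (flipB e₀ b) hform] at h1
    exact h1 _ _ ht
  refine ⟨β, hβε, hβ, fun x hx x' hx' => ?_, fun x hx y hy => ?_, fun y hy y' hy' => ?_, ?_⟩
  · have h1 := hdβ x x'
    rw [coord_scaling_left hd x hx, coord_scaling_left hd x' hx'] at h1
    simp only [map_smul, LinearMap.smul_apply, smul_eq_mul] at h1
    rw [mul_assoc, h1]
  · have h1 := hdβ x y
    rw [coord_scaling_left hd x hx, coord_scaling_right hd y hy] at h1
    simp only [map_smul, LinearMap.smul_apply, smul_eq_mul] at h1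
    linear_combination h1
  · have h1 := hdβ y y'
    rw [coord_scaling_right hd y hy, coord_scaling_right hd y' hy'] at h1
    simp only [map_smul, LinearMap.smul_apply, smul_eq_mul] at h1
    rw [mul_assoc, h1]
  · let s : Fin n ≃ Fin n ⊕ Fin 0 := (Equiv.sumEmpty _ _).symm
    have hs : ∀ y, twist hβ (Fin n) (Fin 0) y ∘ s = fun _ => y := fun y => rfl
    let F : (Std N ≃ₗ[ℂ] Std N) →* (W ≃ₗ[ℂ] W) :=
      (fam (flipB e₀ b)).comp (Pi.constMonoidHom _ _)
    have hF : Function.Injective F := fun y z h =>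
      congrFun (fam_injective (flipB e₀ b) h) ⟨0, hn⟩
    refine isSinglePair_of_coordinates hβ hn
      ((flipB e₀ b).trans (LinearEquiv.funCongrLeft ℂ _ s.symm)) (fun f => ?_) (fun f => ?_)
    · simp only [fam_reindex, hs]
      exact hK f
    · simp only [fam_reindex, hs, mem_blockGroup_coordSubspace_iff hc hd]
      exact mem_commutant_iff_of_generation hF (C := isometryGroup β) hK hHG hσ hσd hgen f

include hω hω' hn hBf hε in
/-- The reciprocal of the diagonal in a product of two orthogonal or symplectic groups. -/
theorem IsDiagonalPair.reciprocal_of_form {a c : ℕ}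
    (h : IsDiagonalPair (isometryGroup Bf) a 0 c 0 G H) (hN : a + c = N) :
    ∃ β : LinearMap.BilinForm ℂ (Std N), (∀ m m', β m m' = -ε * β m' m) ∧ β.Nondegenerate ∧
      ∃ X Y : Submodule ℂ (Std N), IsCompl X Y ∧ Module.finrank ℂ X = a ∧
        Module.finrank ℂ Y = c ∧ (∀ x ∈ X, ∀ y ∈ Y, β x y = 0) ∧
        IsSinglePair (isometryGroup β) (blockGroup X Y) n 0 (commutant H) (commutant G) := by
  obtain ⟨φ, hφ, rfl, rfl⟩ := h
  obtain ⟨e, he⟩ := hφ.exists_regroup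
  let τ : Fin a ⊕ Fin c ≃ Fin N := finSumFinEquiv.trans (finCongr hN)
  let e₀ : W ≃ₗ[ℂ] (Fin N → Std n) :=
    (e.trans LinearEquiv.prodUnique).trans (LinearEquiv.funCongrLeft ℂ _ τ.symm)
  have he₀ : ∀ w k, e₀ w k = (e w).1 (τ.symm k) := fun w k => rfl
  let S : Fin N → Bool := fun k => (τ.symm k).isLeft
  let z : isometryGroup Bf := ⟨LinearEquiv.neg ℂ, fun x y => by simp⟩
  have hz : ∀ v, (z : Std n ≃ₗ[ℂ] Std n) v = -v := fun v => rfl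
  have hΦ : ∀ (g : isometryGroup Bf) w k, e₀ (toEnd (φ (g, g)) w) k = toEnd g (e₀ w k) := by
    intro g w k
    rw [he₀, (he _ _).1, he₀]
    rcases τ.symm k with i | i <;> rfl
  have hzS : ∀ w k, e₀ (toEnd (φ (1, z)) w) k = (if S k then (1 : ℂ) else -1) • e₀ w k := by
    intro w k
    rw [he₀, (he _ _).1, he₀]
    have hS : S k = (τ.symm k).isLeft := rfl
    rcases hi : τ.symm k with i | i
    · simp [hS, hi]
    · simp [hS, hi, hz]
  have hHG : (φ.comp ((MonoidHom.id (isometryGroup Bf)).prod (MonoidHom.id _))).range ≤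
      φ.range := by
    rintro _ ⟨γ, rfl⟩
    exact ⟨(γ, γ), rfl⟩
  obtain ⟨β, hβε, hβ, -, hXY, -, hpair⟩ := exists_isSinglePair_blockGroup hω hω' hn hBf hε
    e₀ hΦ (fun h => Iff.rfl) hHG (σ := φ (1, z)) ⟨_, rfl⟩ S
    one_ne_zero (by norm_num) (by norm_num) hzS fun x hx hxz => by
      rintro _ ⟨γ, rfl⟩
      exact commute_of_commute_diagonal hφ hz (fun γ => hx _ ⟨γ, rfl⟩) hxz γ
  refine ⟨β, hβε, hβ, _, _, isCompl_coordSubspace S, ?_, ?_, fun x hx y hy => ?_, hpair⟩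
  · rw [finrank_coordSubspace, card_isLeft_symm, Fintype.card_fin]
  · rw [finrank_coordSubspace, card_not_isLeft_symm, Fintype.card_fin]
  · have := hXY x hx y hy
    linear_combination -this / 2

include hω hω' hn hBf hε in
/-- The reciprocal of an orthogonal or symplectic group in the general linear group. -/
theorem IsSinglePair.reciprocal_of_form {m : ℕ}
    (h : IsSinglePair ⊤ (isometryGroup Bf) m m G H) (hN : m + m = N) :
    ∃ β : LinearMap.BilinForm ℂ (Std N), (∀ m m', β m m' = -ε * β m' m) ∧ β.Nondegenerate ∧
      ∃ X Y : Submodule ℂ (Std N), IsCompl X Y ∧ (∀ x ∈ X, ∀ x' ∈ X, β x x' = 0) ∧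
        (∀ y ∈ Y, ∀ y' ∈ Y, β y y' = 0) ∧
        IsSinglePair (isometryGroup β) (blockGroup X Y) n 0 (commutant H) (commutant G) := by
  obtain ⟨φ, ⟨hφ, e, he⟩, rfl, rfl⟩ := h
  let τ : Fin m ⊕ Fin m ≃ Fin N := finSumFinEquiv.trans (finCongr hN)
  let E : W ≃ₗ[ℂ] (Fin m ⊕ Fin m → Std n) :=
    (e.trans (LinearEquiv.prodCongr (.refl ℂ _)
      (LinearEquiv.piCongrRight fun _ => (Bf.toDual hBf).symm))).trans
      (LinearEquiv.sumArrowLequivProdArrow _ _ ℂ _).symm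
  have hE : ∀ (g : (⊤ : Subgroup (Std n ≃ₗ[ℂ] Std n))) w i, E (toEnd (φ g) w) i =
      twist hBf _ _ (g : Std n ≃ₗ[ℂ] Std n) i (E w i) := by
    rintro g w (i | i)
    · exact (he g w).1 i
    · change (Bf.toDual hBf).symm ((e ((φ g : W ≃ₗ[ℂ] W) w)).2 i) =
        contra hBf (g : Std n ≃ₗ[ℂ] Std n) ((Bf.toDual hBf).symm ((e w).2 i))
      apply (Bf.toDual hBf).injective
      refine LinearMap.ext fun v => ?_
      rw [LinearEquiv.apply_symm_apply, (he g w).2, LinearMap.BilinForm.toDual_def, form_contra,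
        ← LinearMap.BilinForm.toDual_def hBf, LinearEquiv.apply_symm_apply]
  let e₀ : W ≃ₗ[ℂ] (Fin N → Std n) := E.trans (LinearEquiv.funCongrLeft ℂ _ τ.symm)
  have he₀ : ∀ w k, e₀ w k = E w (τ.symm k) := fun w k => rfl
  let S : Fin N → Bool := fun k => (τ.symm k).isLeft
  -- a scalar of the general linear group separates the standard module from its dual
  let z : (⊤ : Subgroup (Std n ≃ₗ[ℂ] Std n)) :=
    ⟨LinearEquiv.smulOfNeZero ℂ (Std n) 2 two_ne_zero, trivial⟩
  have hz : ∀ v, (z : Std n ≃ₗ[ℂ] Std n) v = (2 : ℂ) • v := fun v => rfl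
  have hz' : ∀ v, contra hBf (z : Std n ≃ₗ[ℂ] Std n) v = (2 : ℂ)⁻¹ • v := by
    intro v
    refine eq_of_forall_form hBf fun m => ?_
    have h1 := form_contra_apply hBf (z : Std n ≃ₗ[ℂ] Std n) v m
    rw [hz, map_smul, smul_eq_mul] at h1
    rw [map_smul, LinearMap.smul_apply, smul_eq_mul]
    linear_combination h1 / 2
  let Φ : isometryGroup Bf → isometryGroup ω := fun g => φ ⟨g, trivial⟩
  have hΦ : ∀ g w k, e₀ (toEnd (Φ g) w) k = toEnd g (e₀ w k) := by
    intro g w k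
    rw [he₀, hE, he₀, twist_eq_const hBf g.2]
    rfl
  have hzS : ∀ w k, e₀ (toEnd (φ z) w) k = (if S k then (2 : ℂ) else 2⁻¹) • e₀ w k := by
    intro w k
    rw [he₀, hE, he₀]
    have hS : S k = (τ.symm k).isLeft := rfl
    rcases hi : τ.symm k with i | i
    · simp [hS, hi, hz]
    · simp [hS, hi, hz']
  have hH : ∀ h, h ∈ ((isometryGroup Bf).subgroupOf ⊤).map φ ↔ ∃ g, Φ g = h := by
    intro h
    constructor
    · rintro ⟨g, hg, rfl⟩
      exact ⟨⟨g, hg⟩, rfl⟩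
    · rintro ⟨g, rfl⟩
      exact ⟨⟨g, trivial⟩, g.2, rfl⟩
  have hHG : ((isometryGroup Bf).subgroupOf ⊤).map φ ≤ φ.range := by
    rintro x ⟨g, -, rfl⟩
    exact ⟨g, rfl⟩
  have hgen : ∀ x : Module.End ℂ W, (∀ h ∈ ((isometryGroup Bf).subgroupOf ⊤).map φ,
      Commute x (toEnd h)) → Commute x (toEnd (φ z)) → ∀ g ∈ φ.range, Commute x (toEnd g) := by
    rintro x hx hxz _ ⟨γ, rfl⟩
    have hamp : ∀ a, Commute x (amp e₀ a) := by
      intro a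
      have h1 : a ∈ (Subalgebra.centralizer ℂ {x}).comap (amp e₀) := by
        refine mem_of_isometry_mem hBf hε (one_mul 1)
          (Or.inl (isTraceInvolution_adj hBf hε).map_one) (fun g _ => ?_) (Commute.one_right a)
        rw [Subalgebra.mem_comap, Subalgebra.mem_centralizer_iff, ← toEnd_eq_amp e₀ hΦ]
        rintro _ rfl
        exact hx _ ⟨⟨g, trivial⟩, g.2, rfl⟩
      rw [Subalgebra.mem_comap, Subalgebra.mem_centralizer_iff] at h1
      exact h1 x rfl
    -- the projection onto the copies of the standard module, where `φ z` acts by `2`, along those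
    -- of its dual, where it acts by `1 / 2`
    set P : Module.End ℂ W := (2 / 3 : ℂ) • (toEnd (φ z) - (2 : ℂ)⁻¹ • 1) with hP
    have hP1 : ∀ w k, e₀ (P w) k = if S k then e₀ w k else 0 := by
      intro w k
      simp only [hP, LinearMap.smul_apply, LinearMap.sub_apply, Module.End.one_apply, map_smul,
        map_sub, Pi.smul_apply, Pi.sub_apply, hzS]
      split_ifs
      · module
      · module
    have hxP : Commute x P :=
      (hxz.sub_right ((Commute.one_right x).smul_right _)).smul_right _
    have key : toEnd (φ γ) = amp e₀ ((γ : Std n ≃ₗ[ℂ] Std n) : Std n →ₗ[ℂ] Std n) * P +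
        amp e₀ (contra hBf (γ : Std n ≃ₗ[ℂ] Std n) : Std n →ₗ[ℂ] Std n) * (1 - P) := by
      ext w
      apply e₀.injective
      ext1 k
      rw [LinearMap.add_apply, map_add, Pi.add_apply, Module.End.mul_apply, Module.End.mul_apply,
        amp_apply, amp_apply, LinearMap.sub_apply, map_sub, Pi.sub_apply, hP1,
        Module.End.one_apply, he₀, hE, he₀]
      have hS : S k = (τ.symm k).isLeft := rfl
      rcases hi : τ.symm k with i | i <;> simp [hS, hi]
    rw [key]
    exact ((hamp _).mul_right hxP).add_right
      ((hamp _).mul_right ((Commute.one_right x).sub_right hxP))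
  obtain ⟨β, hβε, hβ, hX, -, hY, hpair⟩ := exists_isSinglePair_blockGroup hω hω' hn hBf hε
    e₀ hΦ hH hHG ⟨z, rfl⟩ S two_ne_zero (by norm_num) (by norm_num) hzS hgen
  refine ⟨β, hβε, hβ, _, _, isCompl_coordSubspace S, fun x hx x' hx' => ?_,
    fun y hy y' hy' => ?_, hpair⟩
  · have := hX x hx x' hx'
    linear_combination this / 3
  · have := hY y hy y' hy'
    linear_combination -this * 4 / 3

end FormReciprocity

/-! ### Reciprocals of the decomposition pairs of orthogonal and symplectic groups -/

section FormDecomposition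

variable {W : Type u} [AddCommGroup W] [Module ℂ W] {ω : LinearMap.BilinForm ℂ W}
  (hω : ω.IsAlt) (hω' : ω.Nondegenerate) {n a p q : ℕ} (hp : 0 < p) (hq : 0 < q)
  {Bf : LinearMap.BilinForm ℂ (Std n)} (hBf : Bf.Nondegenerate)
  {ε : ℂ} (hε : ∀ x y, Bf x y = ε * Bf y x) {G H : Subgroup (isometryGroup ω)}
  {X Y : Submodule ℂ (Std n)} (hXY : IsCompl X Y)

theorem mem_map_subgroupOf_iff {C D : Subgroup (Std n ≃ₗ[ℂ] Std n)}
    {φ : C →* isometryGroup ω} (h : isometryGroup ω) :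
    h ∈ (D.subgroupOf C).map φ ↔ ∃ g : C, (g : Std n ≃ₗ[ℂ] Std n) ∈ D ∧ φ g = h := by
  rw [Subgroup.mem_map]
  rfl

include hω hω' hp hq hBf hε hXY in
/-- The reciprocal of the stabilizer of an orthogonal decomposition. -/
theorem IsSinglePair.reciprocal_of_orthogonal (hX : Module.finrank ℂ X = p)
    (hY : Module.finrank ℂ Y = q) (horth : ∀ x ∈ X, ∀ y ∈ Y, Bf x y = 0)
    (h : IsSinglePair (isometryGroup Bf) (blockGroup X Y) a 0 G H) :
    ∃ β : LinearMap.BilinForm ℂ (Std a), (∀ m m', β m m' = -ε * β m' m) ∧ β.Nondegenerate ∧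
      IsDiagonalPair (isometryGroup β) p 0 q 0 (commutant H) (commutant G) := by
  obtain ⟨φ, ⟨hφ, e, he⟩, rfl, rfl⟩ := h
  have : Nonempty (Fin p) := ⟨⟨0, hp⟩⟩
  have : Nonempty (Fin q) := ⟨⟨0, hq⟩⟩
  let e₀ : W ≃ₗ[ℂ] (Fin a → Std n) := e.trans LinearEquiv.prodUnique
  have hΦ : ∀ g w k, e₀ (toEnd (φ g) w) k = toEnd g (e₀ w k) := fun g w k => (he g w).1 k
  obtain ⟨b, hbX, hbY⟩ := exists_adapted_basis hXY hX hY
  obtain ⟨β, hβε, hβ, hform⟩ := exists_multiplicity_form hBf hε e₀ b hΦ hω hω'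
  refine ⟨β, hβε, hβ, ?_⟩
  let s : Fin p ⊕ Fin q ≃ (Fin p ⊕ Fin 0) ⊕ (Fin q ⊕ Fin 0) :=
    Equiv.sumCongr (Equiv.sumEmpty _ _).symm (Equiv.sumEmpty _ _).symm
  have hs : ∀ y z, Sum.elim (twist hβ (Fin p) (Fin 0) y) (twist hβ (Fin q) (Fin 0) z) ∘ s =
      Sum.elim (fun _ => y) (fun _ => z) := by
    intro y z
    ext (i | i) : 1 <;> rfl
  refine isDiagonalPair_of_coordinates hβ hp hq
    ((flipB e₀ b).trans (LinearEquiv.funCongrLeft ℂ _ s.symm)) (fun f => ?_) (fun f => ?_)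
  · simp only [fam_reindex, hs]
    exact mem_commutant_orthogonal_iff hBf hε e₀ b hΦ hXY hbX hbY hform horth
      mem_map_subgroupOf_iff f
  · simp only [fam_reindex, hs, Sum.elim_lam_const_lam_const]
    exact mem_commutant_isometries_iff hBf hε e₀ b hΦ hform (fun h => Iff.rfl) f

include hBf hXY in
/-- The form embeds an isotropic subspace into the dual of any complement of it. -/
theorem finrank_le_of_isotropic (hX : ∀ x ∈ X, ∀ x' ∈ X, Bf x x' = 0) :
    Module.finrank ℂ X ≤ Module.finrank ℂ Y := by
  rw [← Subspace.dual_finrank_eq (K := ℂ) (V := Y)]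
  let f : X →ₗ[ℂ] Module.Dual ℂ Y := Y.subtype.dualMap ∘ₗ Bf ∘ₗ X.subtype
  refine LinearMap.finrank_le_finrank_of_injective (f := f) ?_
  rw [← LinearMap.ker_eq_bot, LinearMap.ker_eq_bot']
  intro x hx
  refine Subtype.ext (hBf.1 _ fun v => ?_)
  obtain ⟨x', hx', y, hy, rfl⟩ : ∃ x ∈ X, ∃ y ∈ Y, x + y = v :=
    Submodule.mem_sup.mp (hXY.sup_eq_top ▸ Submodule.mem_top)
  have h1 : Bf x y = 0 := LinearMap.congr_fun hx ⟨y, hy⟩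
  rw [map_add, hX x x.2 x' hx', h1, add_zero]

include hBf hXY in
theorem finrank_eq_of_isotropic (hX : ∀ x ∈ X, ∀ x' ∈ X, Bf x x' = 0)
    (hY : ∀ y ∈ Y, ∀ y' ∈ Y, Bf y y' = 0) (hn : n = 2 * p) :
    Module.finrank ℂ X = p ∧ Module.finrank ℂ Y = p := by
  have h1 := finrank_le_of_isotropic hBf hXY hX
  have h2 := finrank_le_of_isotropic hBf hXY.symm hY
  have h3 := Submodule.finrank_add_eq_of_isCompl hXY
  rw [Module.finrank_fin_fun] at h3
  omega

include hω hω' hp hBf hε hXY in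
/-- The reciprocal of the stabilizer of a polarization. -/
theorem IsSinglePair.reciprocal_of_isotropic (hX : ∀ x ∈ X, ∀ x' ∈ X, Bf x x' = 0)
    (hY : ∀ y ∈ Y, ∀ y' ∈ Y, Bf y y' = 0) (hn : n = 2 * p)
    (h : IsSinglePair (isometryGroup Bf) (blockGroup X Y) a 0 G H) :
    ∃ β : LinearMap.BilinForm ℂ (Std a), (∀ m m', β m m' = -ε * β m' m) ∧ β.Nondegenerate ∧
      IsSinglePair ⊤ (isometryGroup β) p p (commutant H) (commutant G) := by
  obtain ⟨φ, ⟨hφ, e, he⟩, rfl, rfl⟩ := h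
  have : Nonempty (Fin p) := ⟨⟨0, hp⟩⟩
  let e₀ : W ≃ₗ[ℂ] (Fin a → Std n) := e.trans LinearEquiv.prodUnique
  have hΦ : ∀ g w k, e₀ (toEnd (φ g) w) k = toEnd g (e₀ w k) := fun g w k => (he g w).1 k
  obtain ⟨hXp, hYp⟩ := finrank_eq_of_isotropic hBf hXY hX hY hn
  obtain ⟨b, hbX, hbY⟩ := exists_adapted_basis hXY hXp hYp
  obtain ⟨β, hβε, hβ, hform⟩ := exists_multiplicity_form hBf hε e₀ b hΦ hω hω'
  refine ⟨β, hβε, hβ, isSinglePair_of_coordinates hβ hp (flipB e₀ b) (fun f => ?_) (fun f => ?_)⟩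
  · rw [mem_commutant_isotropic_iff hBf hε e₀ b hΦ hXY hbX hbY hform hX hY hβ hβε
      mem_map_subgroupOf_iff f]
    simp
  · rw [mem_commutant_isometries_iff hBf hε e₀ b hΦ hform (fun h => Iff.rfl) f]
    constructor
    · rintro ⟨y, hy, rfl⟩
      exact ⟨y, trivial, hy, by rw [twist_eq_const hβ hy]⟩
    · rintro ⟨y, -, hy, rfl⟩
      exact ⟨y, hy, by rw [twist_eq_const hβ hy]⟩

include hXY in
/-- The decomposition into two subspaces is the fixed decomposition of an inner involution. -/
theorem IsSinglePair.isSymmetricSubgroup_of_decomposition {b : ℕ}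
    {C : Subgroup (Std n ≃ₗ[ℂ] Std n)} {c : ℂ} (hc : c ≠ 0)
    (hC : ∀ s : Std n ≃ₗ[ℂ] Std n, (∀ x ∈ X, s x = c • x) → (∀ y ∈ Y, s y = -c • y) → s ∈ C)
    (h : IsSinglePair C (blockGroup X Y) a b G H) : IsSymmetricSubgroup H G := by
  obtain ⟨s, hsX, hsY⟩ := exists_scaling_equiv hXY hc (neg_ne_zero.mpr hc)
  refine h.isSymmetricSubgroup_of_inner (hC s hsX hsY) (fun g => ?_) fun g _ => ?_
  · have hss : ∀ v, (s * s) v = (c * c) • v := by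
      intro v
      obtain ⟨x, hx, y, hy, rfl⟩ : ∃ x ∈ X, ∃ y ∈ Y, x + y = v :=
        Submodule.mem_sup.mp (hXY.sup_eq_top ▸ Submodule.mem_top)
      rw [LinearEquiv.mul_apply, map_add, hsX x hx, hsY y hy, map_add, map_smul, map_smul,
        hsX x hx, hsY y hy]
      module
    refine LinearEquiv.ext fun v => ?_
    change (s * s) (g v) = g ((s * s) v)
    rw [hss, hss, map_smul]
  · have hcc : c ≠ -c := fun h => hc (by linear_combination h / 2)
    rw [mem_blockGroup_iff_commute hXY (d := s) hcc hsX hsY]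
    exact ⟨fun h => LinearEquiv.ext h, fun h => LinearEquiv.congr_fun h.eq⟩

end FormDecomposition

/-! ### Reciprocals of the pairs of general linear groups -/

section LinearCommutants

variable {V : Type v} [AddCommGroup V] [Module ℂ V] [FiniteDimensional ℂ V]
  {W : Type u} [AddCommGroup W] [Module ℂ W] {ω : LinearMap.BilinForm ℂ W}
  {ι κ : Type*} [Fintype κ] [DecidableEq κ] [Fintype ι] [DecidableEq ι]
  (e₀ : W ≃ₗ[ℂ] (κ → V) × (κ → Module.Dual ℂ V))
  {Φ : (V ≃ₗ[ℂ] V) → isometryGroup ω}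
  (hΦ : ∀ g w, (∀ k, (e₀ (toEnd (Φ g) w)).1 k = g ((e₀ w).1 k)) ∧
    ∀ k v, (e₀ (toEnd (Φ g) w)).2 k v = (e₀ w).2 k ((g⁻¹ : V ≃ₗ[ℂ] V) v))
  (b : Module.Basis ι ℂ V) {e : W ≃ₗ[ℂ] (ι ⊕ ι → κ → ℂ)} {γ : κ → κ → ℂ}
  (he₁ : ∀ w s k, e w (.inl s) k = b.repr ((e₀ w).1 k) s)
  (he₂ : ∀ w s k, e w (.inr s) k = ∑ j, γ k j * (e₀ w).2 j (b s))
  {β : LinearMap.BilinForm ℂ (κ → ℂ)} (hβ : β.Nondegenerate) (hβs : ∀ m m', β m m' = β m' m)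
  (hform : ∀ w w', ω w w' = ∑ s, ∑ t, hyp s t * β (e w s) (e w' t))

omit [DecidableEq κ] in
include hΦ he₁ he₂ hβs hform in
/-- The commutant of a block diagonal subgroup of a general linear group. -/
theorem mem_commutant_linear_iff {T : Type*} {c : ι → T} (hc : Function.Surjective c)
    {P : Subgroup (V ≃ₗ[ℂ] V)} (hP : ∀ g ∈ P, ∀ s t, c s ≠ c t → b.repr (g (b t)) s = 0)
    (hP2 : ∀ u : V ≃ₗ[ℂ] V, (∀ v, u v = (2 : ℂ) • v) → u ∈ P)
    (hPt : ∀ s t, c s = c t → ∀ u : V ≃ₗ[ℂ] V, (∀ v, u v = v + b.repr v t • b s) → u ∈ P)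
    {H : Subgroup (isometryGroup ω)} (hH : ∀ h, h ∈ H ↔ ∃ g ∈ P, Φ g = h) (f : W ≃ₗ[ℂ] W) :
    f ∈ (commutant H).map (isometryGroup ω).subtype ↔
      ∃ y : T → ((κ → ℂ) ≃ₗ[ℂ] (κ → ℂ)),
        f = fam e (Sum.elim (fun s => y (c s)) (fun s => contra hβ (y (c s)))) := by
  rw [mem_map_commutant_iff e hform (hc.sumMap hc)]
  · constructor
    · rintro ⟨y, hy, rfl⟩
      refine ⟨y ∘ .inl, congrArg (fam e) ?_⟩
      ext (s | s) : 1
      · rfl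
      · refine eq_contra_of_forall hβ fun m m' => ?_
        exact hy (.inr s) (.inl s) (by simp [hyp]) m m'
    · rintro ⟨y, rfl⟩
      refine ⟨Sum.elim y fun τ => contra hβ (y τ), ?_, congrArg (fam e) ?_⟩
      · rintro (s | s) (t | t) hst m m'
        · simp [hyp] at hst
        · obtain rfl : s = t := by simpa [hyp] using hst
          change β (y (c s) m) (contra hβ (y (c s)) m') = β m m'
          rw [hβs, form_contra_apply, hβs]
        · obtain rfl : s = t := by simpa [hyp] using hst
          exact form_contra_apply hβ _ m m'
        · simp [hyp] at hst
      · ext (s | s) : 1 <;> rfl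
  · intro x hx
    have key : ∀ s t, c s = c t →
        Commute x (elem e (.inl s) (.inl t)) ∧ Commute x (elem e (.inr t) (.inr s)) :=
      fun s t hst => commute_elem_of_commute_automorphisms e₀ hΦ b he₁ he₂
        (fun u hu => hx _ ((hH _).mpr ⟨u, hP2 u hu, rfl⟩))
        fun u hu => ⟨hx _ ((hH _).mpr ⟨u, hPt s t hst u hu, rfl⟩),
          hx _ ((hH _).mpr ⟨u⁻¹, inv_mem (hPt s t hst u hu), rfl⟩)⟩
    rintro (s | s) (t | t) hst
    · exact (key s t (Sum.inl_injective hst)).1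
    · cases hst
    · cases hst
    · exact (key t s (Sum.inr_injective hst).symm).2
  · intro h hh
    obtain ⟨g, hg, rfl⟩ := (hH h).mp hh
    refine ⟨fun
      | .inl s, .inl t => b.repr (g (b t)) s
      | .inr s, .inr t => b.repr ((g⁻¹ : V ≃ₗ[ℂ] V) (b s)) t
      | _, _ => 0, ?_, ?_⟩
    · rintro (s | s) (t | t) hst
      · exact hP g hg s t fun h => hst (congrArg Sum.inl h)
      · rfl
      · rfl
      · exact hP g⁻¹ (inv_mem hg) t s fun h => hst (congrArg Sum.inr h.symm)
    · rintro w (s | s)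
      · rw [toEnd_inl e₀ hΦ b he₁]
        simp
      · rw [toEnd_inr e₀ hΦ b he₂]
        simp

end LinearCommutants

section LinearReciprocity

variable {W : Type u} [AddCommGroup W] [Module ℂ W] {ω : LinearMap.BilinForm ℂ W}
  (hω : ω.IsAlt) (hω' : ω.Nondegenerate) {G H : Subgroup (isometryGroup ω)}

theorem nondegenerate_dot (κ : Type*) [Fintype κ] [DecidableEq κ] :
    (Matrix.toBilin' (1 : Matrix κ κ ℂ)).Nondegenerate :=
  LinearMap.BilinForm.nondegenerate_toBilin'_of_det_ne_zero' _ (by simp)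

theorem dot_comm {κ : Type*} [Fintype κ] [DecidableEq κ] (m m' : κ → ℂ) :
    Matrix.toBilin' (1 : Matrix κ κ ℂ) m m' = Matrix.toBilin' (1 : Matrix κ κ ℂ) m' m := by
  simp [Matrix.toBilin'_apply, Matrix.one_apply, mul_comm]

include hω hω' in
/-- The reciprocal of the diagonal in a product of two general linear groups. -/
theorem IsDiagonalPair.reciprocal_of_linear {n m l : ℕ} (hn : 0 < n)
    (h : IsDiagonalPair (⊤ : Subgroup (Std n ≃ₗ[ℂ] Std n)) m m l l G H) :
    ∃ X Y : Submodule ℂ (Std (m + l)), IsCompl X Y ∧ Module.finrank ℂ X = m ∧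
      Module.finrank ℂ Y = l ∧
      IsSinglePair ⊤ (blockGroup X Y) n n (commutant H) (commutant G) := by
  obtain ⟨φ, hφ, rfl, rfl⟩ := h
  obtain ⟨e₁, he₁⟩ := hφ.exists_regroup
  let τ : Fin m ⊕ Fin l ≃ Fin (m + l) := finSumFinEquiv
  let e₀ : W ≃ₗ[ℂ] (Fin (m + l) → Std n) × (Fin (m + l) → Module.Dual ℂ (Std n)) :=
    e₁.trans (LinearEquiv.prodCongr (LinearEquiv.funCongrLeft ℂ _ τ.symm)
      (LinearEquiv.funCongrLeft ℂ _ τ.symm))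
  have he₀ : ∀ w k, (e₀ w).1 k = (e₁ w).1 (τ.symm k) := fun w k => rfl
  have he₀' : ∀ w k, (e₀ w).2 k = (e₁ w).2 (τ.symm k) := fun w k => rfl
  let S : Fin (m + l) → Bool := fun k => (τ.symm k).isLeft
  let Φ : (Std n ≃ₗ[ℂ] Std n) → isometryGroup ω := fun g => φ (⟨g, trivial⟩, ⟨g, trivial⟩)
  have hΦ : ∀ g w, (∀ k, (e₀ (toEnd (Φ g) w)).1 k = g ((e₀ w).1 k)) ∧
      ∀ k v, (e₀ (toEnd (Φ g) w)).2 k v = (e₀ w).2 k ((g⁻¹ : Std n ≃ₗ[ℂ] Std n) v) := by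
    refine fun g w => ⟨fun k => ?_, fun k v => ?_⟩
    · rw [he₀, he₀, (he₁ _ _).1]
      rcases τ.symm k with i | i <;> rfl
    · rw [he₀', he₀', (he₁ _ _).2]
      rcases τ.symm k with i | i <;> rfl
  let b := Pi.basisFun ℂ (Fin n)
  have : Nonempty (Fin n) := ⟨⟨0, hn⟩⟩
  obtain ⟨γ, hγ⟩ := exists_pairing_eq e₀ hΦ hω
  obtain ⟨e, hinl, hinr, hform⟩ := exists_hyperbolic_coordinates e₀ b hω' hγ
  have hβ := nondegenerate_dot (Fin (m + l))
  let F : (Std (m + l) ≃ₗ[ℂ] Std (m + l)) →* (W ≃ₗ[ℂ] W) :=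
    (fam e).comp (twist hβ (Fin n) (Fin n))
  have hF : Function.Injective F := fun y z h => congrFun (fam_injective e h) (.inl ⟨0, hn⟩)
  set H := (φ.comp ((MonoidHom.id (⊤ : Subgroup (Std n ≃ₗ[ℂ] Std n))).prod
    (MonoidHom.id _))).range with hHdef
  have hH : ∀ h, h ∈ H ↔ ∃ g ∈ (⊤ : Subgroup (Std n ≃ₗ[ℂ] Std n)), Φ g = h := by
    intro h
    constructor
    · rintro ⟨g, rfl⟩
      exact ⟨g, trivial, rfl⟩
    · rintro ⟨g, -, rfl⟩
      exact ⟨⟨g, trivial⟩, rfl⟩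
  have hK : ∀ f, f ∈ (commutant H).map (isometryGroup ω).subtype ↔
      ∃ y ∈ (⊤ : Subgroup (Std (m + l) ≃ₗ[ℂ] Std (m + l))), f = F y := by
    intro f
    rw [mem_commutant_linear_iff e₀ hΦ b hinl hinr hβ dot_comm hform (c := fun _ => ())
      (fun _ => ⟨⟨0, hn⟩, rfl⟩) (P := ⊤) (fun g _ s t hst => absurd rfl hst) (fun _ _ => trivial)
      (fun _ _ _ _ _ => trivial) hH]
    constructor
    · rintro ⟨y, rfl⟩
      exact ⟨y (), trivial, rfl⟩
    · rintro ⟨y, -, rfl⟩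
      exact ⟨fun _ => y, rfl⟩
  let z : (⊤ : Subgroup (Std n ≃ₗ[ℂ] Std n)) := ⟨LinearEquiv.neg ℂ, trivial⟩
  have hz : ∀ v, (z : Std n ≃ₗ[ℂ] Std n) v = -v := fun v => rfl
  -- the element `(1, -1)` belongs to the commutant of the diagonal
  have hσ : φ (1, z) ∈ commutant H := by
    rw [Subgroup.mem_centralizer_iff]
    rintro _ ⟨g, rfl⟩
    change φ (g, g) * φ (1, z) = φ (1, z) * φ (g, g)
    rw [← map_mul, ← map_mul, Prod.mk_mul_mk, Prod.mk_mul_mk, mul_one, one_mul]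
    congr 2
    refine Subtype.ext (LinearEquiv.ext fun v => ?_)
    exact map_neg (g : Std n ≃ₗ[ℂ] Std n) v
  obtain ⟨d, -, hσd⟩ := (hK (φ (1, z))).mp ⟨_, hσ, rfl⟩
  have hd : ∀ u k, d u k = (if S k then (1 : ℂ) else -1) * u k := by
    intro u k
    have h1 : e (toEnd (φ (1, z)) (e.symm fun _ => u)) (.inl ⟨0, hn⟩) = d u := by
      rw [toEnd_apply, hσd]
      simp [F]
    rw [← h1, hinl, he₀, (he₁ _ _).1]
    have h2 : u k = b.repr ((e₁ (e.symm fun _ => u)).1 (τ.symm k)) ⟨0, hn⟩ := by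
      rw [← he₀, ← hinl, LinearEquiv.apply_symm_apply]
    rw [h2]
    have hS : S k = (τ.symm k).isLeft := rfl
    rcases hi : τ.symm k with i | i
    · simp [hS, hi]
    · simp [hS, hi, hz]
  have hHG : H ≤ φ.range := by
    rintro _ ⟨γ, rfl⟩
    exact ⟨(γ, γ), rfl⟩
  refine ⟨_, _, isCompl_coordSubspace S, ?_, ?_,
    isSinglePair_of_coordinates hβ hn e hK fun f => ?_⟩
  · rw [finrank_coordSubspace, card_isLeft_symm, Fintype.card_fin]
  · rw [finrank_coordSubspace, card_not_isLeft_symm, Fintype.card_fin]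
  · simp only [mem_blockGroup_coordSubspace_iff (show (1 : ℂ) ≠ -1 by norm_num) hd]
    refine mem_commutant_iff_of_generation hF
      (C := (⊤ : Subgroup (Std (m + l) ≃ₗ[ℂ] Std (m + l)))) hK hHG ⟨_, rfl⟩ hσd ?_ f
    rintro x hx hxz _ ⟨γ, rfl⟩
    exact commute_of_commute_diagonal hφ hz (fun γ => hx _ ⟨γ, rfl⟩) hxz γ

include hω hω' in
/-- The reciprocal of the stabilizer of a direct sum decomposition in a general linear group. -/
theorem IsSinglePair.reciprocal_of_isCompl {n l p q : ℕ} (hp : 0 < p) (hq : 0 < q)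
    {X Y : Submodule ℂ (Std n)} (hXY : IsCompl X Y) (hX : Module.finrank ℂ X = p)
    (hY : Module.finrank ℂ Y = q) (h : IsSinglePair ⊤ (blockGroup X Y) l l G H) :
    IsDiagonalPair (⊤ : Subgroup (Std l ≃ₗ[ℂ] Std l)) p p q q (commutant H) (commutant G) := by
  obtain ⟨φ, ⟨-, e₀, he₀⟩, rfl, rfl⟩ := h
  let Φ : (Std n ≃ₗ[ℂ] Std n) → isometryGroup ω := fun g => φ ⟨g, trivial⟩
  have hΦ : ∀ g w, (∀ k, (e₀ (toEnd (Φ g) w)).1 k = g ((e₀ w).1 k)) ∧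
      ∀ k v, (e₀ (toEnd (Φ g) w)).2 k v = (e₀ w).2 k ((g⁻¹ : Std n ≃ₗ[ℂ] Std n) v) :=
    fun g w => he₀ ⟨g, trivial⟩ w
  obtain ⟨b, hbX, hbY⟩ := exists_adapted_basis hXY hX hY
  obtain ⟨γ, hγ⟩ := exists_pairing_eq e₀ hΦ hω
  obtain ⟨e, hinl, hinr, hform⟩ := exists_hyperbolic_coordinates e₀ b hω' hγ
  have hβ := nondegenerate_dot (Fin l)
  let s : (Fin p ⊕ Fin q) ⊕ (Fin p ⊕ Fin q) ≃ (Fin p ⊕ Fin p) ⊕ (Fin q ⊕ Fin q) :=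
    Equiv.sumSumSumComm _ _ _ _
  have hs : ∀ y z : Std l ≃ₗ[ℂ] Std l, Sum.elim (twist hβ (Fin p) (Fin p) y)
      (twist hβ (Fin q) (Fin q) z) ∘ s =
      Sum.elim (Sum.elim (fun _ => y) fun _ => z)
        (Sum.elim (fun _ => contra hβ y) fun _ => contra hβ z) := by
    intro y z
    ext ((i | i) | (i | i)) : 1 <;> rfl
  refine isDiagonalPair_of_coordinates hβ hp hq
    (e.trans (LinearEquiv.funCongrLeft ℂ _ s.symm)) (fun f => ?_) (fun f => ?_)
  · simp only [fam_reindex, hs]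
    rw [mem_commutant_linear_iff e₀ hΦ b hinl hinr hβ dot_comm hform (c := Sum.isLeft)
      (P := blockGroup X Y)]
    · constructor
      · rintro ⟨y, rfl⟩
        refine ⟨y true, trivial, y false, trivial, congrArg (fam e) ?_⟩
        ext ((i | i) | (i | i)) : 1 <;> rfl
      · rintro ⟨y, -, z, -, rfl⟩
        refine ⟨fun t => if t then y else z, congrArg (fam e) ?_⟩
        ext ((i | i) | (i | i)) : 1 <;> rfl
    · rintro (_ | _)
      · exact ⟨.inr ⟨0, hq⟩, rfl⟩
      · exact ⟨.inl ⟨0, hp⟩, rfl⟩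
    · rintro g hg (i | i) (j | j) hij
      · simp at hij
      · exact repr_inl_eq_zero hXY b hbX hbY ((hg.2 _).mpr (hbY j)) i
      · exact repr_inr_eq_zero hXY b hbX hbY ((hg.1 _).mpr (hbX j)) i
      · simp at hij
    · intro u hu
      refine ⟨fun x => ?_, fun x => ?_⟩ <;>
      · rw [hu]
        exact Submodule.smul_mem_iff _ two_ne_zero
    · intro i j hij u hu
      obtain ⟨π, hπX, hπY⟩ := exists_scaling hXY 1 0
      rw [mem_blockGroup_iff_commute hXY one_ne_zero hπX hπY]
      intro v
      obtain ⟨x, hx, y, hy, rfl⟩ : ∃ x ∈ X, ∃ y ∈ Y, x + y = v :=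
        Submodule.mem_sup.mp (hXY.sup_eq_top ▸ Submodule.mem_top)
      simp only [map_add, hπX x hx, hπY y hy, one_smul, zero_smul, add_zero]
      rcases i with i | i <;> rcases j with j | j
      · have h1 : u y = y := by rw [hu, repr_inl_eq_zero hXY b hbX hbY hy]; simp
        have h2 : u x ∈ X := by
          rw [hu]
          exact X.add_mem hx (X.smul_mem _ (hbX i))
        rw [h1, hπY y hy, hπX _ h2]
        simp
      · simp at hij
      · simp at hij
      · have h1 : u x = x := by rw [hu, repr_inr_eq_zero hXY b hbX hbY hx]; simp
        have h2 : u y ∈ Y := by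
          rw [hu]
          exact Y.add_mem hy (Y.smul_mem _ (hbY i))
        rw [h1, hπX x hx, hπY _ h2]
        simp
    · intro h
      rw [mem_map_subgroupOf_iff]
      exact ⟨fun ⟨g, hg, h⟩ => ⟨g, hg, h⟩, fun ⟨g, hg, h⟩ => ⟨⟨g, trivial⟩, hg, h⟩⟩
  · simp only [fam_reindex, hs]
    rw [mem_commutant_linear_iff e₀ hΦ b hinl hinr hβ dot_comm hform (c := fun _ => ())
      (fun _ => ⟨.inl ⟨0, hp⟩, rfl⟩) (P := ⊤) (fun g _ s t hst => absurd rfl hst)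
      (fun _ _ => trivial) (fun _ _ _ _ _ => trivial)]
    · constructor
      · rintro ⟨y, rfl⟩
        refine ⟨y (), trivial, congrArg (fam e) ?_⟩
        ext ((i | i) | (i | i)) : 1 <;> rfl
      · rintro ⟨y, -, rfl⟩
        refine ⟨fun _ => y, congrArg (fam e) ?_⟩
        ext ((i | i) | (i | i)) : 1 <;> rfl
    · exact fun h => ⟨fun ⟨g, h⟩ => ⟨g, trivial, h⟩, fun ⟨g, _, h⟩ => ⟨⟨g, trivial⟩, h⟩⟩

end LinearReciprocity

/-! ### The ten families -/

section Positivity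

variable {W : Type u} [AddCommGroup W] [Module ℂ W] {ω : LinearMap.BilinForm ℂ W} {n : ℕ}
  {C D : Subgroup (Std n ≃ₗ[ℂ] Std n)} {G H : Subgroup (isometryGroup ω)}

theorem neg_mem_isometryGroup {V : Type u} [AddCommGroup V] [Module ℂ V]
    (B : LinearMap.BilinForm ℂ V) : LinearEquiv.neg ℂ ∈ isometryGroup B :=
  fun x y => by simp

theorem neg_ne_one (hn : 0 < n) : (LinearEquiv.neg ℂ : Std n ≃ₗ[ℂ] Std n) ≠ 1 := by
  intro h
  have h1 := congrFun (LinearEquiv.congr_fun h fun _ => 1) ⟨0, hn⟩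
  simp only [LinearEquiv.neg_apply, Pi.neg_apply, LinearEquiv.coe_one, id] at h1
  norm_num at h1

/-- A faithful representation of a nontrivial group is nonzero. -/
theorem IsSinglePair.pos {a b : ℕ} (hn : 0 < n) (hC : LinearEquiv.neg ℂ ∈ C)
    (h : IsSinglePair C D a b G H) : 0 < a ∨ 0 < b := by
  obtain ⟨φ, ⟨hφ, e, he⟩, -, -⟩ := h
  by_contra! hab
  obtain ⟨rfl, rfl⟩ : a = 0 ∧ b = 0 := by omega
  have : Subsingleton W := e.toEquiv.subsingleton
  have h1 : (⟨LinearEquiv.neg ℂ, hC⟩ : C) = 1 :=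
    hφ (Subtype.ext (LinearEquiv.ext fun w => Subsingleton.elim _ _))
  exact neg_ne_one hn (congrArg Subtype.val h1)

/-- A product of two groups acts faithfully only if both factors have standard modules in `W`. -/
theorem IsDiagonalPair.pos {a b c d : ℕ} (hn : 0 < n) (hC : LinearEquiv.neg ℂ ∈ C)
    (h : IsDiagonalPair C a b c d G H) : (0 < a ∨ 0 < b) ∧ (0 < c ∨ 0 < d) := by
  obtain ⟨φ, ⟨hφ, e, he⟩, -, -⟩ := h
  let z : C := ⟨LinearEquiv.neg ℂ, hC⟩
  have hz : z ≠ 1 := fun h1 => neg_ne_one hn (congrArg Subtype.val h1)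
  constructor
  · by_contra! hab
    obtain ⟨rfl, rfl⟩ : a = 0 ∧ b = 0 := by omega
    refine hz (congrArg Prod.fst (hφ (Subtype.ext (LinearEquiv.ext fun w => ?_)) :
      (z, (1 : C)) = (1, 1)))
    apply e.injective
    refine Prod.ext (Subsingleton.elim _ _) (Prod.ext (funext fun i => ?_)
      (funext fun j => LinearMap.ext fun v => ?_))
    · rw [(he _ _ _).2.2.1, (he _ _ _).2.2.1]
    · rw [(he _ _ _).2.2.2, (he _ _ _).2.2.2]
  · by_contra! hab
    obtain ⟨rfl, rfl⟩ : c = 0 ∧ d = 0 := by omega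
    refine hz (congrArg Prod.snd (hφ (Subtype.ext (LinearEquiv.ext fun w => ?_)) :
      ((1 : C), z) = (1, 1)))
    apply e.injective
    refine Prod.ext (Prod.ext (funext fun i => ?_)
      (funext fun j => LinearMap.ext fun v => ?_)) (Subsingleton.elim _ _)
    · rw [(he _ _ _).1, (he _ _ _).1]
    · rw [(he _ _ _).2.1, (he _ _ _).2.1]

end Positivity

section Families

variable {W : Type u} [AddCommGroup W] [Module ℂ W] {ω : LinearMap.BilinForm ℂ W}
  {n : ℕ} {B : LinearMap.BilinForm ℂ (Std n)} {X Y : Submodule ℂ (Std n)}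

/-- The reflection `1` on `X`, `-1` on `Y` of an orthogonal decomposition is an isometry. -/
theorem mem_isometryGroup_of_orthogonal (hXY : IsCompl X Y) {ε : ℂ}
    (hε : ∀ x y, B x y = ε * B y x) (horth : ∀ x ∈ X, ∀ y ∈ Y, B x y = 0)
    {s : Std n ≃ₗ[ℂ] Std n} (hX : ∀ x ∈ X, s x = (1 : ℂ) • x)
    (hY : ∀ y ∈ Y, s y = -(1 : ℂ) • y) : s ∈ isometryGroup B := by
  intro v v'
  obtain ⟨x, hx, y, hy, rfl⟩ : ∃ x ∈ X, ∃ y ∈ Y, x + y = v :=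
    Submodule.mem_sup.mp (hXY.sup_eq_top ▸ Submodule.mem_top)
  obtain ⟨x', hx', y', hy', rfl⟩ : ∃ x ∈ X, ∃ y ∈ Y, x + y = v' :=
    Submodule.mem_sup.mp (hXY.sup_eq_top ▸ Submodule.mem_top)
  have h1 : B y x' = 0 := by rw [hε, horth x' hx' y hy, mul_zero]
  simp [hX x hx, hY y hy, hX x' hx', hY y' hy', horth x hx y' hy', h1]

/-- For a polarization the inner involution is that of `i` on `X`, `-i` on `Y`: scalars `1`, `-1`
would not preserve the form, which pairs `X` with `Y`. -/
theorem mem_isometryGroup_of_isotropic (hXY : IsCompl X Y)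
    (hBX : ∀ x ∈ X, ∀ x' ∈ X, B x x' = 0) (hBY : ∀ y ∈ Y, ∀ y' ∈ Y, B y y' = 0)
    {s : Std n ≃ₗ[ℂ] Std n} (hX : ∀ x ∈ X, s x = Complex.I • x)
    (hY : ∀ y ∈ Y, s y = -Complex.I • y) : s ∈ isometryGroup B := by
  intro v v'
  obtain ⟨x, hx, y, hy, rfl⟩ : ∃ x ∈ X, ∃ y ∈ Y, x + y = v :=
    Submodule.mem_sup.mp (hXY.sup_eq_top ▸ Submodule.mem_top)
  obtain ⟨x', hx', y', hy', rfl⟩ : ∃ x ∈ X, ∃ y ∈ Y, x + y = v' :=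
    Submodule.mem_sup.mp (hXY.sup_eq_top ▸ Submodule.mem_top)
  simp only [map_add, hX x hx, hY y hy, hX x' hx', hY y' hy', LinearMap.add_apply, map_smul,
    LinearMap.smul_apply, smul_eq_mul, hBX x hx x' hx', hBY y hy y' hy']
  linear_combination (-B x y' - B y x') * Complex.I_mul_I

/-- Each of the ten classical families consists of symmetric pairs, and is exchanged with its
reciprocal family by passing to commutants. -/
theorem Family.IsPair.reciprocal (hω : ω.IsAlt) (hω' : ω.Nondegenerate) {r : Family}
    {G H : Subgroup (isometryGroup ω)} (h : r.IsPair G H) :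
    IsSymmetricSubgroup H G ∧ r.reciprocal.IsPair (commutant H) (commutant G) := by
  cases r with
  | diagGL n m l =>
    obtain ⟨hn, h⟩ := h
    obtain ⟨hm, hl⟩ := h.pos hn (Subgroup.mem_top _)
    rw [or_self] at hm hl
    exact ⟨h.isSymmetricSubgroup hm hl (by simp [hm, hl]), hm, hl,
      h.reciprocal_of_linear hω hω' hn⟩
  | diagO n m l =>
    obtain ⟨hn, B, hB, hB', h⟩ := h
    obtain ⟨hm, hl⟩ := h.pos hn (neg_mem_isometryGroup B)
    refine ⟨h.isSymmetricSubgroup (by omega) (by omega) Iff.rfl, by omega, by omega, ?_⟩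
    obtain ⟨β, hβ, hβ', h⟩ := h.reciprocal_of_form hω hω' hn hB' (swap_of_isSymm hB)
      (mul_add 2 m l).symm
    exact ⟨β, isAlt_of_swap hβ, hβ', h⟩
  | diagSp n m l =>
    obtain ⟨hn, B, hB, hB', h⟩ := h
    obtain ⟨hm, hl⟩ := h.pos (by omega) (neg_mem_isometryGroup B)
    refine ⟨h.isSymmetricSubgroup (by omega) (by omega) Iff.rfl, by omega, by omega, ?_⟩
    obtain ⟨β, hβ, hβ', h⟩ := h.reciprocal_of_form hω hω' (by omega) hB' (swap_of_isAlt hB) rfl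
    exact ⟨β, isSymm_of_swap hβ, hβ', h⟩
  | sumGL n m l =>
    obtain ⟨hn, hm, X, Y, hXY, hX, hY, h⟩ := h
    have hl := h.pos (by omega) (Subgroup.mem_top _)
    rw [or_self] at hl
    exact ⟨h.isSymmetricSubgroup_of_decomposition hXY one_ne_zero
      fun _ _ _ => Subgroup.mem_top _, hl,
      h.reciprocal_of_isCompl hω hω' hn hm hXY hX hY⟩
  | sumO n m l =>
    obtain ⟨hn, hm, B, hB, hB', X, Y, hXY, hX, hY, horth, h⟩ := h
    have hl := h.pos (by omega) (neg_mem_isometryGroup B)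
    refine ⟨h.isSymmetricSubgroup_of_decomposition hXY one_ne_zero fun s hsX hsY =>
      mem_isometryGroup_of_orthogonal hXY (swap_of_isSymm hB) horth hsX hsY, by omega, ?_⟩
    obtain ⟨β, hβ, hβ', h⟩ := h.reciprocal_of_orthogonal hω hω' hn hm hB' (swap_of_isSymm hB)
      hXY hX hY horth
    exact ⟨β, isAlt_of_swap hβ, hβ', h⟩
  | sumSp n m l =>
    obtain ⟨hn, hm, B, hB, hB', X, Y, hXY, hX, hY, horth, h⟩ := h
    have hl := h.pos (by omega) (neg_mem_isometryGroup B)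
    refine ⟨h.isSymmetricSubgroup_of_decomposition hXY one_ne_zero fun s hsX hsY =>
      mem_isometryGroup_of_orthogonal hXY (swap_of_isAlt hB) horth hsX hsY, by omega, ?_⟩
    obtain ⟨β, hβ, hβ', h⟩ := h.reciprocal_of_orthogonal hω hω' (by omega) (by omega) hB'
      (swap_of_isAlt hB) hXY hX hY horth
    exact ⟨β, isSymm_of_swap hβ, hβ', h⟩
  | polO n m =>
    obtain ⟨hn, B, hB, hB', X, Y, hXY, hX, hY, h⟩ := h
    have hm := h.pos (by omega) (neg_mem_isometryGroup B)
    refine ⟨h.isSymmetricSubgroup_of_decomposition hXY Complex.I_ne_zero fun s hsX hsY =>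
      mem_isometryGroup_of_isotropic hXY hX hY hsX hsY, by omega, ?_⟩
    obtain ⟨β, hβ, hβ', h⟩ := h.reciprocal_of_isotropic hω hω' hn hB' (swap_of_isSymm hB)
      hXY hX hY rfl
    exact ⟨β, isAlt_of_swap hβ, hβ', h⟩
  | polSp n m =>
    obtain ⟨hn, B, hB, hB', X, Y, hXY, hX, hY, h⟩ := h
    have hm := h.pos (by omega) (neg_mem_isometryGroup B)
    refine ⟨h.isSymmetricSubgroup_of_decomposition hXY Complex.I_ne_zero fun s hsX hsY =>
      mem_isometryGroup_of_isotropic hXY hX hY hsX hsY, by omega, ?_⟩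
    obtain ⟨β, hβ, hβ', h⟩ := h.reciprocal_of_isotropic hω hω' hn hB' (swap_of_isAlt hB)
      hXY hX hY rfl
    exact ⟨β, isSymm_of_swap hβ, hβ', h⟩
  | bilO n m =>
    obtain ⟨hn, B, hB, hB', h⟩ := h
    have hm := h.pos hn (Subgroup.mem_top _)
    refine ⟨h.isSymmetricSubgroup_of_contra hB' (swap_of_isSymm hB), by omega, ?_⟩
    obtain ⟨β, hβ, hβ', h⟩ := h.reciprocal_of_form hω hω' hn hB' (swap_of_isSymm hB)
      (two_mul m).symm
    exact ⟨β, isAlt_of_swap hβ, hβ', h⟩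
  | bilSp n m =>
    obtain ⟨hn, B, hB, hB', h⟩ := h
    have hm := h.pos (by omega) (Subgroup.mem_top _)
    refine ⟨h.isSymmetricSubgroup_of_contra hB' (swap_of_isAlt hB), by omega, ?_⟩
    obtain ⟨β, hβ, hβ', h⟩ := h.reciprocal_of_form hω hω' (by omega) hB' (swap_of_isAlt hB)
      (two_mul m).symm
    exact ⟨β, isSymm_of_swap hβ, hβ', h⟩

end Families

end Reciprocity

theorem proposition4p2 {W : Type*} [AddCommGroup W] [Module ℂ W] [FiniteDimensional ℂ W]
    (ω : LinearMap.BilinForm ℂ W) (hω : ω.IsAlt) (hω' : ω.Nondegenerate)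
    (G G' : Subgroup (Reciprocity.isometryGroup ω)) (hG : Reciprocity.IsDualPair G G') :
    (∀ H : Subgroup (Reciprocity.isometryGroup ω),
      (Reciprocity.IsClassical G ∨ Reciprocity.IsClassicalSq G) →
      Reciprocity.IsSymmetricSubgroup H G →
        Reciprocity.IsDualPair H (Reciprocity.commutant H) ∧
        Reciprocity.IsSymmetricSubgroup G' (Reciprocity.commutant H)) ∧
    (∀ (H : Subgroup (Reciprocity.isometryGroup ω)) (r : Reciprocity.Family),
      r.IsPair G H →
        Reciprocity.IsSymmetricSubgroup H G ∧
        r.reciprocal.IsPair (Reciprocity.commutant H) G') := by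
  obtain rfl := hG.eq_right
  exact ⟨fun H _ hH => Reciprocity.reciprocity hω' (Reciprocity.swap_of_isAlt hω) hG hH,
    fun H r h => h.reciprocal hω hω'⟩
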